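/- Let $N\ge 3$ be an integer, let $q$ be a nonzero complex number with $q^m\neq 1$ for all integers $m\ge 1$, and let $c$ be a complex number such that $c^2$ is a nonzero real number. Put $q_\pm=q\pm q^{-1}$, $i'=N+1-i$ for $1\le i\le N$, $\rho_i=N/2-i$ if $i<i'$, $\rho_i=-(N/2-i')$ if $i'<i$, $\rho_i=0$ if $i=i'$, and (repeated indices being summed over $1,\dots,N$) $$C^{ij}=C_{ij}=q^{-2\rho_i}\delta^i_{j'},\qquad K^{ij}_{kl}=C^{ij}C_{kl},$$ $$\hat R^{ij}_{kl}=q^{2\delta^i_j-2\delta^i_{j'}}\delta^i_l\delta^j_k+(q^2-q^{-2})\,\delta_{i<l}\,(\delta^i_k\delta^j_l-K^{ij}_{kl}),$$ $$P_+=\frac{1}{q^2+q^{-2}}\Bigl(q^{-2}\,\mathrm{id}+\hat R-\frac{q_+q_-}{q^{2N}-1}K\Bigr),$$ where $\delta_{i<l}=1$ if $i<l$ and $0$ otherwise. Let $\mathrm{Cl}_q(N)$ be the complex unital algebra generated by $\gamma_1,\dots,\gamma_N$ with relations $$P_+{}^{kl}_{ij}\,\gamma_k\gamma_l=0\quad(i,j=1,\dots,N),\qquad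 C^{ij}\gamma_i\gamma_j=c^2\,\frac{q^{2N}-1}{q^2-1}.$$ Let $\Lambda(O_q^N)$ be the algebra defined in the same way with $c$ replaced by $0$, with product $\wedge$. Let $V$ be the vector space with basis $\gamma_1,\dots,\gamma_N$ and let $V^{\wedge m}\subseteq\Lambda(O_q^N)$ be the image of $V^{\otimes m}$. A matrix $M^{ij}_{kl}$ acts on $V\otimes V$ by $\gamma_k\otimes\gamma_l\mapsto M^{ij}_{kl}\,\gamma_i\otimes\gamma_j$, and $M_{i,i+1}$ denotes this operator acting in the tensor factors $i,i+1$. On $V^{\otimes(k+1)}$ set $$d'^-_{k+1,i}=K_{12}K_{23}\cdots K_{k-i+1,k-i+2}\sum_{j=0}^{i-1}(-q^{-2})^j\prod_{l=1}^{j}\hat R_{k-i+1+l,\,k-i+2+l}\qquad(1\le i\le k),$$ $$b^-_{1,k}=\sum_{i=0}^{k}(-q^{-2})^i\hat R_{12}\hat R_{23}\cdots\hat R_{i,i+1}-\frac{q_+q_-}{1+q^{2N-4k}}\sum_{i=1}^{k}q^{4i-4k-2}\,d'^-_{k+1,i},$$ where products are ordered from left to right. Let $g(\gamma_i\otimes\gamma_j)=c^2q^{2N-3}q_+C_{ij}/(q^{2N-4}+1)$,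 let $g_{12}$ be $g$ applied to the first two tensor factors, and for $t\in V^{\otimes m}$ put $\langle\gamma_i,t\rangle=g_{12}\bigl(\gamma_i\otimes b^-_{1,m-1}(t)\bigr)\in V^{\otimes(m-1)}$ if $m\ge 1$ and $\langle\gamma_i,t\rangle=0$ if $m=0$. Then there exists a representation $\triangleright$ of $\mathrm{Cl}_q(N)$ on $\Lambda(O_q^N)$ such that $$\gamma_i\triangleright\rho_m=\gamma_i\wedge\rho_m+\frac{1+q^{2N-4}}{1+q^{2N-4m}}\,\langle\gamma_i,\rho_m\rangle$$ for all $m\in\{0,1,\dots,N\}$, all $\rho_m\in V^{\wedge m}$ and all $i=1,\dots,N$, where for $\rho_m$ the class of $t\in V^{\otimes m}$ the symbol $\langle\gamma_i,\rho_m\rangle$ means the class of $\langle\gamma_i,t\rangle$ in $\Lambda(O_q^N)$ (for every choice of $t$). Moreover, every representation $\triangleright$ of $\mathrm{Cl}_q(N)$ on $\Lambda(O_q^N)$ satisfying this formula is faithful, i.e. the algebra homomorphism $\mathrm{Cl}_q(N)\to\mathrm{End}(\Lambda(O_q^N))$ is injective. -/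

import Mathlib

noncomputable section

namespace FRT

/-! Indices `i : Fin N` are `0`-based: `i` stands for the index `i + 1` of `{1, …, N}`, and
`Fin.rev i` stands for `i' = N + 1 - i`. -/

/-- `2 ρ_i`, an integer, where
`ρ_i = δ_{i<i'} (N/2 - i) - δ_{i'<i} (N/2 - i')` for `i ∈ {1, …, N}`. -/
def twoRho (N : ℕ) (i : Fin N) : ℤ :=
  (if i < i.rev then (N : ℤ) - 2 * ((i : ℤ) + 1) else 0)
    - (if i.rev < i then (N : ℤ) - 2 * ((i.rev : ℤ) + 1) else 0)

/-- `q_+ = q + q⁻¹`. -/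
def qPlus (q : ℂ) : ℂ := q + q⁻¹

/-- `q_- = q - q⁻¹`. -/
def qMinus (q : ℂ) : ℂ := q - q⁻¹

/-- Kronecker's symbol. -/
def delta {N : ℕ} (i j : Fin N) : ℂ := if i = j then 1 else 0

/-- The metric `C^{ij} = C_{ij} = q^{-2ρ_i} δ^i_{j'}`. -/
def metric (N : ℕ) (q : ℂ) (i j : Fin N) : ℂ := q ^ (-twoRho N i) * delta i j.rev

/-- A linear endomorphism of `V ⊗ V` given by its matrix: `M i j k l` is the entry `M^{ij}_{kl}`,
so that `γ_k ⊗ γ_l ↦ ∑ M^{ij}_{kl} γ_i ⊗ γ_j`. -/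
abbrev Mat4 (N : ℕ) : Type := Fin N → Fin N → Fin N → Fin N → ℂ

/-- `K^{ij}_{kl} = C^{ij} C_{kl}`. -/
def kMat (N : ℕ) (q : ℂ) : Mat4 N := fun i j k l => metric N q i j * metric N q k l

/-- The `R̂`-matrix
`q^{2δ^i_j - 2δ^i_{j'}} δ^i_l δ^j_k + (q² - q⁻²) δ_{i<l} (δ^i_k δ^j_l - K^{ij}_{kl})`. -/
def rMat (N : ℕ) (q : ℂ) : Mat4 N := fun i j k l =>
  q ^ ((if i = j then 2 else 0) - (if i = j.rev then 2 else 0) : ℤ) * (delta i l * delta j k)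
    + (q ^ 2 - q ^ (-2 : ℤ)) * (if i < l then 1 else 0) *
        (delta i k * delta j l - kMat N q i j k l)

/-- `P_+ = (q² + q⁻²)⁻¹ (q⁻² id + R̂ - (q_+ q_- / (q^{2N} - 1)) K)`. -/
def pPlus (N : ℕ) (q : ℂ) : Mat4 N := fun i j k l =>
  1 / (q ^ 2 + q ^ (-2 : ℤ)) *
    (q ^ (-2 : ℤ) * (delta i k * delta j l) + rMat N q i j k l
      - qPlus q * qMinus q / (q ^ (2 * N) - 1) * kMat N q i j k l)

/-- The defining relations of the FRT-Clifford algebra: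
`P_+^{kl}_{ij} γ_k γ_l = 0` for all `i, j`, and
`C^{ij} γ_i γ_j = c² (q^{2N} - 1) / (q² - 1)`. -/
inductive CliffordRel (N : ℕ) (q c : ℂ) :
    FreeAlgebra ℂ (Fin N) → FreeAlgebra ℂ (Fin N) → Prop
  | plus (i j : Fin N) :
      CliffordRel N q c
        (∑ k, ∑ l, pPlus N q k l i j • (FreeAlgebra.ι ℂ k * FreeAlgebra.ι ℂ l)) 0
  | metric :
      CliffordRel N q c
        (∑ i, ∑ j, FRT.metric N q i j • (FreeAlgebra.ι ℂ i * FreeAlgebra.ι ℂ j))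
        (algebraMap ℂ (FreeAlgebra ℂ (Fin N)) (c ^ 2 * ((q ^ (2 * N) - 1) / (q ^ 2 - 1))))

/-- The FRT-Clifford algebra `Cl_q(N)` with parameter `c`. -/
abbrev Clifford (N : ℕ) (q c : ℂ) : Type := RingQuot (CliffordRel N q c)

/-- The generators `γ_i` of `Cl_q(N)`. -/
def gen (N : ℕ) (q c : ℂ) (i : Fin N) : Clifford N q c :=
  RingQuot.mkAlgHom ℂ (CliffordRel N q c) (FreeAlgebra.ι ℂ i)

/-- The `q`-exterior algebra `Λ(O_q^N)`: the FRT-Clifford algebra with `c = 0`. -/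
abbrev Exterior (N : ℕ) (q : ℂ) : Type := Clifford N q 0

/-- `V^{⊗m}`, where `V` has the basis `γ_1, …, γ_N`: the function `t` is the tensor
`∑ t(w) γ_{w_1} ⊗ ⋯ ⊗ γ_{w_m}`, summed over all words `w` of length `m`. -/
abbrev Tens (N m : ℕ) : Type := (Fin m → Fin N) → ℂ

/-- The quotient map `V^{⊗m} → V^{∧m} ⊆ Λ(O_q^N)`,
`γ_{w_1} ⊗ ⋯ ⊗ γ_{w_m} ↦ γ_{w_1} ∧ ⋯ ∧ γ_{w_m}`. -/
def toExterior (N : ℕ) (q : ℂ) (m : ℕ) : Tens N m →ₗ[ℂ] Exterior N q where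
  toFun t := ∑ w, t w • (List.ofFn fun p => gen N q 0 (w p)).prod
  map_add' s t := by simp [add_smul, Finset.sum_add_distrib]
  map_smul' a t := by simp [mul_smul, Finset.smul_sum]

/-- The endomorphism `M` acting in the tensor factors `p + 1` and `p + 2` of `V^{⊗m}`, that is
`M_{p+1,p+2}` (only used for `p + 1 < m`). -/
def opAt {N : ℕ} (M : Mat4 N) (m p : ℕ) : Module.End ℂ (Tens N m) where
  toFun t := fun w =>
    if h : p + 1 < m then
      ∑ k, ∑ l, M (w ⟨p, Nat.lt_of_succ_lt h⟩) (w ⟨p + 1, h⟩) k l *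
        t (Function.update (Function.update w ⟨p, Nat.lt_of_succ_lt h⟩ k) ⟨p + 1, h⟩ l)
    else 0
  map_add' s t := by
    funext w
    by_cases h : p + 1 < m <;> simp [h, mul_add, Finset.sum_add_distrib]
  map_smul' a t := by
    funext w
    by_cases h : p + 1 < m <;> simp [h, Finset.mul_sum, mul_left_comm]

/-- The ordered product (composition) `M_{s+1,s+2} M_{s+2,s+3} ⋯ M_{s+r,s+r+1}` on `V^{⊗m}`;
the identity for `r = 0`. -/
def chain {N : ℕ} (M : Mat4 N) (m s r : ℕ) : Module.End ℂ (Tens N m) :=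
  ((List.range r).map fun x => opAt M m (s + x)).prod

/-- `d'^-_{k+1,i} = K_{12} ⋯ K_{k-i+1,k-i+2}
∑_{j=0}^{i-1} (-q⁻²)^j ∏_{l=1}^j R̂_{k-i+1+l,k-i+2+l}` on `V^{⊗(k+1)}`, for `1 ≤ i ≤ k`. -/
def dMinus (N : ℕ) (q : ℂ) (k i : ℕ) : Module.End ℂ (Tens N (k + 1)) :=
  chain (kMat N q) (k + 1) 0 (k - i + 1) *
    ∑ j ∈ Finset.range i,
      (-q ^ (-2 : ℤ)) ^ j • chain (rMat N q) (k + 1) (k - i + 1) j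

/-- `b^-_{1,k} = ∑_{i=0}^k (-q⁻²)^i R̂_{12} R̂_{23} ⋯ R̂_{i,i+1}
- (q_+ q_- / (1 + q^{2N-4k})) ∑_{i=1}^k q^{4i-4k-2} d'^-_{k+1,i}` on `V^{⊗(k+1)}`. -/
def bMinus (N : ℕ) (q : ℂ) (k : ℕ) : Module.End ℂ (Tens N (k + 1)) :=
  (∑ i ∈ Finset.range (k + 1), (-q ^ (-2 : ℤ)) ^ i • chain (rMat N q) (k + 1) 0 i)
    - (qPlus q * qMinus q / (1 + q ^ (2 * (N : ℤ) - 4 * (k : ℤ)))) •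
      ∑ i ∈ Finset.Icc 1 k, q ^ (4 * (i : ℤ) - 4 * (k : ℤ) - 2) • dMinus N q k i

/-- The bilinear form `g(γ_i ⊗ γ_j) = c² q^{2N-3} q_+ C_{ij} / (q^{2N-4} + 1)`. -/
def gForm (N : ℕ) (q c : ℂ) (i j : Fin N) : ℂ :=
  c ^ 2 * q ^ (2 * (N : ℤ) - 3) * qPlus q * metric N q i j / (q ^ (2 * (N : ℤ) - 4) + 1)

/-- The contraction `⟨γ_i, ·⟩ : V^{⊗m} → V^{⊗ max(0, m-1)}`,
`⟨γ_i, t⟩ = g_{12} (γ_i ⊗ b^-_{1,m-1}(t))` for `m ≥ 1`, and `0` for `m = 0`. -/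
def contract (N : ℕ) (q c : ℂ) (i : Fin N) : (m : ℕ) → Tens N m → Tens N (m - 1)
  | 0, _ => 0
  | k + 1, t => fun w => ∑ j, gForm N q c i j * bMinus N q k t (Fin.cons j w)

/-- The representation `act` of `Cl_q(N)` on `Λ(O_q^N)` satisfies
`γ_i ▷ ρ_m = γ_i ∧ ρ_m + ((1 + q^{2N-4}) / (1 + q^{2N-4m})) ⟨γ_i, ρ_m⟩`
for all `m ∈ {0, …, N}`, `ρ_m ∈ V^{∧m}`, and all `i`. Every `ρ_m` is written as the class of a
tensor `t ∈ V^{⊗m}`, and `⟨γ_i, ρ_m⟩` is the class of `⟨γ_i, t⟩`. -/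
def IsCliffordAction (N : ℕ) (q c : ℂ)
    (act : Clifford N q c →ₐ[ℂ] Module.End ℂ (Exterior N q)) : Prop :=
  ∀ m : ℕ, m ≤ N → ∀ (t : Tens N m) (i : Fin N),
    act (gen N q c i) (toExterior N q m t) =
      gen N q 0 i * toExterior N q m t
        + ((1 + q ^ (2 * (N : ℤ) - 4)) / (1 + q ^ (2 * (N : ℤ) - 4 * (m : ℤ)))) •
          toExterior N q (m - 1) (contract N q c i m t)

end FRT

end

/-! All relations are handled through arrays `Z k l` of vectors, on which 4-index matrices act from
the right. An array satisfies the exterior relations (`IsAnti`) exactly when R̂ acts on it as the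
scalar -q⁻² (`IsAnti.amul_rMat`, `isAnti_of_amul`), and the Clifford relations say that γ_i γ_j - κ₁
C_ij is such an array (`isAnti_gen`, `cliffordLift`).

Existence. On degree m the contraction with γ_i is a scalar κ_m times a twisted derivative ∂_i,
lowered with the metric. It obeys the Leibniz rule `lower`: ∂_k(γ_l x) = C_kl x - q⁻² ∑
(R̂⁻¹)^{ij}_{kl} γ_i ∂_j x - q⁻² λ γ_k ∂_l x, where λ depends on the degree. Three facts are needed:
the rule respects the exterior relations (`isAnti_lower_lower`), the derivatives satisfy the
exterior relations among themselves (`isAnti_lowered_lowered`), and γ_i + κ ∂_i satisfies the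
Clifford relations (`isAnti_clifford`). Each time the array in question splits into exterior arrays.
Some are images of R̂ - q² + ζK (`isAnti_hecke`), others are exterior arrays moved past further
indices (`IsAnti.braid`, the needed part of the Yang-Baxter equation). What remains cancels by
identities between λ, ζ, κ and by Euler's identity ∑ C^{ij} γ_i ∂_j x = [m] x. The derivatives
themselves come from the universal property of the exterior algebra acting on jets, and `deriv_cls`
identifies them with the operators b⁻ by showing that both satisfy the same recursion.

Faithfulness. Filter Cl_q(N) by word length. Words of length N + 1 vanish in the exterior algebra by
straightening (`word_eq_zero`), so words of length at most N span Cl_q(N) (`filt_eq_top`). A word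
acts on 1 as the corresponding exterior word plus terms of lower degree. If x is a combination of
words of length at most n and acts as zero, its degree-n part therefore vanishes in the exterior
algebra. The symbol map from the exterior algebra to the graded pieces of Cl_q(N)
(`exists_symbolMap`) then puts x one step lower in the filtration, and descent gives x = 0. Neither
a basis nor a dimension count is needed. -/

noncomputable section

namespace FRT

/-! ### Arrays, their partial traces, and the right action of R̂ and K. -/

section

variable {N : ℕ} {q : ℂ} {M : Type*} [AddCommGroup M] [Module ℂ M]

/-- The nonzero entries `q^{-2ρ_i}` of the metric. -/
def weight (N : ℕ) (q : ℂ) (i : Fin N) : ℂ := q ^ (-twoRho N i)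

/-- The number `q² - q⁻²`. -/
def skein (q : ℂ) : ℂ := q ^ 2 - q ^ (-2 : ℤ)

lemma metric_eq (i j : Fin N) : metric N q i j = if i = j.rev then weight N q i else 0 := by
  simp [metric, weight, delta]

lemma metric_rev (i : Fin N) : metric N q i i.rev = weight N q i := by
  simp [metric_eq]

lemma metric_eq_zero {i j : Fin N} (h : i ≠ j.rev) : metric N q i j = 0 := by
  simp [metric_eq, h]

lemma weight_of_lt (i : Fin N) (h : i < i.rev) :
    weight N q i = q ^ (2 * (i : ℤ) + 2 - N) := by
  have h' : ¬ i.rev < i := not_lt.2 h.le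
  simp only [weight, twoRho, h, h', if_true, if_false]
  congr 1; ring

lemma weight_of_gt (i : Fin N) (h : i.rev < i) :
    weight N q i = q ^ (2 * (i : ℤ) - N) := by
  have h' : ¬ i < i.rev := not_lt.2 h.le
  simp only [weight, twoRho, h, h', if_true, if_false]
  congr 1
  rw [Fin.val_rev, Nat.cast_sub (by omega)]
  push_cast; ring

lemma weight_of_eq (i : Fin N) (h : i = i.rev) : weight N q i = 1 := by
  have h1 : ¬ i < i.rev := by rw [← h]; exact lt_irrefl i
  have h2 : ¬ i.rev < i := by rw [← h]; exact lt_irrefl i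
  simp [weight, twoRho, h1, h2]

lemma weight_ne_zero (hq0 : q ≠ 0) (i : Fin N) : weight N q i ≠ 0 := zpow_ne_zero _ hq0

lemma twoRho_rev (i : Fin N) : twoRho N i.rev = -twoRho N i := by
  simp [twoRho]

lemma weight_mul_rev (hq0 : q ≠ 0) (i : Fin N) : weight N q i * weight N q i.rev = 1 := by
  rw [weight, weight, ← zpow_add₀ hq0, twoRho_rev]; simp

lemma weight_rev (hq0 : q ≠ 0) (i : Fin N) : weight N q i.rev = (weight N q i)⁻¹ :=
  eq_inv_of_mul_eq_one_right (weight_mul_rev hq0 i)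

lemma weight_sq_of_lt (hq0 : q ≠ 0) (i : Fin N) (h : i < i.rev) :
    weight N q i ^ 2 = q ^ (4 * (i : ℤ) + 4 - 2 * N) := by
  rw [weight_of_lt i h, sq, ← zpow_add₀ hq0]; congr 1; ring

lemma weight_sq_of_gt (hq0 : q ≠ 0) (i : Fin N) (h : i.rev < i) :
    weight N q i ^ 2 = q ^ (4 * (i : ℤ) - 2 * N) := by
  rw [weight_of_gt i h, sq, ← zpow_add₀ hq0]; congr 1; ring

/-- The partial traces `∑_{i < m} C^{ii'} Z_{ii'}` of an array `Z`. -/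
def ptr (q : ℂ) (Z : Fin N → Fin N → M) (m : ℕ) : M :=
  ∑ i : Fin N, if (i : ℕ) < m then weight N q i • Z i i.rev else 0

lemma ptr_zero (Z : Fin N → Fin N → M) : ptr q Z 0 = 0 := by simp [ptr]

lemma ptr_succ (Z : Fin N → Fin N → M) (k : Fin N) :
    ptr q Z (k + 1) = ptr q Z k + weight N q k • Z k k.rev := by
  have : ∀ i : Fin N, (if (i : ℕ) < k + 1 then weight N q i • Z i i.rev else 0)
      = (if (i : ℕ) < k then weight N q i • Z i i.rev else 0)
        + if i = k then weight N q i • Z i i.rev else 0 := by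
    intro i
    rcases lt_trichotomy i k with h | h | h
    · have h1 : (i : ℕ) < k := h
      simp [h1, h.ne, Nat.lt_succ_of_lt h1]
    · simp [h]
    · have h1 : (k : ℕ) < i := h
      have h2 : ¬ (i : ℕ) < k + 1 := by omega
      have h3 : ¬ (i : ℕ) < k := by omega
      simp [h2, h3, h.ne']
  simp only [ptr, this, Finset.sum_add_distrib, Finset.sum_ite_eq', Finset.mem_univ, if_true]

lemma ptr_top (Z : Fin N → Fin N → M) :
    ptr q Z N = ∑ i, ∑ j, metric N q i j • Z i j := by
  simp only [ptr, Fin.is_lt, if_true]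
  refine Finset.sum_congr rfl fun i _ => ?_
  rw [Finset.sum_eq_single i.rev]
  · rw [metric_rev]
  · intro j _ hj
    rw [metric_eq_zero, zero_smul]
    rintro rfl; simp at hj
  · simp

/-- The array `Z` multiplied from the right by the matrix `A`. -/
def amul (Z : Fin N → Fin N → M) (A : Mat4 N) : Fin N → Fin N → M :=
  fun k l => ∑ i, ∑ j, A i j k l • Z i j

/-- The exponent of `q` in the diagonal part of the `R̂`-matrix. -/
def dexp (i j : Fin N) : ℤ := (if i = j then 2 else 0) - (if i = j.rev then 2 else 0)

/-- The factor δ_{i<l} in front of K cuts the trace of Z off at l. This is why partial traces, and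
not only the full trace, enter the explicit relations. -/
lemma amul_rMat (Z : Fin N → Fin N → M) (k l : Fin N) :
    amul Z (rMat N q) k l = q ^ dexp k l • Z l k + (if k < l then skein q • Z k l else 0)
      - (skein q * metric N q k l) • ptr q Z l := by
  have h1 : ∑ i, ∑ j, (q ^ dexp i j * (delta i l * delta j k)) • Z i j
      = q ^ dexp k l • Z l k := by
    rw [Finset.sum_eq_single l, Finset.sum_eq_single k]
    · have : dexp l k = dexp k l := by
        simp only [dexp]
        congr 1
        · simp [eq_comm]
        · have : l = k.rev ↔ k = l.rev := by rw [eq_comm, Fin.rev_eq_iff]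
          simp [this]
      simp [delta, this]
    · intro j _ hj; simp [delta, hj]
    · simp
    · intro i _ hi; simp [delta, hi]
    · simp
  have h2 : ∑ i, ∑ j, (skein q * (if i < l then 1 else 0) * (delta i k * delta j l)) • Z i j
      = if k < l then skein q • Z k l else 0 := by
    rw [Finset.sum_eq_single k, Finset.sum_eq_single l]
    · split_ifs <;> simp [delta]
    · intro j _ hj; simp [delta, hj]
    · simp
    · intro i _ hi; simp [delta, hi]
    · simp
  have h3 : ∑ i, ∑ j, (skein q * (if i < l then 1 else 0) * kMat N q i j k l) • Z i j
      = (skein q * metric N q k l) • ptr q Z l := by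
    rw [ptr, Finset.smul_sum]
    refine Finset.sum_congr rfl fun i _ => ?_
    rw [Finset.sum_eq_single i.rev]
    · by_cases h : i < l
      · have h' : (i : ℕ) < l := h
        simp only [h, h', if_true, kMat, metric_rev, smul_smul]; congr 1; ring
      · have h' : ¬ (i : ℕ) < l := h
        simp [h, h']
    · intro j _ hj
      rw [kMat, metric_eq_zero, zero_mul, mul_zero, zero_smul]
      rintro rfl; simp at hj
    · simp
  rw [← h1, ← h2, ← h3, ← Finset.sum_add_distrib, ← Finset.sum_sub_distrib]
  refine Finset.sum_congr rfl fun i _ => ?_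
  rw [← Finset.sum_add_distrib, ← Finset.sum_sub_distrib]
  refine Finset.sum_congr rfl fun j _ => ?_
  rw [← add_smul, ← sub_smul]
  congr 1
  simp only [rMat, dexp, skein]; ring

lemma amul_kMat (Z : Fin N → Fin N → M) (k l : Fin N) :
    amul Z (kMat N q) k l = metric N q k l • ptr q Z N := by
  simp only [amul, ptr_top, kMat, Finset.smul_sum, smul_smul]
  simp only [mul_comm]

end

/-! ### The exterior relations in explicit form, and partial traces of Z R̂. -/

section

variable {N : ℕ} {q : ℂ} {M : Type*} [AddCommGroup M] [Module ℂ M]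

lemma zpow_ne_one (hq : ∀ m : ℕ, 1 ≤ m → q ^ m ≠ 1) {n : ℤ} (hn : n ≠ 0) :
    q ^ n ≠ 1 := by
  intro h
  rcases Int.natAbs_eq n with h1 | h1
  · rw [h1, zpow_natCast] at h
    exact hq _ (by omega) h
  · rw [h1, zpow_neg, zpow_natCast, inv_eq_one] at h
    exact hq _ (by omega) h

lemma one_add_zpow_ne_zero (hq0 : q ≠ 0) (hq : ∀ m : ℕ, 1 ≤ m → q ^ m ≠ 1) (n : ℤ) :
    1 + q ^ n ≠ 0 := by
  intro h
  have h1 : q ^ n = -1 := by linear_combination h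
  have h2 : q ^ (n + n) = 1 := by rw [zpow_add₀ hq0, h1]; norm_num
  by_cases hn : n = 0
  · subst hn; norm_num at h
  · exact zpow_ne_one hq (by omega : n + n ≠ 0) h2

lemma skein_ne_zero (hq0 : q ≠ 0) (hq : ∀ m : ℕ, 1 ≤ m → q ^ m ≠ 1) : skein q ≠ 0 := by
  intro h
  apply hq 4 (by norm_num)
  have : q ^ 2 * skein q = q ^ 4 - 1 := by
    simp only [skein, zpow_neg, zpow_ofNat]; field_simp
  rw [h] at this; linear_combination -this

/-- The relations of the `q`-exterior algebra, in terms of the products `Z k l` of generators. -/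
structure IsAnti (q : ℂ) (Z : Fin N → Fin N → M) : Prop where
  diag : ∀ k, k ≠ k.rev → Z k k = 0
  comm : ∀ k l, k < l → l ≠ k.rev → Z l k = -(q ^ 2 • Z k l)
  refl : ∀ l : ℕ, l ≤ N → ptr q Z (N - l) = q ^ (2 * (N : ℤ) - 4 * l) • ptr q Z l

lemma map_ptr {M' : Type*} [AddCommGroup M'] [Module ℂ M'] (f : M →ₗ[ℂ] M')
    (Z : Fin N → Fin N → M) (m : ℕ) : f (ptr q Z m) = ptr q (fun i j => f (Z i j)) m := by
  simp only [ptr, map_sum]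
  refine Finset.sum_congr rfl fun i _ => ?_
  split_ifs <;> simp

lemma map_amul {M' : Type*} [AddCommGroup M'] [Module ℂ M'] (f : M →ₗ[ℂ] M')
    (Z : Fin N → Fin N → M) (A : Mat4 N) (k l : Fin N) :
    f (amul Z A k l) = amul (fun i j => f (Z i j)) A k l := by
  simp [amul, map_sum]

lemma IsAnti.map {M' : Type*} [AddCommGroup M'] [Module ℂ M'] {Z : Fin N → Fin N → M}
    (h : IsAnti q Z) (f : M →ₗ[ℂ] M') : IsAnti q (fun i j => f (Z i j)) where
  diag k hk := by rw [h.diag k hk, map_zero]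
  comm k l hkl hl := by rw [h.comm k l hkl hl, map_neg, map_smul]
  refl l hl := by rw [← map_ptr, h.refl l hl, map_smul, map_ptr]

/-- The relations are linear and functionals separate points, so identities between arrays can be
checked for complex entries, where they become polynomial identities. -/
lemma isAnti_of_dual {Z : Fin N → Fin N → M}
    (h : ∀ f : M →ₗ[ℂ] ℂ, IsAnti q (fun i j => f (Z i j))) : IsAnti q Z where
  diag k hk := by
    rw [← Module.forall_dual_apply_eq_zero_iff ℂ]
    exact fun f => (h f).diag k hk
  comm k l hkl hl := by
    rw [← sub_eq_zero, ← Module.forall_dual_apply_eq_zero_iff ℂ]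
    intro f
    have := (h f).comm k l hkl hl
    rw [map_sub, map_neg, map_smul, sub_eq_zero, this]
  refl l hl := by
    rw [← sub_eq_zero, ← Module.forall_dual_apply_eq_zero_iff ℂ]
    intro f
    have := (h f).refl l hl
    rw [map_sub, map_smul, map_ptr, map_ptr, sub_eq_zero, this]

lemma ptr_add (Z W : Fin N → Fin N → M) (m : ℕ) :
    ptr q (fun i j => Z i j + W i j) m = ptr q Z m + ptr q W m := by
  simp only [ptr, ← Finset.sum_add_distrib]
  refine Finset.sum_congr rfl fun i _ => ?_
  split_ifs <;> simp

lemma ptr_smul (a : ℂ) (Z : Fin N → Fin N → M) (m : ℕ) :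
    ptr q (fun i j => a • Z i j) m = a • ptr q Z m := by
  simp only [ptr, Finset.smul_sum]
  refine Finset.sum_congr rfl fun i _ => ?_
  split_ifs <;> simp [smul_comm a]

lemma IsAnti.add {Z W : Fin N → Fin N → M} (h : IsAnti q Z) (h' : IsAnti q W) :
    IsAnti q (fun i j => Z i j + W i j) where
  diag k hk := by rw [h.diag k hk, h'.diag k hk, add_zero]
  comm k l hkl hl := by rw [h.comm k l hkl hl, h'.comm k l hkl hl, smul_add]; abel
  refl l hl := by rw [ptr_add, ptr_add, h.refl l hl, h'.refl l hl, smul_add]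

lemma IsAnti.smul {Z : Fin N → Fin N → M} (a : ℂ) (h : IsAnti q Z) :
    IsAnti q (fun i j => a • Z i j) where
  diag k hk := by rw [h.diag k hk, smul_zero]
  comm k l hkl hl := by rw [h.comm k l hkl hl, smul_neg, smul_comm]
  refl l hl := by rw [ptr_smul, ptr_smul, h.refl l hl, smul_comm]

lemma isAnti_zero : IsAnti q (fun _ _ => (0 : M) : Fin N → Fin N → M) where
  diag _ _ := rfl
  comm _ _ _ _ := by simp
  refl l _ := by simp [ptr]

lemma IsAnti.sum {ι : Type*} (s : Finset ι) {Z : ι → Fin N → Fin N → M}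
    (h : ∀ a ∈ s, IsAnti q (Z a)) : IsAnti q (fun i j => ∑ a ∈ s, Z a i j) := by
  classical
  induction s using Finset.induction_on with
  | empty => simpa using isAnti_zero
  | insert a s ha ih =>
    simp only [Finset.sum_insert ha]
    exact (h a (by simp)).add (ih fun b hb => h b (by simp [hb]))

lemma IsAnti.ptr_top {Z : Fin N → Fin N → M} (h : IsAnti q Z) : ptr q Z N = 0 := by
  have := h.refl 0 (Nat.zero_le _)
  rwa [ptr_zero, smul_zero, Nat.sub_zero] at this

lemma dexp_rev (k : Fin N) (h : k ≠ k.rev) : dexp k k.rev = -2 := by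
  simp [dexp, h]

lemma dexp_of_eq (k : Fin N) (h : k = k.rev) : dexp k k.rev = 0 := by
  simp [dexp, ← h]

lemma dexp_self (k : Fin N) (h : k ≠ k.rev) : dexp k k = 2 := by
  simp [dexp, h]

lemma dexp_ne (k l : Fin N) (h : k ≠ l) (h' : l ≠ k.rev) : dexp k l = 0 := by
  have : k ≠ l.rev := by rintro rfl; simp at h'
  simp [dexp, h, this]

lemma rev_lt_iff_val (k : Fin N) : k.rev < k ↔ N ≤ 2 * (k : ℕ) := by
  rw [Fin.lt_def, Fin.val_rev]; omega

lemma lt_rev_iff_val (k : Fin N) : k < k.rev ↔ 2 * (k : ℕ) + 1 < N := by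
  rw [Fin.lt_def, Fin.val_rev]; omega

lemma eq_rev_iff_val (k : Fin N) : k = k.rev ↔ 2 * (k : ℕ) + 1 = N := by
  rw [Fin.ext_iff, Fin.val_rev]; omega

lemma weight_mul_self (Z : Fin N → Fin N → ℂ) (k : Fin N) :
    weight N q k * Z k k.rev = ptr q Z (k + 1) - ptr q Z k := by
  rw [ptr_succ]; simp

lemma self_rev_eq (hq0 : q ≠ 0) (Z : Fin N → Fin N → ℂ) (k : Fin N) :
    Z k k.rev = (weight N q k)⁻¹ * (ptr q Z (k + 1) - ptr q Z k) := by
  rw [← weight_mul_self, inv_mul_cancel_left₀ (weight_ne_zero hq0 k)]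

/-- Together with `self_rev_eq` this trades every antidiagonal entry for a difference of partial
traces; the index k' corresponds to the step from N - (k+1) to N - k. -/
lemma rev_self_eq (hq0 : q ≠ 0) (Z : Fin N → Fin N → ℂ) (k : Fin N) :
    Z k.rev k = weight N q k * (ptr q Z (N - k) - ptr q Z (N - (k + 1))) := by
  have h := self_rev_eq hq0 Z k.rev
  rw [Fin.rev_rev, weight_rev hq0, inv_inv] at h
  rw [h, Fin.val_rev]
  congr 3; omega

/-- Summation of `amul_rMat` along the antidiagonal, one index at a time. The formula changes at the
middle because the exponents of the weights jump by 4 there and the term with k < k' disappears. -/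
lemma ptr_amul_rMat (hq0 : q ≠ 0) (Z : Fin N → Fin N → ℂ) (l : ℕ) (hl : l ≤ N) :
    (2 * l ≤ N → ptr q (amul Z (rMat N q)) l = q ^ (2 - 2 * (N : ℤ)) * ptr q Z N
      - q ^ (4 * (l : ℤ) + 2 - 2 * N) * ptr q Z (N - l) + skein q * ptr q Z l) ∧
    (N ≤ 2 * l → ptr q (amul Z (rMat N q)) l = q ^ (2 - 2 * (N : ℤ)) * ptr q Z N
      - q ^ (4 * (l : ℤ) - 2 - 2 * N) * ptr q Z (N - l)) := by
  induction l with
  | zero =>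
    refine ⟨fun _ => by simp [ptr_zero], fun h => ?_⟩
    obtain rfl : N = 0 := by omega
    simp [ptr_zero]
  | succ l ih =>
    obtain ⟨ih1, ih2⟩ := ih (by omega)
    obtain ⟨k, rfl⟩ : ∃ k : Fin N, (k : ℕ) = l := ⟨⟨l, hl⟩, rfl⟩
    have hc := weight_ne_zero (N := N) hq0 k
    have e := ptr_succ (q := q) (amul Z (rMat N q)) k
    rw [amul_rMat, rev_self_eq hq0 Z k, self_rev_eq hq0 Z k, metric_rev, Fin.val_rev] at e
    simp only [smul_eq_mul] at e
    rcases lt_trichotomy k k.rev with h | h | h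
    · have h0 := (lt_rev_iff_val k).1 h
      have hsq := weight_sq_of_lt hq0 k h
      have E : ∀ a b c d : ℂ, weight N q k * (q ^ (-2 : ℤ) * (weight N q k * (a - b)) +
          skein q * ((weight N q k)⁻¹ * (c - d)) - skein q * weight N q k * b)
          = weight N q k ^ 2 * (q ^ (-2 : ℤ) * (a - b) - skein q * b) + skein q * (c - d) := by
        intro a b c d; field_simp; ring
      rw [if_pos h, dexp_rev k h.ne, ih1 (by omega), E, hsq] at e
      have F : ptr q (amul Z (rMat N q)) (k + 1) = q ^ (2 - 2 * (N : ℤ)) * ptr q Z N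
          - q ^ (4 * ((k + 1 : ℕ) : ℤ) + 2 - 2 * N) * ptr q Z (N - (k + 1))
          + skein q * ptr q Z (k + 1) := by
        rw [e]
        simp only [skein, zpow_sub₀ hq0, zpow_add₀ hq0, zpow_neg, zpow_ofNat, Nat.cast_add,
          Nat.cast_one, mul_add, mul_one]
        field_simp; ring
      refine ⟨fun _ => F, fun h' => ?_⟩
      -- Here 2(k+1) = N, so both forms apply; the second follows from the first because the two
      -- partial traces coincide.
      rw [F, show N - ((k : ℕ) + 1) = k + 1 by omega]
      have hN : (N : ℤ) = 2 * k + 2 := by omega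
      rw [hN]
      simp only [skein, zpow_sub₀ hq0, zpow_add₀ hq0, zpow_neg, zpow_ofNat, Nat.cast_add,
          Nat.cast_one, mul_add, mul_one, ← mul_assoc]
      field_simp; norm_num; field_simp; ring
    · have h0 := (eq_rev_iff_val k).1 h
      have hN : (N : ℤ) = 2 * k + 1 := by omega
      refine ⟨fun h' => by omega, fun _ => ?_⟩
      rw [if_neg (by rw [← h]; exact lt_irrefl k), dexp_of_eq k h, ih1 (by omega),
        weight_of_eq k h, show N - ((k : ℕ) + 1) = k by omega,
        show N - (k : ℕ) = k + 1 by omega] at e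
      rw [e, show N - ((k : ℕ) + 1) = k by omega, hN,
        show 4 * (k : ℤ) + 2 - 2 * (2 * k + 1) = 0 by ring,
        show 4 * ((k + 1 : ℕ) : ℤ) - 2 - 2 * (2 * k + 1) = 0 by push_cast; ring]
      simp only [zpow_zero]
      ring
    · have h0 := (rev_lt_iff_val k).1 h
      have hsq := weight_sq_of_gt hq0 k h
      refine ⟨fun h' => by omega, fun _ => ?_⟩
      have E : ∀ a b : ℂ, weight N q k * (q ^ (-2 : ℤ) * (weight N q k * (a - b)) +
          0 - skein q * weight N q k * b)
          = weight N q k ^ 2 * (q ^ (-2 : ℤ) * (a - b) - skein q * b) := by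
        intro a b; ring
      rw [if_neg (not_lt.2 h.le), dexp_rev k h.ne', ih2 (by omega), E, hsq] at e
      rw [e]
      simp only [skein, zpow_sub₀ hq0, zpow_add₀ hq0, zpow_neg, zpow_ofNat, Nat.cast_add,
          Nat.cast_one, mul_add, mul_one]
      field_simp; ring

end

/-! ### Exterior arrays as an eigenspace of R̂, and the quadratic relation of R̂. -/

section

variable {N : ℕ} {q : ℂ} {M : Type*} [AddCommGroup M] [Module ℂ M]

/-- The identity for N - l is the inverse of the identity for l. -/
lemma refl_of_half (hq0 : q ≠ 0) {Z : Fin N → Fin N → ℂ}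
    (h : ∀ l : ℕ, 2 * l ≤ N → ptr q Z (N - l) = q ^ (2 * (N : ℤ) - 4 * l) * ptr q Z l)
    (l : ℕ) (hl : l ≤ N) : ptr q Z (N - l) = q ^ (2 * (N : ℤ) - 4 * l) * ptr q Z l := by
  rcases le_total (2 * l) N with h1 | h1
  · exact h l h1
  · have := h (N - l) (by omega)
    rw [Nat.sub_sub_self hl] at this
    rw [this, ← mul_assoc, ← zpow_add₀ hq0, Nat.cast_sub hl,
      show 2 * (N : ℤ) - 4 * l + (2 * N - 4 * (N - l)) = 0 by ring]
    simp

lemma IsAnti.ptr_rev_of_lt (hq0 : q ≠ 0) {Z : Fin N → Fin N → ℂ} (h : IsAnti q Z) (j : Fin N)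
    (hj : j < j.rev) :
    weight N q j ^ 2 * ptr q Z (N - (j + 1)) = ptr q Z (j + 1) ∧
      weight N q j ^ 2 * ptr q Z (N - j) = q ^ 4 * ptr q Z j := by
  have h1 := h.refl (j + 1) j.is_lt
  have h2 := h.refl j j.is_lt.le
  rw [h1, h2, weight_sq_of_lt hq0 j hj]
  simp only [smul_eq_mul, zpow_sub₀ hq0, zpow_add₀ hq0, zpow_ofNat, Nat.cast_add,
    Nat.cast_one, mul_add, mul_one]
  constructor <;> field_simp

lemma IsAnti.ptr_rev_of_gt (hq0 : q ≠ 0) {Z : Fin N → Fin N → ℂ} (h : IsAnti q Z) (j : Fin N)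
    (hj : j.rev < j) :
    q ^ 4 * weight N q j ^ 2 * ptr q Z (N - (j + 1)) = ptr q Z (j + 1) ∧
      weight N q j ^ 2 * ptr q Z (N - j) = ptr q Z j := by
  have h1 := h.refl (j + 1) j.is_lt
  have h2 := h.refl j j.is_lt.le
  rw [h1, h2, weight_sq_of_gt hq0 j hj]
  simp only [smul_eq_mul, zpow_sub₀ hq0, zpow_add₀ hq0, zpow_ofNat, Nat.cast_add,
    Nat.cast_one, mul_add, mul_one]
  constructor <;> field_simp

lemma IsAnti.ptr_rev_of_eq {Z : Fin N → Fin N → ℂ} (h : IsAnti q Z) (j : Fin N)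
    (hj : j = j.rev) : ptr q Z (j + 1) = q ^ 2 * ptr q Z j := by
  have h2 := h.refl j j.is_lt.le
  have hN := (eq_rev_iff_val j).1 hj
  rw [show N - (j : ℕ) = j + 1 by omega, show 2 * (N : ℤ) - 4 * (j : ℕ) = 2 by omega] at h2
  rw [h2]; rfl

/-- Off the antidiagonal this is the q-commutation rule. On it, all entries are differences of
partial traces, and the reflection identities for k and k + 1 give the claim. -/
lemma IsAnti.amul_rMat_complex (hq0 : q ≠ 0) {Z : Fin N → Fin N → ℂ} (h : IsAnti q Z)
    (k l : Fin N) :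
    amul Z (rMat N q) k l = -q ^ (-2 : ℤ) * Z k l := by
  rw [amul_rMat]
  simp only [smul_eq_mul]
  by_cases hkl : l = k.rev
  · subst hkl
    rw [metric_rev, rev_self_eq hq0 Z k, self_rev_eq hq0 Z k, Fin.val_rev]
    have hc := weight_ne_zero (N := N) hq0 k
    rcases lt_trichotomy k k.rev with hk | hk | hk
    · obtain ⟨h1, h2⟩ := h.ptr_rev_of_lt hq0 k hk
      rw [if_pos hk, dexp_rev k hk.ne]
      simp only [skein, zpow_neg, zpow_ofNat]
      field_simp
      linear_combination h2 - q ^ 4 * h1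
    · rw [if_neg (by rw [← hk]; exact lt_irrefl k), dexp_of_eq k hk, weight_of_eq k hk]
      have hN := (eq_rev_iff_val k).1 hk
      have h2 := h.ptr_rev_of_eq k hk
      rw [show N - ((k : ℕ) + 1) = k by omega, show N - (k : ℕ) = k + 1 by omega, h2]
      simp only [skein, zpow_neg, zpow_ofNat]
      field_simp
      ring
    · obtain ⟨h1, h2⟩ := h.ptr_rev_of_gt hq0 k hk
      rw [if_neg (not_lt.2 hk.le), dexp_rev k hk.ne']
      simp only [skein, zpow_neg, zpow_ofNat]
      field_simp
      linear_combination h2 - h1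
  · rw [metric_eq_zero (by rintro rfl; simp at hkl)]
    rcases lt_trichotomy k l with hk | rfl | hk
    · rw [if_pos hk, dexp_ne k l hk.ne hkl, h.comm k l hk hkl]
      simp only [skein, zpow_neg, zpow_ofNat, smul_eq_mul]
      ring
    · rw [h.diag k hkl]; simp
    · have hkl' : k ≠ l.rev := by rintro rfl; simp at hkl
      rw [if_neg (not_lt.2 hk.le), dexp_ne k l hk.ne' hkl, h.comm l k hk hkl']
      simp only [skein, zpow_neg, zpow_ofNat, smul_eq_mul]
      field_simp
      ring

lemma IsAnti.amul_rMat (hq0 : q ≠ 0) {Z : Fin N → Fin N → M} (h : IsAnti q Z) (k l : Fin N) :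
    amul Z (rMat N q) k l = -q ^ (-2 : ℤ) • Z k l := by
  rw [← sub_eq_zero, ← Module.forall_dual_apply_eq_zero_iff ℂ]
  intro f
  rw [map_sub, map_amul, (h.map f).amul_rMat_complex hq0, map_smul]
  simp

/-- Converse direction: the diagonal entries and the full trace are killed by 1 + q⁴ and 1 +
q^{4-2N}, which are nonzero because no positive power of q is 1. Once the full trace is gone,
`ptr_amul_rMat` on the first half is the reflection identity. -/
lemma isAnti_of_amul_complex (hq0 : q ≠ 0) (hq : ∀ m : ℕ, 1 ≤ m → q ^ m ≠ 1)
    {Z : Fin N → Fin N → ℂ}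
    (h : ∀ k l, amul Z (rMat N q) k l = -q ^ (-2 : ℤ) * Z k l) : IsAnti q Z where
  diag k hk := by
    have := h k k
    rw [amul_rMat, if_neg (lt_irrefl k), dexp_self k hk, metric_eq_zero hk] at this
    have h4 := one_add_zpow_ne_zero hq0 hq 4
    simp only [smul_eq_mul, zpow_neg, zpow_ofNat] at this h4
    field_simp at this
    have h5 : (1 + q ^ 4) * Z k k = 0 := by linear_combination this
    exact (mul_eq_zero.1 h5).resolve_left h4
  comm k l hkl hl := by
    have := h k l
    have hl' : k ≠ l.rev := by rintro rfl; simp at hl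
    rw [amul_rMat, if_pos hkl, dexp_ne k l hkl.ne hl, metric_eq_zero hl'] at this
    simp only [smul_eq_mul, skein, zpow_zero] at this ⊢
    linear_combination this
  refl := by
    have hp : ∀ m, ptr q (amul Z (rMat N q)) m = -q ^ (-2 : ℤ) * ptr q Z m := by
      intro m
      rw [← smul_eq_mul, ← ptr_smul]
      simp only [ptr]
      refine Finset.sum_congr rfl fun i _ => ?_
      rw [h]; rfl
    have hN : ptr q Z N = 0 := by
      rcases Nat.eq_zero_or_pos N with rfl | h0
      · exact ptr_zero _
      · have h1 := (ptr_amul_rMat hq0 Z N le_rfl).2 (by omega)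
        rw [hp, Nat.sub_self, ptr_zero] at h1
        have h2 := one_add_zpow_ne_zero hq0 hq (4 - 2 * N)
        have h3 : (1 + q ^ (4 - 2 * (N : ℤ))) * ptr q Z N = 0 := by
          simp only [zpow_sub₀ hq0, zpow_neg, zpow_ofNat] at h1 ⊢
          field_simp at h1 ⊢
          linear_combination -h1
        exact (mul_eq_zero.1 h3).resolve_left h2
    refine refl_of_half hq0 fun l hl => ?_
    have h1 := (ptr_amul_rMat hq0 Z l (by omega)).1 hl
    rw [hp, hN] at h1
    simp only [skein, zpow_sub₀ hq0, zpow_add₀ hq0, zpow_neg, zpow_ofNat] at h1 ⊢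
    field_simp at h1 ⊢
    apply mul_left_cancel₀ (pow_ne_zero 4 hq0)
    linear_combination h1

lemma isAnti_of_amul (hq0 : q ≠ 0) (hq : ∀ m : ℕ, 1 ≤ m → q ^ m ≠ 1)
    {Z : Fin N → Fin N → M}
    (h : ∀ k l, amul Z (rMat N q) k l = -q ^ (-2 : ℤ) • Z k l) : IsAnti q Z := by
  refine isAnti_of_dual fun f => isAnti_of_amul_complex hq0 hq fun k l => ?_
  rw [← map_amul, h, map_smul, smul_eq_mul]

/-- The squared weights form a geometric progression on each half of the index range, and
multiplication by q² - q⁻² makes the sum telescope. -/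
lemma skein_mul_ptr_metric (hq0 : q ≠ 0) (l : ℕ) (hl : l ≤ N) :
    (2 * l ≤ N → skein q * ptr q (metric N q) l
      = q ^ (4 * (l : ℤ) + 2 - 2 * N) - q ^ (2 - 2 * (N : ℤ))) ∧
    (N ≤ 2 * l → skein q * ptr q (metric N q) l
      = q ^ (4 * (l : ℤ) - 2 - 2 * N) - q ^ (2 - 2 * (N : ℤ)) + skein q) := by
  induction l with
  | zero =>
    refine ⟨fun _ => by simp [ptr_zero], fun h => ?_⟩
    obtain rfl : N = 0 := by omega
    simp [ptr_zero, skein]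
  | succ l ih =>
    obtain ⟨ih1, ih2⟩ := ih (by omega)
    obtain ⟨k, rfl⟩ : ∃ k : Fin N, (k : ℕ) = l := ⟨⟨l, hl⟩, rfl⟩
    have e : skein q * ptr q (metric N q) (k + 1)
        = skein q * ptr q (metric N q) k + skein q * weight N q k ^ 2 := by
      rw [ptr_succ (q := q) (metric N q) k, metric_rev, smul_eq_mul]; ring
    rcases lt_trichotomy k k.rev with h | h | h
    · have h0 := (lt_rev_iff_val k).1 h
      rw [ih1 (by omega), weight_sq_of_lt hq0 k h] at e
      have F : skein q * ptr q (metric N q) (k + 1)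
          = q ^ (4 * ((k + 1 : ℕ) : ℤ) + 2 - 2 * N) - q ^ (2 - 2 * (N : ℤ)) := by
        rw [e]
        simp only [skein, zpow_sub₀ hq0, zpow_add₀ hq0, zpow_neg, zpow_ofNat, Nat.cast_add,
          Nat.cast_one, mul_add, mul_one]
        field_simp; ring
      refine ⟨fun _ => F, fun h' => ?_⟩
      have hN : (N : ℤ) = 2 * k + 2 := by omega
      rw [F, hN, show 4 * ((k + 1 : ℕ) : ℤ) + 2 - 2 * (2 * k + 2) = 2 by push_cast; ring,
        show 4 * ((k + 1 : ℕ) : ℤ) - 2 - 2 * (2 * k + 2) = -2 by push_cast; ring, skein,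
        zpow_ofNat]
      ring
    · have h0 := (eq_rev_iff_val k).1 h
      have hN : (N : ℤ) = 2 * k + 1 := by omega
      refine ⟨fun h' => by omega, fun _ => ?_⟩
      rw [ih1 (by omega), weight_of_eq k h] at e
      rw [e, hN, show 4 * (k : ℤ) + 2 - 2 * (2 * k + 1) = 0 by ring,
        show 4 * ((k + 1 : ℕ) : ℤ) - 2 - 2 * (2 * k + 1) = 0 by push_cast; ring]
      ring
    · have h0 := (rev_lt_iff_val k).1 h
      refine ⟨fun h' => by omega, fun _ => ?_⟩
      rw [ih2 (by omega), weight_sq_of_gt hq0 k h] at e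
      rw [e]
      simp only [skein, zpow_sub₀ hq0, zpow_add₀ hq0, zpow_neg, zpow_ofNat, Nat.cast_add,
          Nat.cast_one, mul_add, mul_one]
      field_simp; ring

/-- The coefficient of `K` in the quadratic relation `(R̂ - q²)(R̂ + q⁻²) ∝ K`. -/
def zeta (N : ℕ) (q : ℂ) : ℂ := skein q / (1 + q ^ (2 * (N : ℤ) - 4))

/-- This is the cubic equation of R̂ in usable form: R̂ - q² + ζK maps into the eigenspace of -q⁻².
The K-term, with coefficient `zeta`, removes the component along the third eigenvalue q^{2-2N}. -/
lemma isAnti_hecke_complex (hq0 : q ≠ 0) (hq : ∀ m : ℕ, 1 ≤ m → q ^ m ≠ 1)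
    (X : Fin N → Fin N → ℂ) :
    IsAnti q (fun k l => amul X (rMat N q) k l - q ^ 2 * X k l
      + zeta N q * ptr q X N * metric N q k l) where
  diag k hk := by
    rw [amul_rMat, if_neg (lt_irrefl k), dexp_self k hk, metric_eq_zero hk]
    simp
  comm k l hkl hl := by
    have hl' : k ≠ l.rev := by rintro rfl; simp at hl
    have hl'' : l ≠ k := hkl.ne'
    rw [amul_rMat, amul_rMat, if_pos hkl, if_neg (not_lt.2 hkl.le), dexp_ne k l hkl.ne hl,
      dexp_ne l k hkl.ne' hl', metric_eq_zero hl', metric_eq_zero hl]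
    simp only [smul_eq_mul, skein, zpow_neg, zpow_ofNat]
    field_simp; ring
  refl := by
    have hp : ∀ m, ptr q (fun k l => amul X (rMat N q) k l - q ^ 2 * X k l
        + zeta N q * ptr q X N * metric N q k l) m
        = ptr q (amul X (rMat N q)) m - q ^ 2 * ptr q X m
          + zeta N q * ptr q X N * ptr q (metric N q) m := by
      intro m
      simp only [sub_eq_add_neg, ← neg_mul]
      simp only [← smul_eq_mul]
      rw [ptr_add, ptr_add, ptr_smul, ptr_smul]
    refine refl_of_half hq0 fun l hl => ?_
    have hs := skein_ne_zero hq0 hq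
    have hz := one_add_zpow_ne_zero hq0 hq (2 * N - 4)
    have e1 := (ptr_amul_rMat hq0 X l (by omega)).1 hl
    have e2 := (ptr_amul_rMat hq0 X (N - l) (by omega)).2 (by omega)
    have f1 := (skein_mul_ptr_metric (N := N) hq0 l (by omega)).1 hl
    have f2 := (skein_mul_ptr_metric (N := N) hq0 (N - l) (by omega)).2 (by omega)
    rw [Nat.sub_sub_self (by omega : l ≤ N), Nat.cast_sub (by omega : l ≤ N),
      show 4 * ((N : ℤ) - l) - 2 - 2 * N = 2 * N - 4 * l - 2 by ring] at e2
    rw [Nat.cast_sub (by omega : l ≤ N),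
      show 4 * ((N : ℤ) - l) - 2 - 2 * N = 2 * N - 4 * l - 2 by ring] at f2
    have g1 := eq_div_of_mul_eq hs ((mul_comm _ _).trans f1)
    have g2 := eq_div_of_mul_eq hs ((mul_comm _ _).trans f2)
    rw [hp, hp, e1, e2, g1, g2, zeta]
    generalize ptr q X N = a, ptr q X l = b, ptr q X (N - l) = d
    have hs' : q ^ 2 * skein q = q ^ 4 - 1 := by
      simp only [skein, zpow_neg, zpow_ofNat]; field_simp
    have hs'' : skein q = (q ^ 4 - 1) / q ^ 2 := by rw [← hs']; field_simp
    have h4 : q ^ 4 - 1 ≠ 0 := by rw [← hs']; exact mul_ne_zero (pow_ne_zero _ hq0) hs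
    rw [hs'']
    have hz' : q ^ 4 + q ^ (2 * (N : ℤ)) ≠ 0 := by
      have : q ^ 4 + q ^ (2 * (N : ℤ)) = q ^ 4 * (1 + q ^ (2 * (N : ℤ) - 4)) := by
        rw [zpow_sub₀ hq0, zpow_ofNat]; field_simp
      rw [this]; exact mul_ne_zero (pow_ne_zero _ hq0) hz
    rw [zpow_sub₀ hq0 (2 * (N : ℤ)) 4, zpow_ofNat]
    have : 1 + q ^ (2 * (N : ℤ)) / q ^ 4 = (q ^ 4 + q ^ (2 * (N : ℤ))) / q ^ 4 := by field_simp
    rw [this]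
    simp only [zpow_sub₀ hq0, zpow_add₀ hq0, zpow_ofNat]
    field_simp
    ring

lemma isAnti_hecke (hq0 : q ≠ 0) (hq : ∀ m : ℕ, 1 ≤ m → q ^ m ≠ 1)
    (X : Fin N → Fin N → M) :
    IsAnti q (fun k l => amul X (rMat N q) k l - q ^ 2 • X k l
      + (zeta N q * metric N q k l) • ptr q X N) := by
  refine isAnti_of_dual fun f => ?_
  convert isAnti_hecke_complex hq0 hq (fun i j => f (X i j)) using 3 with k l
  rw [map_add, map_sub, map_smul, map_smul, map_amul, map_ptr]
  simp only [smul_eq_mul]; ring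

end

/-! ### Entries of an array moved past an index by two factors R̂. -/

section

variable {N : ℕ} {q : ℂ} {M : Type*} [AddCommGroup M] [Module ℂ M]

/-- The row `(n, ·)`, column `(k, m)` part of the `R̂`-matrix applied to a family of vectors. -/
lemma sum_rMat_smul (g : Fin N → M) (n k m : Fin N) :
    ∑ b, rMat N q n b k m • g b = (if m = n then q ^ dexp n k • g k else 0)
      + if n < m then skein q • ((if k = n then g m else 0)
        - if k = m.rev then (weight N q n * weight N q k) • g n.rev else 0) else 0 := by
  have h1 : ∑ b, (q ^ dexp n b * (delta n m * delta b k)) • g b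
      = if m = n then q ^ dexp n k • g k else 0 := by
    rw [Finset.sum_eq_single k]
    · by_cases h : m = n
      · simp [h, delta]
      · simp [h, delta, Ne.symm h]
    · intro j _ hj; simp [delta, hj]
    · simp
  have h2 : ∑ b, (delta n k * delta b m : ℂ) • g b = if k = n then g m else 0 := by
    rw [Finset.sum_eq_single m]
    · by_cases h : k = n
      · simp [h, delta]
      · simp [h, delta, Ne.symm h]
    · intro j _ hj; simp [delta, hj]
    · simp
  have h3 : ∑ b, kMat N q n b k m • g b
      = if k = m.rev then (weight N q n * weight N q k) • g n.rev else 0 := by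
    rw [Finset.sum_eq_single n.rev]
    · rw [kMat, metric_rev, metric_eq]
      split_ifs <;> simp
    · intro j _ hj
      rw [kMat, metric_eq_zero, zero_mul, zero_smul]
      rintro rfl; simp at hj
    · simp
  rw [← h1, ← h2, ← h3, ← Finset.sum_sub_distrib, Finset.smul_sum]
  by_cases hnm : n < m
  · rw [if_pos hnm, ← Finset.sum_add_distrib]
    refine Finset.sum_congr rfl fun b _ => ?_
    rw [← sub_smul, smul_smul, ← add_smul]
    simp only [rMat, dexp, skein, hnm, if_true, mul_one]
  · rw [if_neg hnm, add_zero]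
    refine Finset.sum_congr rfl fun b _ => ?_
    simp [rMat, dexp, hnm]

/-- The array `(k, l) ↦ ∑ R̂^{nb}_{km} R̂^{mc}_{lp} Z_{bc}`. -/
def braid (q : ℂ) (Z : Fin N → Fin N → M) (n p k l : Fin N) : M :=
  ∑ m, ∑ b, rMat N q n b k m • ∑ c, rMat N q m c l p • Z b c

/-- The nontrivial part of the off-diagonal entries `braid Z n e'`, `n < e'`. -/
def braidOff (q : ℂ) (Z : Fin N → Fin N → ℂ) (n e k l : Fin N) : ℂ :=
  (if l = n then q ^ dexp n k * Z k e.rev else 0)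
  - (if l = e then weight N q n * weight N q e * q ^ dexp n k * Z k n.rev else 0)
  + (if k = n then q ^ dexp e.rev l * Z e.rev l else 0)
  - (if k = e then weight N q n * weight N q e * q ^ dexp e.rev l * Z n.rev l else 0)
  + skein q * (
    (if k = n ∧ n < l ∧ l < e.rev then Z l e.rev else 0)
    - (if k = n ∧ l = e then weight N q e * (ptr q Z e.rev - ptr q Z (n + 1)) else 0)
    - (if l = k.rev ∧ n < l ∧ l < e.rev then weight N q n * weight N q k * Z n.rev e.rev else 0)
    + (if l = e ∧ n < k.rev ∧ k.rev < e.rev then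
        weight N q n * weight N q e * Z n.rev k else 0))

/-- R̂ is triangular: the row index n never exceeds the index m produced by the first factor, and m
never exceeds p. -/
lemma braid_of_gt (Z : Fin N → Fin N → M) {n p : Fin N} (h : p < n) (k l : Fin N) :
    braid q Z n p k l = 0 := by
  refine Finset.sum_eq_zero fun m _ => ?_
  simp only [sum_rMat_smul]
  rcases lt_trichotomy n m with h1 | rfl | h1
  · simp [h1.ne', (h.trans h1).ne, not_lt_of_gt (h.trans h1)]
  · simp [h.ne, h.le]
  · simp [h1.ne, not_lt_of_gt h1]

lemma braid_diag (Z : Fin N → Fin N → M) (n k l : Fin N) :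
    braid q Z n n k l = (q ^ dexp n k * q ^ dexp n l) • Z k l := by
  rw [braid, Finset.sum_eq_single n]
  · simp only [sum_rMat_smul]
    simp [smul_smul]
  · intro m _ hm
    simp only [sum_rMat_smul]
    rcases lt_or_gt_of_ne hm with h1 | h1
    · simp [h1.ne, not_lt_of_gt h1]
    · simp [h1.ne, h1.ne', not_lt_of_gt h1]
  · simp

lemma ptr_sub_ptr (Z : Fin N → Fin N → ℂ) (n p : Fin N) (h : n < p) :
    ∑ m, (if n < m ∧ m < p then weight N q m * Z m m.rev else 0)
      = ptr q Z p - ptr q Z (n + 1) := by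
  rw [ptr, ptr, ← Finset.sum_sub_distrib]
  refine Finset.sum_congr rfl fun m _ => ?_
  have h' : (n : ℕ) < p := h
  by_cases h1 : n < m
  · have h2 : ¬ (m : ℕ) < n + 1 := by have : (n : ℕ) < m := h1; omega
    simp [h1, h2]
  · have h2 : (m : ℕ) < n + 1 := by have : ¬ (n : ℕ) < m := h1; omega
    have h3 : (m : ℕ) < p := by omega
    simp [h1, h2, h3]

lemma braid_of_lt (hq0 : q ≠ 0) (Z : Fin N → Fin N → ℂ) (n e : Fin N) (h : n < e.rev)
    (k l : Fin N) : braid q Z n e.rev k l = skein q * braidOff q Z n e k l := by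
  -- Only n ≤ m ≤ e' contributes. The endpoints m = n and m = e' use the diagonal part of one
  -- factor, and the values strictly in between use the off-diagonal part of both.
  have key : ∀ m, ∑ b, rMat N q n b k m • ∑ c, rMat N q m c l e.rev • Z b c
      = (if m = n then skein q * ((if l = n then q ^ dexp n k * Z k e.rev else 0)
          - (if l = e then weight N q n * weight N q e * q ^ dexp n k * Z k n.rev else 0)) else 0)
        + (if m = e.rev then skein q * ((if k = n then q ^ dexp e.rev l * Z e.rev l else 0)
          - (if k = e then weight N q n * weight N q e * q ^ dexp e.rev l * Z n.rev l else 0))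
            else 0)
        + skein q * skein q * (
          (if m = l then (if k = n ∧ n < l ∧ l < e.rev then Z l e.rev else 0) else 0)
          - (if k = n ∧ l = e then weight N q e *
              (if n < m ∧ m < e.rev then weight N q m * Z m m.rev else 0) else 0)
          - (if m = l then (if l = k.rev ∧ n < l ∧ l < e.rev then
              weight N q n * weight N q k * Z n.rev e.rev else 0) else 0)
          + (if m = k.rev then (if l = e ∧ n < k.rev ∧ k.rev < e.rev then
              weight N q n * weight N q e * Z n.rev k else 0) else 0)) := by
    intro m
    simp only [sum_rMat_smul]
    simp only [smul_eq_mul, Fin.rev_rev]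
    have hw := weight_mul_rev (N := N) hq0 m
    have hr : ∀ a b : Fin N, a = b.rev → b = a.rev := by rintro a b rfl; simp
    have hr1 := hr k m
    have hr2 := hr m k
    have hr3 := hr k l
    have hr4 := hr l k
    have hr5 := hr m e
    have hr6 := hr e m
    have hr7 := hr k n
    have hr8 := hr l n
    rcases lt_trichotomy n m with h1 | rfl | h1
    · rcases lt_trichotomy m e.rev with h2 | h2 | h2
      · simp only [h1, h1.ne', h2, h2.ne, h2.ne', if_true, if_false, and_true]
        grind
      · simp only [h2, lt_irrefl, if_true, if_false]
        grind
      · simp only [h1, h1.ne', h2.ne, h2.ne', not_lt_of_gt h2, if_true, if_false]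
        grind
    · simp only [h, h.ne, h.ne', lt_irrefl, if_true, if_false]
      grind
    · simp only [h1.ne, not_lt_of_gt h1, (h1.trans h).ne, if_false]
      grind
  simp only [braid, key, Finset.sum_add_distrib, Finset.sum_sub_distrib, ← Finset.mul_sum,
    Finset.sum_ite_eq', Finset.mem_univ, if_true]
  have h5 := ptr_sub_ptr (q := q) Z n e.rev h
  have : ∑ m, (if k = n ∧ l = e then weight N q e *
      (if n < m ∧ m < e.rev then weight N q m * Z m m.rev else 0) else 0)
      = if k = n ∧ l = e then weight N q e * (ptr q Z e.rev - ptr q Z (n + 1)) else 0 := by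
    split_ifs
    · rw [← Finset.mul_sum, h5]
    · simp
  rw [this, braidOff]
  ring

end

/-! ### Diagonal and commutation relations for the moved array. -/

section

variable {N : ℕ} {q : ℂ} {M : Type*} [AddCommGroup M] [Module ℂ M]

lemma q_zpow_dexp (k l : Fin N) : q ^ dexp k l =
    if k = l then (if k = k.rev then 1 else q ^ 2) else if l = k.rev then q ^ (-2 : ℤ) else 1 := by
  by_cases h1 : k = l
  · subst h1
    by_cases h2 : k = k.rev
    · have := dexp_of_eq k h2
      rw [← h2] at this
      rw [this, zpow_zero, if_pos rfl, if_pos h2]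
    · rw [dexp_self k h2]; simp [h2, zpow_ofNat]
  · by_cases h2 : l = k.rev
    · subst h2
      rw [dexp_rev k h1]; simp [h1]
    · rw [dexp_ne k l h1 h2]; simp [h1, h2]

lemma lt_rev_comm {a b : Fin N} (h : a < b.rev) : b < a.rev := by
  rw [Fin.lt_def, Fin.val_rev] at *; omega

lemma IsAnti.ptr_rev_cases (hq0 : q ≠ 0) {Z : Fin N → Fin N → ℂ} (h : IsAnti q Z) (j : Fin N) :
    (j < j.rev ∧ weight N q j ^ 2 * ptr q Z (N - (j + 1)) = ptr q Z (j + 1) ∧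
      weight N q j ^ 2 * ptr q Z (N - j) = q ^ 4 * ptr q Z j) ∨
    (j = j.rev ∧ weight N q j = 1 ∧ ptr q Z (N - (j + 1)) = ptr q Z j ∧
      ptr q Z (N - j) = ptr q Z (j + 1) ∧ ptr q Z (j + 1) = q ^ 2 * ptr q Z j) ∨
    (j.rev < j ∧ q ^ 4 * weight N q j ^ 2 * ptr q Z (N - (j + 1)) = ptr q Z (j + 1) ∧
      weight N q j ^ 2 * ptr q Z (N - j) = ptr q Z j) := by
  rcases lt_trichotomy j j.rev with h1 | h1 | h1
  · exact Or.inl ⟨h1, h.ptr_rev_of_lt hq0 j h1⟩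
  · have hN := (eq_rev_iff_val j).1 h1
    refine Or.inr (Or.inl ⟨h1, weight_of_eq j h1, ?_, ?_, h.ptr_rev_of_eq j h1⟩)
    · congr 1; omega
    · congr 1; omega
  · exact Or.inr (Or.inr ⟨h1, h.ptr_rev_of_gt hq0 j h1⟩)

lemma braidOff_diag (hq0 : q ≠ 0) {Z : Fin N → Fin N → ℂ} (h : IsAnti q Z) (n e : Fin N)
    (hne : n < e.rev) (k : Fin N) (hk : k ≠ k.rev) : braidOff q Z n e k k = 0 := by
  have hq2 : q ^ 2 * (q ^ 2)⁻¹ = 1 := mul_inv_cancel₀ (pow_ne_zero 2 hq0)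
  by_cases hke : k = n ∧ k = e
  · obtain ⟨rfl, rfl⟩ := hke
    have h1 := h.ptr_rev_of_lt hq0 k hne
    have hc := weight_ne_zero (N := N) hq0 k
    have hs := hne.not_gt
    simp only [braidOff, q_zpow_dexp, hne, hk, hk.symm, lt_irrefl, if_true, if_false,
      and_true, and_false, Fin.rev_rev, self_rev_eq hq0 Z k, rev_self_eq hq0 Z k,
      Fin.val_rev]
    obtain ⟨h1, h2⟩ := h1
    simp only [skein, zpow_neg, zpow_ofNat]
    field_simp
    linear_combination (1 - weight N q k ^ 2) * (h2 - q ^ 4 * h1) -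
      weight N q k ^ 2 * (q ^ 4 - 1) * h1
  · have h1 := h.comm k e.rev
    have h2 := h.comm e.rev k
    have h3 := h.comm k n.rev
    have h4 := h.comm n.rev k
    have h5 := h.diag k hk
    simp only [smul_eq_mul] at h1 h2 h3 h4
    clear h
    simp only [braidOff, q_zpow_dexp, skein, zpow_neg, zpow_ofNat, Fin.rev_rev]
    grind

/-- The positions (n, e) and (e, n) are the ones at which the antidiagonal entries of Z meet a
partial trace, so the reflection identities for both n and e are required. At the other positions
the commutation rules of Z suffice. -/
lemma braidOff_comm_special (hq0 : q ≠ 0) {Z : Fin N → Fin N → ℂ} (h : IsAnti q Z) (n e : Fin N)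
    (hne : n < e.rev) (hen : n ≠ e) :
    (n < e → braidOff q Z n e e n = -(q ^ 2 * braidOff q Z n e n e)) ∧
      (e < n → braidOff q Z n e n e = -(q ^ 2 * braidOff q Z n e e n)) := by
  have hq2 : q ^ 2 * (q ^ 2)⁻¹ = 1 := mul_inv_cancel₀ (pow_ne_zero 2 hq0)
  have hen' := lt_rev_comm hne
  have hn := h.ptr_rev_cases hq0 n
  have he := h.ptr_rev_cases hq0 e
  have hcn := weight_ne_zero (N := N) hq0 n
  have hce := weight_ne_zero (N := N) hq0 e
  have hnr : n ≠ e.rev := hne.ne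
  have her : e ≠ n.rev := hen'.ne
  clear h
  constructor
  · intro hlt
    have h0 : ¬ n.rev < e.rev := by simpa using hlt.le
    have h1 : n < n.rev := hlt.trans hen'
    have h2 := h1.ne
    have hn' := (hn.resolve_right (by rintro (h | h) <;> grind)).2
    clear hn
    simp only [braidOff, q_zpow_dexp, skein, zpow_neg, zpow_ofNat, Fin.rev_rev, if_true, if_false,
      hen, hen.symm, hnr, hlt, h2, h1, true_and, and_self, her, h0,
      self_rev_eq hq0, rev_self_eq hq0, Fin.val_rev, hnr.symm, and_false, false_and]
    generalize ptr q Z (N - (n + 1)) = n1, ptr q Z (N - n) = n2, ptr q Z (n + 1) = n3,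
      ptr q Z n = n4, ptr q Z (N - (e + 1)) = e1, ptr q Z (N - e) = e2, ptr q Z (e + 1) = e3,
      ptr q Z e = e4 at *
    generalize weight N q n = a, weight N q e = b at *
    obtain ⟨rfl, h4⟩ := hn'
    obtain rfl : n4 = a ^ 2 * n2 / q ^ 4 := by field_simp; linear_combination -h4
    rcases he with ⟨h5, rfl, h6⟩ | ⟨h5, rfl, rfl, rfl, rfl⟩ | ⟨h5, rfl, rfl⟩
    · obtain rfl : e4 = b ^ 2 * e2 / q ^ 4 := by field_simp; linear_combination -h6
      rw [if_neg h5.ne', if_pos h5]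
      field_simp; ring
    · rw [if_pos h5.symm, if_pos h5.symm, if_neg (by rw [← h5]; exact lt_irrefl e)]
      field_simp; ring
    · rw [if_neg h5.ne, if_neg h5.not_gt]
      field_simp; ring
  · intro hlt
    have h0 : n.rev < e.rev := by simpa using hlt
    have h1 : e < e.rev := hlt.trans hne
    have h2 := h1.ne
    have he' := (he.resolve_right (by rintro (h | h) <;> grind)).2
    clear he
    simp only [braidOff, q_zpow_dexp, skein, zpow_neg, zpow_ofNat, Fin.rev_rev, if_true, if_false,
      hen, hen.symm, hnr, hlt.not_gt, h2.symm, h1, true_and, and_true, and_self, her, h0,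
      self_rev_eq hq0, rev_self_eq hq0, Fin.val_rev, hnr.symm, and_false, false_and]
    generalize ptr q Z (N - (n + 1)) = n1, ptr q Z (N - n) = n2, ptr q Z (n + 1) = n3,
      ptr q Z n = n4, ptr q Z (N - (e + 1)) = e1, ptr q Z (N - e) = e2, ptr q Z (e + 1) = e3,
      ptr q Z e = e4 at *
    generalize weight N q n = a, weight N q e = b at *
    obtain ⟨rfl, h4⟩ := he'
    obtain rfl : e4 = b ^ 2 * e2 / q ^ 4 := by field_simp; linear_combination -h4
    rcases hn with ⟨h5, rfl, h6⟩ | ⟨h5, rfl, rfl, rfl, rfl⟩ | ⟨h5, rfl, rfl⟩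
    · obtain rfl : n4 = a ^ 2 * n2 / q ^ 4 := by field_simp; linear_combination -h6
      rw [if_neg h5.ne, if_pos h5]
      field_simp; ring
    · rw [if_pos h5, if_neg (by rw [← h5]; exact lt_irrefl n)]
      field_simp; ring
    · rw [if_neg h5.ne', if_neg h5.not_gt]
      field_simp; ring

lemma braidOff_comm (hq0 : q ≠ 0) {Z : Fin N → Fin N → ℂ} (h : IsAnti q Z) (n e : Fin N)
    (hne : n < e.rev) (k l : Fin N) (hkl : k < l) (hl : l ≠ k.rev) :
    braidOff q Z n e l k = -(q ^ 2 * braidOff q Z n e k l) := by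
  have hq2 : q ^ 2 * (q ^ 2)⁻¹ = 1 := mul_inv_cancel₀ (pow_ne_zero 2 hq0)
  have hl' : k ≠ l.rev := by rintro rfl; simp at hl
  have hs := braidOff_comm_special hq0 h n e hne
  have hce := h.comm
  have hcd := h.diag
  simp only [smul_eq_mul] at hce
  clear h
  by_cases hs1 : k = e ∧ l = n
  · obtain ⟨rfl, rfl⟩ := hs1
    exact (hs hkl.ne').2 hkl
  by_cases hs2 : k = n ∧ l = e
  · obtain ⟨rfl, rfl⟩ := hs2
    exact (hs hkl.ne).1 hkl
  clear hs
  simp only [braidOff, q_zpow_dexp, skein, zpow_neg, zpow_ofNat, Fin.rev_rev]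
  by_cases hke : k = e
  · have h1 := hce l n.rev
    have h2 := hce n.rev l
    have h3 := hcd l
    have h4 := hce l e.rev
    have h5 := hce e.rev l
    clear hce hcd
    by_cases hkn : k = n
    · simp only [if_pos hke, if_pos hkn]
      grind
    · by_cases hln : l = n
      · grind
      · simp only [if_neg hkn, if_neg hln]
        grind
  · by_cases hle : l = e
    · have h1 := hce k n.rev
      have h2 := hce n.rev k
      have h3 := hcd k
      have h4 := hce k e.rev
      have h5 := hce e.rev k
      clear hce hcd
      by_cases hln : l = n
      · grind
      · by_cases hkn : k = n
        · grind
        · grind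
    · have h1 := hce k e.rev
      have h2 := hce e.rev k
      have h3 := hcd k
      have h4 := hcd l
      have h5 := hce l e.rev
      have h6 := hce e.rev l
      clear hce hcd
      grind

end

/-! ### Reflection identity for the moved array. -/

section

variable {N : ℕ} {q : ℂ} {M : Type*} [AddCommGroup M] [Module ℂ M]

lemma weight_mul_braidOff_rev (hq0 : q ≠ 0) (Z : Fin N → Fin N → ℂ) (n e : Fin N)
    (hne : n < e.rev) (hen : n ≠ e) (k : Fin N) :
    weight N q k * braidOff q Z n e k k.rev =
      (if k = n.rev then weight N q n.rev * q ^ dexp n n.rev * Z n.rev e.rev else 0)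
      - (if k = e.rev then weight N q n * Z e.rev n.rev else 0)
      + (if k = n then weight N q n * Z e.rev n.rev else 0)
      - (if k = e then weight N q n * (weight N q e ^ 2 * q ^ dexp e.rev e.rev) * Z n.rev e.rev
          else 0)
      + skein q * ((if k = n ∧ e < n ∧ n < n.rev then weight N q n * Z n.rev e.rev else 0)
        - (if e < k ∧ k < n.rev then weight N q n * weight N q k ^ 2 * Z n.rev e.rev else 0)
        + (if k = e.rev ∧ n < e ∧ e < e.rev then weight N q n * Z n.rev e.rev else 0)) := by
  have hen' := lt_rev_comm hne
  have d1 : q ^ dexp n e.rev = 1 := by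
    rw [dexp_ne _ _ hne.ne (by simpa using hen.symm), zpow_zero]
  have d2 : q ^ dexp e.rev n.rev = 1 := by
    rw [dexp_ne _ _ (by simpa using hen.symm) (by simpa using hen'.ne'), zpow_zero]
  have e1 : (k.rev = n) = (k = n.rev) := by rw [Fin.rev_eq_iff]
  have e2 : (k.rev = e) = (k = e.rev) := by rw [Fin.rev_eq_iff]
  have e3 : (n < k.rev) = (k < n.rev) := propext ⟨lt_rev_comm, lt_rev_comm⟩
  have e4 : (k.rev < e.rev) = (e < k) := by simp
  have hw := weight_mul_rev (N := N) hq0 e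
  simp only [braidOff, e1, e2, e3, e4, true_and]
  have t1 : weight N q k * (if k = n.rev then q ^ dexp n k * Z k e.rev else 0)
      = if k = n.rev then weight N q n.rev * q ^ dexp n n.rev * Z n.rev e.rev else 0 := by
    split_ifs with h
    · rw [h]; ring
    · ring
  have t2 : weight N q k * (if k = e.rev then weight N q n * weight N q e * q ^ dexp n k *
      Z k n.rev else 0) = if k = e.rev then weight N q n * Z e.rev n.rev else 0 := by
    split_ifs with h
    · rw [h, d1]; linear_combination weight N q n * Z e.rev n.rev * hw
    · ring
  have t3 : weight N q k * (if k = n then q ^ dexp e.rev k.rev * Z e.rev k.rev else 0)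
      = if k = n then weight N q n * Z e.rev n.rev else 0 := by
    split_ifs with h
    · rw [h, d2]; ring
    · ring
  have t4 : weight N q k * (if k = e then weight N q n * weight N q e * q ^ dexp e.rev k.rev *
      Z n.rev k.rev else 0) = if k = e then
        weight N q n * (weight N q e ^ 2 * q ^ dexp e.rev e.rev) * Z n.rev e.rev else 0 := by
    split_ifs with h
    · rw [h]; ring
    · ring
  have t5 : weight N q k * (if k = n ∧ k < n.rev ∧ e < k then Z k.rev e.rev else 0)
      = if k = n ∧ e < n ∧ n < n.rev then weight N q n * Z n.rev e.rev else 0 := by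
    by_cases h : k = n
    · rw [h, mul_ite, mul_zero]; simp only [true_and, and_comm]
    · simp [h]
  have t6 : (if k = n ∧ k = e.rev then weight N q e * (ptr q Z e.rev - ptr q Z (n + 1)) else 0)
      = 0 := by
    rw [if_neg]; rintro ⟨rfl, h⟩; exact hne.ne h
  have t7 : weight N q k * (if k < n.rev ∧ e < k then weight N q n * weight N q k *
      Z n.rev e.rev else 0)
      = if e < k ∧ k < n.rev then weight N q n * weight N q k ^ 2 * Z n.rev e.rev else 0 := by
    by_cases a : e < k <;> by_cases b : k < n.rev <;> simp [a, b]
    ring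
  have t8 : weight N q k * (if k = e.rev ∧ k < n.rev ∧ e < k then weight N q n * weight N q e *
      Z n.rev k else 0) = if k = e.rev ∧ n < e ∧ e < e.rev then
        weight N q n * Z n.rev e.rev else 0 := by
    by_cases h : k = e.rev
    · rw [h, mul_ite, mul_zero]
      simp only [true_and, Fin.rev_lt_rev]
      congr 1
      linear_combination weight N q n * Z n.rev e.rev * hw
    · simp [h]
  rw [t6]
  linear_combination t1 - t2 + t3 - t4 + skein q * (t5 - t7 + t8)

/-- The summand has isolated contributions at n', e', n and e. Strictly between e and n' it is
proportional to the squared weight, which produces the partial traces of the metric. -/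
lemma ptr_braidOff (hq0 : q ≠ 0) (Z : Fin N → Fin N → ℂ) (n e : Fin N)
    (hne : n < e.rev) (hen : n ≠ e) (m : ℕ) (hm : m ≤ N) :
    ptr q (braidOff q Z n e) m =
      (if (n.rev : ℕ) < m then weight N q n.rev * q ^ dexp n n.rev * Z n.rev e.rev else 0)
      + (if (e.rev : ℕ) < m then weight N q n * (skein q * (if n < e ∧ e < e.rev then
          Z n.rev e.rev else 0) - Z e.rev n.rev) else 0)
      + (if (n : ℕ) < m then weight N q n * (skein q * (if e < n ∧ n < n.rev then
          Z n.rev e.rev else 0) + Z e.rev n.rev) else 0)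
      - (if (e : ℕ) < m then weight N q n *
          (weight N q e ^ 2 * q ^ dexp e.rev e.rev + skein q * ptr q (metric N q) (min m n.rev)
            - skein q * ptr q (metric N q) (e + 1)) * Z n.rev e.rev else 0) := by
  have hen' : (e : ℕ) < n.rev := lt_rev_comm hne
  induction m with
  | zero => simp [ptr_zero]
  | succ m ih =>
    obtain ⟨k, rfl⟩ : ∃ k : Fin N, (k : ℕ) = m := ⟨⟨m, hm⟩, rfl⟩
    have hp := ptr_succ (q := q) (metric N q) k
    rw [metric_rev, smul_eq_mul] at hp
    rw [ptr_succ, ih (by omega), smul_eq_mul, weight_mul_braidOff_rev hq0 Z n e hne hen]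
    clear ih
    have s1 : ∀ (a : Fin N) (x : ℂ), (if (a : ℕ) < k + 1 then x else 0)
        = (if (a : ℕ) < k then x else 0) + if k = a then x else 0 := by
      intro a x
      rcases lt_trichotomy k a with h | h | h
      · have h' : (k : ℕ) < a := h
        rw [if_neg (by omega), if_neg (by omega), if_neg h.ne, add_zero]
      · simp [h]
      · have h' : (a : ℕ) < k := h
        rw [if_pos (by omega), if_pos (by omega), if_neg h.ne', add_zero]
    simp only [s1]
    have hn : (if k = n then weight N q n * (skein q * (if e < n ∧ n < n.rev then
          Z n.rev e.rev else 0) + Z e.rev n.rev) else 0)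
        = skein q * (if k = n ∧ e < n ∧ n < n.rev then weight N q n * Z n.rev e.rev else 0)
          + if k = n then weight N q n * Z e.rev n.rev else 0 := by
      by_cases a : k = n <;> by_cases b : e < n ∧ n < n.rev <;> simp [a, b]
      ring
    have he : (if k = e.rev then weight N q n * (skein q * (if n < e ∧ e < e.rev then
          Z n.rev e.rev else 0) - Z e.rev n.rev) else 0)
        = skein q * (if k = e.rev ∧ n < e ∧ e < e.rev then weight N q n * Z n.rev e.rev else 0)
          - if k = e.rev then weight N q n * Z e.rev n.rev else 0 := by
      by_cases a : k = e.rev <;> by_cases b : n < e ∧ e < e.rev <;> simp [a, b]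
      ring
    rw [hn, he]
    clear hn he
    rcases lt_trichotomy k e with h | h | h
    · have h' : (k : ℕ) < e := h
      simp only [h.not_gt, h.ne, if_neg (not_lt.2 h'.le), if_false, false_and]
      ring
    · subst h
      rw [min_eq_left (by omega : (k : ℕ) + 1 ≤ n.rev)]
      simp only [lt_irrefl, if_true, if_false, false_and]
      ring
    · have h' : (e : ℕ) < k := h
      simp only [h, h.ne', if_pos h', if_false, true_and]
      by_cases h2 : k < n.rev
      · have h2' : (k : ℕ) < n.rev := h2
        rw [min_eq_left (by omega), min_eq_left (by omega), hp, if_pos h2]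
        ring
      · have h2' : ¬ (k : ℕ) < n.rev := h2
        rw [min_eq_right (by omega), min_eq_right (by omega), if_neg h2]
        ring

/-- This and `weight_sq_mul_dexp_self` rewrite the isolated contributions by partial traces of the
metric, so that they merge with the telescoped part; the correction accounts for indices past the
middle. -/
lemma weight_sq_mul_dexp_rev (hq0 : q ≠ 0) (j : Fin N) :
    weight N q j ^ 2 * q ^ dexp j.rev j = skein q * ptr q (metric N q) j + q ^ (2 - 2 * (N : ℤ))
      - if j.rev < j then skein q else 0 := by
  have hd : dexp j.rev j = dexp j j.rev := by simp [dexp, eq_comm]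
  have g := skein_mul_ptr_metric (N := N) hq0 j j.is_lt.le
  rw [hd]
  rcases lt_trichotomy j j.rev with h | h | h
  · rw [if_neg h.not_gt, dexp_rev j h.ne, weight_sq_of_lt hq0 j h, ← zpow_add₀ hq0,
      g.1 (by rw [lt_rev_iff_val] at h; omega), show 4 * (j : ℤ) + 4 - 2 * N + -2
        = 4 * j + 2 - 2 * N by ring]
    ring
  · have h' := (eq_rev_iff_val j).1 h
    rw [if_neg (by rw [← h]; exact lt_irrefl j), dexp_of_eq j h, weight_of_eq j h,
      g.1 (by omega), show 4 * (j : ℤ) + 2 - 2 * N = 0 by omega]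
    ring
  · rw [if_pos h, dexp_rev j h.ne', weight_sq_of_gt hq0 j h, ← zpow_add₀ hq0,
      g.2 (by rw [rev_lt_iff_val] at h; omega), show 4 * (j : ℤ) - 2 * N + -2
        = 4 * j - 2 - 2 * N by ring]
    ring

lemma weight_sq_mul_dexp_self (hq0 : q ≠ 0) (j : Fin N) :
    weight N q j ^ 2 * q ^ dexp j.rev j.rev = skein q * ptr q (metric N q) (j + 1)
      + q ^ (2 - 2 * (N : ℤ)) - if j.rev ≤ j then skein q else 0 := by
  have hd : dexp j.rev j.rev = dexp j j := by simp [dexp, eq_comm]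
  have g := skein_mul_ptr_metric (N := N) hq0 (j + 1) j.is_lt
  rw [hd]
  push_cast at g
  rcases lt_trichotomy j j.rev with h | h | h
  · rw [if_neg (not_le.2 h), dexp_self j h.ne, weight_sq_of_lt hq0 j h, ← zpow_add₀ hq0,
      g.1 (by rw [lt_rev_iff_val] at h; omega), show 4 * (j : ℤ) + 4 - 2 * N + 2
        = 4 * (j + 1) + 2 - 2 * N by ring]
    ring
  · have h' := (eq_rev_iff_val j).1 h
    have hd' : dexp j j = 0 := by simp [dexp, ← h]
    rw [if_pos h.symm.le, hd', weight_of_eq j h,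
      g.2 (by omega), show 4 * ((j : ℤ) + 1) - 2 - 2 * N = 0 by omega]
    ring
  · rw [if_pos h.le, dexp_self j h.ne', weight_sq_of_gt hq0 j h, ← zpow_add₀ hq0,
      g.2 (by rw [rev_lt_iff_val] at h; omega), show 4 * (j : ℤ) - 2 * N + 2
        = 4 * (j + 1) - 2 - 2 * N by ring]
    ring

/-- For n = e every summand of the trace vanishes, since Z n' n' = 0. For n ≠ e the closed form is
compared at l and N - l for each position of l relative to n, e, n', e'; the two entries Z n' e' and
Z e' n' are proportional by the commutation rule. -/
lemma braidOff_refl (hq0 : q ≠ 0) {Z : Fin N → Fin N → ℂ} (h : IsAnti q Z) (n e : Fin N)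
    (hne : n < e.rev) (l : ℕ) (hl : l ≤ N) : ptr q (braidOff q Z n e) (N - l)
      = q ^ (2 * (N : ℤ) - 4 * l) * ptr q (braidOff q Z n e) l := by
  by_cases hen : n = e
  · subst hen
    have h0 := h.diag n.rev (by simpa using hne.ne')
    have hz : ∀ m, ptr q (braidOff q Z n n) m = 0 := by
      intro m
      refine Finset.sum_eq_zero fun k _ => ?_
      have hnr : n.rev ≠ n := hne.ne'
      have e1 : (k.rev = n) = (k = n.rev) := by rw [Fin.rev_eq_iff]
      simp only [braidOff, e1, smul_eq_mul]
      grind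
    rw [hz, hz, mul_zero]
  refine refl_of_half hq0 (fun l hl => ?_) l hl
  have hA : weight N q n.rev * q ^ dexp n n.rev = weight N q n * (skein q *
      ptr q (metric N q) n.rev + q ^ (2 - 2 * (N : ℤ)) - if n < n.rev then skein q else 0) := by
    have h1 := weight_sq_mul_dexp_rev (N := N) hq0 n.rev
    rw [Fin.rev_rev] at h1
    rw [← h1]
    linear_combination - weight N q n.rev * q ^ dexp n n.rev * weight_mul_rev (N := N) hq0 n
  have hE := weight_sq_mul_dexp_self (N := N) hq0 e
  rw [ptr_braidOff hq0 Z n e hne hen _ (by omega), ptr_braidOff hq0 Z n e hne hen _ (by omega),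
    hA, hE]
  have g1 := (skein_mul_ptr_metric (N := N) hq0 l (by omega)).1 hl
  have g2 := (skein_mul_ptr_metric (N := N) hq0 (N - l) (by omega)).2 (by omega)
  have ht : q ^ (2 * (N : ℤ) - 4 * l) ≠ 0 := zpow_ne_zero _ hq0
  have hs : q ^ 2 * (q ^ 2)⁻¹ = 1 := mul_inv_cancel₀ (pow_ne_zero 2 hq0)
  have hw : skein q = q ^ 2 - (q ^ 2)⁻¹ := by simp [skein, zpow_neg, zpow_ofNat]
  rw [show q ^ (4 * (l : ℤ) + 2 - 2 * N) = q ^ 2 * (q ^ (2 * (N : ℤ) - 4 * l))⁻¹ by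
    rw [← zpow_natCast, ← zpow_neg, ← zpow_add₀ hq0]; congr 1; push_cast; ring] at g1
  rw [Nat.cast_sub (by omega : l ≤ N), show q ^ (4 * ((N : ℤ) - l) - 2 - 2 * N)
      = (q ^ 2)⁻¹ * q ^ (2 * (N : ℤ) - 4 * l) by
    rw [← zpow_natCast, ← zpow_neg, ← zpow_add₀ hq0]; congr 1; push_cast; ring] at g2
  have ht1 : N - l = l → q ^ (2 * (N : ℤ) - 4 * l) = 1 := by
    intro h1
    rw [show 2 * (N : ℤ) - 4 * l = 0 by omega, zpow_zero]
  have hti := mul_inv_cancel₀ ht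
  have c1 : e < n → _ := fun hh => h.comm n.rev e.rev (by simpa using hh) (by simpa using hne.ne')
  have c2 : n < e → _ := fun hh => h.comm e.rev n.rev (by simpa using hh)
    (by simpa using (lt_rev_comm hne).ne')
  simp only [smul_eq_mul] at c1 c2
  have v1 : (n : ℕ) + n.rev + 1 = N := by rw [Fin.val_rev]; omega
  have v2 : (e : ℕ) + e.rev + 1 = N := by rw [Fin.val_rev]; omega
  have v3 : (n : ℕ) < e.rev := hne
  have v4 : (n : ℕ) ≠ e := fun h => hen (Fin.ext h)
  simp only [Fin.lt_def, Fin.le_def] at *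
  clear hA hE
  generalize q ^ (2 * (N : ℤ) - 4 * l) = t,
    q ^ (2 - 2 * (N : ℤ)) = z, (q ^ 2)⁻¹ = s, Z n.rev e.rev = zb, Z e.rev n.rev = za,
    weight N q n = c, skein q = w at *
  clear h ht
  have m1 := le_total l n.rev
  have m2 := le_total (N - l) n.rev
  have m3 : l ≤ n.rev → min l n.rev = l := min_eq_left
  have m4 : n.rev ≤ l → min l n.rev = n.rev := min_eq_right
  have m5 : N - l ≤ n.rev → min (N - l) n.rev = N - l := min_eq_left
  have m6 : n.rev ≤ N - l → min (N - l) n.rev = n.rev := min_eq_right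
  generalize t⁻¹ = ti at *
  generalize (n.rev : ℕ) = n', (e.rev : ℕ) = e', (n : ℕ) = a, (e : ℕ) = b at *
  generalize ptr q (metric N q) = G at *
  generalize min l n' = m, min (N - l) n' = m' at *
  generalize hr : N - l = r at *
  -- The metric trace up to e + 1 occurs in the contribution at e and as the lower limit of the
  -- telescoped sum, and cancels.
  have hx : ∀ x y u : ℂ, x + z - y + u - x = u + z - y := by intros; ring
  simp only [hx]
  rcases lt_or_gt_of_ne v4 with h1 | h1
  · have := c2 h1
    clear c1 c2
    have f1 : a < n' := by omega
    have f2 : ¬ b < a := by omega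
    have f3 : ¬ n' < l := by omega
    have f4 : (a < b ∧ b < e') = (b < e') := by simp [h1]
    have f5 : (e' ≤ b) = ¬ b < e' := by simp
    simp only [f1, f2, f3, f4, f5, if_true, if_false, false_and, m3 (by omega)]
    rcases le_or_gt l a with h2 | h2
    · have f6 : n' < r := by omega
      have f7 : e' < r := by omega
      have f8 : a < r := by omega
      have f9 : b < r := by omega
      have f10 : ¬ e' < l := by omega
      have f11 : ¬ b < l := by omega
      simp only [f6, f7, f8, f9, f10, f11, h2.not_gt, if_true, if_false, m6 f6.le]
      split_ifs <;> ring
    · have f8 : a < r := by omega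
      simp only [h2, f8, if_true, not_lt.2 (by omega : r ≤ n'), if_false, m5 (by omega), g1,
        g2]
      subst this hw
      by_cases h3 : b < l
      · have i1 : ¬ e' < l := by omega
        have i2 : ¬ e' < r := by omega
        have i3 : b < r := by omega
        have i4 : b < e' := by omega
        simp only [h3, i1, i2, i3, i4, if_true, if_false, not_true]
        linear_combination c * za * (t - 1) * hs - c * za * q ^ 4 * hti
      · by_cases h4 : e' < l
        · have i2 : e' < r := by omega
          have i3 : ¬ b < r := by omega
          have i4 : ¬ b < e' := by omega
          simp only [h3, h4, i2, i3, i4, if_true, if_false]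
          ring
        · have i2 : e' < r := by omega
          have i3 : b < r := by omega
          simp only [h3, h4, i2, i3, if_true, if_false]
          by_cases h5 : b < e'
          · simp only [h5, if_true, if_false, not_true]
            linear_combination c * t * za * hs
          · simp only [h5, if_true, if_false, not_false_eq_true]
            linear_combination c * t * za * hs
  · have := c1 h1
    clear c1 c2
    rcases le_or_gt l b with h2 | h2
    · have f1 : n' < r := by omega
      have f2 : e' < r := by omega
      have f3 : a < r := by omega
      have f4 : b < r := by omega
      have f5 : ¬ n' < l := by omega
      have f6 : ¬ e' < l := by omega
      have f7 : ¬ a < l := by omega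
      have f8 : ¬ e' ≤ b := by omega
      simp only [f1, f2, f3, f4, f5, f6, f7, f8, h1, h1.not_gt, h2.not_gt, if_true, if_false,
        m6 f1.le, false_and, true_and]
      split_ifs <;> rw [this] <;> ring
    · have f1 : b < r := by omega
      have f2 : ¬ e' < r := by omega
      have f3 : ¬ e' < l := by omega
      have f4 : ¬ e' ≤ b := by omega
      simp only [f1, f2, f3, f4, h1, h1.not_gt, h2, if_true, if_false, false_and, true_and]
      subst this hw
      by_cases h3 : n' < l
      · rw [m4 h3.le, m6 (by omega)]
        have i1 : n' < r := by omega
        have i2 : ¬ a < r := by omega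
        have i3 : ¬ a < l := by omega
        have i4 : ¬ a < n' := by omega
        simp only [h3, i1, i2, i3, i4, if_true, if_false]
        ring
      · rw [m3 (by omega), g1]
        by_cases h4 : a < l
        · rw [m5 (by omega), g2]
          have i1 : ¬ n' < r := by omega
          have i2 : a < r := by omega
          have i3 : a < n' := by omega
          simp only [h3, h4, i1, i2, i3, if_true, if_false]
          linear_combination c * q ^ 2 * zb * hti
        · rw [m6 (by omega)]
          have i1 : n' < r := by omega
          have i2 : a < r := by omega
          simp only [h3, h4, i1, i2, if_true, if_false]
          by_cases h5 : a < n'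
          · simp only [h5, if_true]
            linear_combination c * q ^ 2 * zb * hti
          · simp only [h5, if_false]
            linear_combination c * q ^ 2 * zb * hti

end

/-! ### Preservation of exterior arrays by braiding; R̂⁻¹ and crossing symmetry. -/

section

variable {N : ℕ} {q : ℂ} {M : Type*} [AddCommGroup M] [Module ℂ M]

lemma dexp_add_rev (n k : Fin N) : dexp n k + dexp n k.rev = 0 := by
  simp only [dexp, Fin.rev_rev]; ring

/-- For n > p the array is zero. For n = p it is a rescaling whose factors at k and k' cancel, so
partial traces are unchanged. For n < p the three preceding verifications apply. -/
lemma isAnti_braid_complex (hq0 : q ≠ 0) {Z : Fin N → Fin N → ℂ} (h : IsAnti q Z) (n p : Fin N) :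
    IsAnti q (braid q Z n p) := by
  rcases lt_trichotomy n p with hnp | rfl | hnp
  · obtain ⟨e, rfl⟩ : ∃ e : Fin N, p = e.rev := ⟨p.rev, by simp⟩
    have h1 : IsAnti q (braidOff q Z n e) :=
      ⟨braidOff_diag hq0 h n e hnp, braidOff_comm hq0 h n e hnp, braidOff_refl hq0 h n e hnp⟩
    have h2 : braid q Z n e.rev = fun k l => skein q • braidOff q Z n e k l := by
      funext k l; exact braid_of_lt hq0 Z n e hnp k l
    rw [h2]; exact h1.smul _
  · have hp : ∀ m, ptr q (braid q Z n n) m = ptr q Z m := by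
      intro m
      refine Finset.sum_congr rfl fun k _ => ?_
      rw [braid_diag, ← zpow_add₀ hq0, dexp_add_rev, zpow_zero, one_smul]
    refine ⟨fun k hk => ?_, fun k l hkl hl => ?_, fun l hl => ?_⟩
    · rw [braid_diag, h.diag k hk, smul_zero]
    · rw [braid_diag, braid_diag, h.comm k l hkl hl]
      simp only [smul_eq_mul]; ring
    · rw [hp, hp, h.refl l hl]
  · have h2 : braid q Z n p = fun k l => 0 := by
      funext k l; exact braid_of_gt Z hnp k l
    rw [h2]; exact isAnti_zero

lemma map_braid {M' : Type*} [AddCommGroup M'] [Module ℂ M'] (f : M →ₗ[ℂ] M')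
    (Z : Fin N → Fin N → M) (n p k l : Fin N) :
    f (braid q Z n p k l) = braid q (fun i j => f (Z i j)) n p k l := by
  simp [braid, map_sum]

lemma IsAnti.braid (hq0 : q ≠ 0) {Z : Fin N → Fin N → M} (h : IsAnti q Z) (n p : Fin N) :
    IsAnti q (braid q Z n p) := by
  refine isAnti_of_dual fun f => ?_
  simp only [map_braid]
  exact isAnti_braid_complex hq0 (h.map f) n p

/-- The inverse of the `R̂`-matrix. -/
def rInv (N : ℕ) (q : ℂ) : Mat4 N := fun i j k l =>
  rMat N q i j k l - skein q * (delta i k * delta j l - kMat N q i j k l)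

lemma amul_rInv (Z : Fin N → Fin N → M) (k l : Fin N) :
    amul Z (rInv N q) k l = amul Z (rMat N q) k l - skein q • Z k l
      + (skein q * metric N q k l) • ptr q Z N := by
  have h1 : ∑ i, ∑ j, (delta i k * delta j l : ℂ) • Z i j = Z k l := by
    rw [Finset.sum_eq_single k, Finset.sum_eq_single l]
    · simp [delta]
    · intro j _ hj; simp [delta, hj]
    · simp
    · intro i _ hi; simp [delta, hi]
    · simp
  have h2 := amul_kMat (q := q) Z k l
  simp only [amul] at h2 ⊢
  rw [mul_smul, ← h2]
  conv_rhs => rw [← h1]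
  simp only [Finset.smul_sum, smul_smul, ← Finset.sum_add_distrib, ← Finset.sum_sub_distrib,
    ← sub_smul, ← add_smul]
  refine Finset.sum_congr rfl fun i _ => Finset.sum_congr rfl fun j _ => ?_
  congr 1
  simp only [rInv]; ring

lemma IsAnti.amul_rInv (hq0 : q ≠ 0) {Z : Fin N → Fin N → M} (h : IsAnti q Z) (k l : Fin N) :
    amul Z (rInv N q) k l = -(q ^ 2) • Z k l := by
  rw [FRT.amul_rInv, h.amul_rMat hq0, h.ptr_top, smul_zero, add_zero, ← sub_smul, skein]
  congr 1; ring

lemma rMat_apply (i j k l : Fin N) : rMat N q i j k l =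
    (if i = l ∧ j = k then q ^ dexp k l else 0)
      + if i < l then skein q * ((if i = k ∧ j = l then 1 else 0)
        - if i = j.rev ∧ k = l.rev then weight N q i * weight N q k else 0) else 0 := by
  have h1 : q ^ ((if i = j then 2 else 0) - (if i = j.rev then 2 else 0) : ℤ)
      * (delta i l * delta j k) = if i = l ∧ j = k then q ^ dexp k l else 0 := by
    by_cases h1 : i = l <;> by_cases h2 : j = k <;> simp [delta, h1, h2, dexp]
    have : l = k.rev ↔ k = l.rev := by rw [eq_comm, Fin.rev_eq_iff]
    simp [eq_comm, this]
  have h2 : (delta i k * delta j l : ℂ) = if i = k ∧ j = l then 1 else 0 := by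
    by_cases h1 : i = k <;> by_cases h2 : j = l <;> simp [delta, h1, h2]
  have h3 : kMat N q i j k l =
      if i = j.rev ∧ k = l.rev then weight N q i * weight N q k else 0 := by
    by_cases h1 : i = j.rev <;> by_cases h2 : k = l.rev <;> simp [kMat, metric_eq, h1, h2]
  rw [rMat, h1, h2, h3, skein]
  split_ifs <;> ring

lemma rInv_apply (i j k l : Fin N) : rInv N q i j k l =
    (if i = l ∧ j = k then q ^ dexp k l else 0)
      - if l ≤ i then skein q * ((if i = k ∧ j = l then 1 else 0)
        - if i = j.rev ∧ k = l.rev then weight N q i * weight N q k else 0) else 0 := by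
  have h2 : (delta i k * delta j l : ℂ) = if i = k ∧ j = l then 1 else 0 := by
    by_cases h1 : i = k <;> by_cases h2 : j = l <;> simp [delta, h1, h2]
  have h3 : kMat N q i j k l =
      if i = j.rev ∧ k = l.rev then weight N q i * weight N q k else 0 := by
    by_cases h1 : i = j.rev <;> by_cases h2 : k = l.rev <;> simp [kMat, metric_eq, h1, h2]
  rw [rInv, rMat_apply, h2, h3]
  rcases lt_or_ge i l with h | h
  · rw [if_pos h, if_neg (not_le.2 h)]; ring
  · rw [if_neg (not_lt.2 h), if_pos h]; ring

/-- Crossing: rotating one index with the metric exchanges R̂ and R̂⁻¹. `rMat_mul_weight` and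
`metric_rInv` are the rotations of the other indices that occur below. -/
lemma metric_rMat (hq0 : q ≠ 0) (k c l d : Fin N) : weight N q k * rMat N q k.rev c l d
    = rInv N q c d.rev k l * weight N q d.rev := by
  have hr : ∀ a b : Fin N, a.rev = b → b.rev = a := by rintro a b rfl; simp
  have h1 := hr k d
  have h2 := hr d k
  have h3 := hr l d
  have h4 := hr d l
  have h5 := hr c k
  have h6 := hr k c
  have h7 := hr k l
  have h8 := hr l k
  have h9 := hr l c
  have h10 := hr c l
  have w1 := weight_mul_rev (N := N) hq0 k
  have w2 := weight_mul_rev (N := N) hq0 d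
  have w3 := weight_mul_rev (N := N) hq0 l
  have w4 := weight_mul_rev (N := N) hq0 c
  have hq2 : q ^ 2 * (q ^ 2)⁻¹ = 1 := mul_inv_cancel₀ (pow_ne_zero 2 hq0)
  have hw : ∀ j : Fin N, j = j.rev → weight N q j = 1 := weight_of_eq
  have hw1 := hw k
  have hw2 := hw d
  have hw3 := hw c
  have hw4 := hw l
  simp only [rMat_apply, rInv_apply, q_zpow_dexp, skein, zpow_neg, zpow_ofNat, Fin.rev_rev]
  generalize (q ^ 2)⁻¹ = s at *
  clear hw hr hq0
  grind

end

section

variable {N : ℕ} {q : ℂ} {M : Type*} [AddCommGroup M] [Module ℂ M]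

lemma rMat_mul_weight (hq0 : q ≠ 0) (n b k c : Fin N) : rMat N q n b k c.rev * weight N q c.rev
    = weight N q n * rInv N q b c n.rev k := by
  have hr : ∀ a b : Fin N, a.rev = b → b.rev = a := by rintro a b rfl; simp
  have h1 := hr k n
  have h2 := hr n k
  have h3 := hr b n
  have h4 := hr n b
  have h5 := hr c k
  have h6 := hr k c
  have h7 := hr k b
  have h8 := hr b k
  have h9 := hr b c
  have h10 := hr c b
  have h11 := hr c n
  have h12 := hr n c
  have w1 := weight_mul_rev (N := N) hq0 k
  have w2 := weight_mul_rev (N := N) hq0 n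
  have w3 := weight_mul_rev (N := N) hq0 b
  have w4 := weight_mul_rev (N := N) hq0 c
  have hq2 : q ^ 2 * (q ^ 2)⁻¹ = 1 := mul_inv_cancel₀ (pow_ne_zero 2 hq0)
  have hw : ∀ j : Fin N, j = j.rev → weight N q j = 1 := weight_of_eq
  have hw1 := hw k
  have hw2 := hw n
  have hw3 := hw c
  have hw4 := hw b
  simp only [rMat_apply, rInv_apply, q_zpow_dexp, skein, zpow_neg, zpow_ofNat, Fin.rev_rev]
  generalize (q ^ 2)⁻¹ = s at *
  clear hw hr hq0
  grind

lemma metric_rInv (hq0 : q ≠ 0) (i n j k : Fin N) : weight N q i * rInv N q i.rev n j k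
    = rMat N q n k.rev i j * weight N q k.rev := by
  have hr : ∀ a b : Fin N, a.rev = b → b.rev = a := by rintro a b rfl; simp
  have h1 := hr k n
  have h2 := hr n k
  have h3 := hr i n
  have h4 := hr n i
  have h5 := hr j k
  have h6 := hr k j
  have h7 := hr k i
  have h8 := hr i k
  have h9 := hr i j
  have h10 := hr j i
  have h11 := hr j n
  have h12 := hr n j
  have w1 := weight_mul_rev (N := N) hq0 k
  have w2 := weight_mul_rev (N := N) hq0 n
  have w3 := weight_mul_rev (N := N) hq0 i
  have w4 := weight_mul_rev (N := N) hq0 j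
  have hq2 : q ^ 2 * (q ^ 2)⁻¹ = 1 := mul_inv_cancel₀ (pow_ne_zero 2 hq0)
  have hw : ∀ j : Fin N, j = j.rev → weight N q j = 1 := weight_of_eq
  have hw1 := hw k
  have hw2 := hw n
  have hw3 := hw i
  have hw4 := hw j
  simp only [rMat_apply, rInv_apply, q_zpow_dexp, skein, zpow_neg, zpow_ofNat, Fin.rev_rev]
  generalize (q ^ 2)⁻¹ = s at *
  clear hw hr hq0
  grind

lemma weight_inv_rev (i : Fin N) : weight N q⁻¹ i.rev = weight N q i := by
  simp [weight, twoRho_rev]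

lemma rMat_symm (hq0 : q ≠ 0) (i j k l : Fin N) : rMat N q i j k l = rMat N q k l i j := by
  have hr : ∀ a b : Fin N, a.rev = b → b.rev = a := by rintro a b rfl; simp
  have h1 := hr k i
  have h2 := hr i k
  have h3 := hr i j
  have h4 := hr j i
  have h5 := hr k l
  have h6 := hr l k
  have h7 := hr j l
  have h8 := hr l j
  have h9 := hr i l
  have h10 := hr l i
  have h11 := hr j k
  have h12 := hr k j
  have w1 := weight_mul_rev (N := N) hq0 k
  have w2 := weight_mul_rev (N := N) hq0 i
  have w3 := weight_mul_rev (N := N) hq0 l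
  have w4 := weight_mul_rev (N := N) hq0 j
  simp only [rMat_apply, q_zpow_dexp, skein, zpow_neg, zpow_ofNat]
  clear hr hq0
  grind

/-- Reversing the indices and replacing q by q⁻¹ turns R̂ into its inverse. Every statement about R̂
thereby yields one about R̂⁻¹. -/
lemma rInv_eq_rMat_inv (hq0 : q ≠ 0) (i j k l : Fin N) :
    rInv N q i j k l = rMat N q⁻¹ i.rev j.rev k.rev l.rev := by
  have hr : ∀ a b : Fin N, a.rev = b → b.rev = a := by rintro a b rfl; simp
  have h1 := hr k i
  have h2 := hr i k
  have h3 := hr i j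
  have h4 := hr j i
  have h5 := hr k l
  have h6 := hr l k
  have h7 := hr j l
  have h8 := hr l j
  have h9 := hr i l
  have h10 := hr l i
  have h11 := hr j k
  have h12 := hr k j
  have w1 := weight_mul_rev (N := N) hq0 k
  have w2 := weight_mul_rev (N := N) hq0 i
  have w3 := weight_mul_rev (N := N) hq0 l
  have w4 := weight_mul_rev (N := N) hq0 j
  have hq2 : q ^ 2 * (q ^ 2)⁻¹ = 1 := mul_inv_cancel₀ (pow_ne_zero 2 hq0)
  have hw : ∀ j : Fin N, j = j.rev → weight N q j = 1 := weight_of_eq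
  have hw1 := hw k
  have hw2 := hw l
  have hw3 := hw i
  have hw4 := hw j
  simp only [rMat_apply, rInv_apply, q_zpow_dexp, weight_inv_rev, skein, zpow_neg, zpow_ofNat,
    Fin.rev_rev, inv_pow, inv_inv]
  generalize (q ^ 2)⁻¹ = s at *
  clear hw hr hq0
  grind

end

/-! ### Index reversal and the braidings by R̂⁻¹. -/

section

variable {N : ℕ} {q : ℂ} {M : Type*} [AddCommGroup M] [Module ℂ M]

lemma inv_pow_ne_one (hq : ∀ m : ℕ, 1 ≤ m → q ^ m ≠ 1) (m : ℕ) (hm : 1 ≤ m) : q⁻¹ ^ m ≠ 1 := by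
  rw [inv_pow]; exact fun h => hq m hm (inv_eq_one.1 h)

lemma sum_rev {A : Type*} [AddCommMonoid A] (f : Fin N → A) : ∑ i : Fin N, f i.rev = ∑ i, f i :=
  Equiv.sum_comp Fin.revPerm f

lemma IsAnti.reverse (hq0 : q ≠ 0) (hq : ∀ m : ℕ, 1 ≤ m → q ^ m ≠ 1) {Z : Fin N → Fin N → M}
    (h : IsAnti q Z) : IsAnti q⁻¹ (fun i j => Z i.rev j.rev) := by
  refine isAnti_of_amul (inv_ne_zero hq0) (inv_pow_ne_one hq) fun k l => ?_
  have e := h.amul_rInv hq0 k.rev l.rev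
  -- The eigenvalue -q² of R̂⁻¹ is the exterior eigenvalue for the parameter q⁻¹.
  rw [zpow_neg, inv_zpow, inv_inv, zpow_ofNat, ← e]
  simp only [amul, rInv_eq_rMat_inv hq0, Fin.rev_rev]
  rw [← sum_rev]
  refine Finset.sum_congr rfl fun i _ => ?_
  rw [← sum_rev]
  simp

lemma IsAnti.braid_rInv (hq0 : q ≠ 0) (hq : ∀ m : ℕ, 1 ≤ m → q ^ m ≠ 1)
    {Z : Fin N → Fin N → M} (h : IsAnti q Z) (a k : Fin N) :
    IsAnti q (fun i j => ∑ b, ∑ c, rInv N q a c i b • ∑ n, rInv N q b n j k • Z c n) := by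
  have e := ((h.reverse hq0 hq).braid (inv_ne_zero hq0) a.rev k.rev).reverse (inv_ne_zero hq0)
    (inv_pow_ne_one hq)
  rw [inv_inv] at e
  convert e using 3 with i j
  simp only [FRT.braid, rInv_eq_rMat_inv hq0]
  rw [← sum_rev]
  refine Finset.sum_congr rfl fun b _ => ?_
  rw [← sum_rev]
  refine Finset.sum_congr rfl fun c _ => ?_
  rw [← sum_rev]
  simp

/-- The braiding of an array past an index pair with lowered indices. -/
lemma IsAnti.braid_lower (hq0 : q ≠ 0) {Z : Fin N → Fin N → M} (h : IsAnti q Z) (n d : Fin N) :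
    IsAnti q (fun k l => ∑ a, ∑ b, ∑ c, (rInv N q a b n k * rInv N q c d b l) • Z a c) := by
  have e := (h.braid hq0 n.rev d.rev).smul (weight N q n * weight N q d.rev)
  convert e using 3 with k l
  have h1 : ∀ a b n k : Fin N, rInv N q a b n k
      = weight N q n * rMat N q n.rev a k b.rev * weight N q b.rev := by
    intro a b n k
    rw [metric_rMat hq0, mul_assoc, Fin.rev_rev, weight_mul_rev hq0, mul_one]
  have h2 : ∀ a b c : Fin N, rInv N q a b n k * rInv N q c d b l
      = (weight N q n * weight N q d.rev)
        * (rMat N q n.rev a k b.rev * rMat N q b.rev c l d.rev) := by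
    intro a b c
    rw [h1, h1 c]
    linear_combination (weight N q n * weight N q d.rev *
      (rMat N q n.rev a k b.rev * rMat N q b.rev c l d.rev)) * weight_mul_rev hq0 b
  simp only [h2, FRT.braid, Finset.smul_sum, smul_smul]
  rw [Finset.sum_comm, ← sum_rev]
  refine Finset.sum_congr rfl fun b _ => Finset.sum_congr rfl fun a _ =>
    Finset.sum_congr rfl fun c _ => ?_
  rw [Fin.rev_rev, mul_assoc]

end

/-! ### Scalar identities for λ, ζ, κ and the Euler eigenvalues. -/

section

variable {N : ℕ} {q : ℂ}

/-- The coefficient of `K` in the recursion for the derivatives of elements of degree `m`. -/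
def lam (N : ℕ) (q : ℂ) (m : ℤ) : ℂ := skein q / (1 + q ^ (2 * (N : ℤ) - 4 * m + 4))

/-- The eigenvalue of the Euler operator `∑ γ_k ∂^k` in degree `m`. -/
def euler (q : ℂ) (m : ℤ) : ℂ := (1 - q ^ (-4 * m)) / (1 - q ^ (-4 : ℤ))

/-- The factor relating the contraction in degree `m` to the derivatives. -/
def kappa (N : ℕ) (q c : ℂ) (m : ℤ) : ℂ :=
  c ^ 2 * q ^ (2 * (N : ℤ) - 3) * qPlus q / (1 + q ^ (2 * (N : ℤ) - 4 * m))

lemma euler_zero : euler q 0 = 0 := by simp [euler]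

lemma one_sub_zpow_neg_four (hq : ∀ m : ℕ, 1 ≤ m → q ^ m ≠ 1) : 1 - q ^ (-4 : ℤ) ≠ 0 :=
  fun h => zpow_ne_one hq (by norm_num : (-4 : ℤ) ≠ 0) (by linear_combination -h)

lemma euler_succ (hq0 : q ≠ 0) (hq : ∀ m : ℕ, 1 ≤ m → q ^ m ≠ 1) (m : ℤ) :
    euler q (m + 1) = 1 + (q ^ 2)⁻¹ ^ 2 * euler q m := by
  have h := one_sub_zpow_neg_four hq
  have h1 : q ^ (-4 * (m + 1)) = q ^ (-4 : ℤ) * q ^ (-4 * m) := by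
    rw [← zpow_add₀ hq0]; congr 1; ring
  have h2 : (q ^ 2)⁻¹ ^ 2 = q ^ (-4 : ℤ) := by
    rw [zpow_neg, inv_pow, ← pow_mul]; rfl
  rw [euler, euler, h1, h2]
  generalize q ^ (-4 * m) = b
  generalize q ^ (-4 : ℤ) = a at h
  field_simp; ring

lemma skein_eq : skein q = q ^ 2 - (q ^ 2)⁻¹ := by
  rw [skein, zpow_neg, zpow_ofNat]

lemma one_add_shift (hq0 : q ≠ 0) (n : ℤ) : q ^ (n + 4) = q ^ 4 * q ^ n := by
  rw [zpow_add₀ hq0, mul_comm]; rfl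

/-- This recursion cancels the terms γγ∂ and γ∂∂ left over when two Leibniz rules of consecutive
degrees are composed. It also matches the recursion of b⁻ in `deriv_cls`. -/
lemma lam_succ (hq0 : q ≠ 0) (hq : ∀ m : ℕ, 1 ≤ m → q ^ m ≠ 1) (m : ℤ) :
    -(q ^ 2) * lam N q m + (q ^ 2)⁻¹ * lam N q (m + 1) + lam N q m * lam N q (m + 1) = 0 := by
  have h1 := one_add_zpow_ne_zero hq0 hq (2 * (N : ℤ) - 4 * m + 4)
  have h2 := one_add_zpow_ne_zero hq0 hq (2 * (N : ℤ) - 4 * m)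
  rw [lam, lam, show 2 * (N : ℤ) - 4 * (m + 1) + 4 = 2 * N - 4 * m by ring, skein_eq]
  rw [one_add_shift hq0] at h1 ⊢
  generalize q ^ (2 * (N : ℤ) - 4 * m) = a at *
  field_simp; ring

lemma zeta_eq (hq0 : q ≠ 0) (hq : ∀ m : ℕ, 1 ≤ m → q ^ m ≠ 1) (m : ℤ) :
    1 - (q ^ 2)⁻¹ * (skein q - zeta N q) * euler q m
      = (1 + q ^ (2 * (N : ℤ) - 4 * m - 4)) / (1 + q ^ (2 * (N : ℤ) - 4)) := by
  have h1 := one_add_zpow_ne_zero hq0 hq (2 * (N : ℤ) - 4)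
  have h3 := one_sub_zpow_neg_four hq
  have h5 : q ^ (2 * (N : ℤ) - 4 * m - 4) = q ^ (-4 * m) * q ^ (2 * (N : ℤ) - 4) := by
    rw [← zpow_add₀ hq0]; congr 1; ring
  rw [euler, zeta, skein_eq, h5]
  generalize q ^ (2 * (N : ℤ) - 4) = a at *
  generalize q ^ (-4 * m) = b at *
  rw [zpow_neg, zpow_ofNat] at h3 ⊢
  have h4 : q ^ 4 - 1 ≠ 0 := by
    intro h
    apply h3
    rw [sub_eq_zero.1 h]; norm_num
  field_simp
  ring

/-- It balances the K-term of the quadratic relation against the trace evaluated by Euler's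
identity. -/
lemma zeta_eq_lam_mul (hq0 : q ≠ 0) (hq : ∀ m : ℕ, 1 ≤ m → q ^ m ≠ 1) (m : ℤ) :
    zeta N q = lam N q (m + 2) * (1 - (q ^ 2)⁻¹ * (skein q - zeta N q) * euler q m) := by
  have h1 := one_add_zpow_ne_zero hq0 hq (2 * (N : ℤ) - 4)
  have h2 := one_add_zpow_ne_zero hq0 hq (2 * (N : ℤ) - 4 * m - 4)
  rw [zeta_eq hq0 hq, zeta, lam,
    show 2 * (N : ℤ) - 4 * (m + 2) + 4 = 2 * (N : ℤ) - 4 * m - 4 by ring]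
  field_simp

/-- It makes the mixed terms γ∂ in a product of two Clifford generators combine into an image of R̂
- q² + ζK; `kappa_succ_mul` then leaves exactly κ₁ times the metric. -/
lemma kappa_eq (hq0 : q ≠ 0) (hq : ∀ m : ℕ, 1 ≤ m → q ^ m ≠ 1) (c : ℂ) (m : ℤ) :
    kappa N q c m = kappa N q c (m + 1) * ((q ^ 2)⁻¹ ^ 2 + (q ^ 2)⁻¹ * lam N q (m + 1)) := by
  have h1 := one_add_zpow_ne_zero hq0 hq (2 * (N : ℤ) - 4 * m)
  have h2 := one_add_zpow_ne_zero hq0 hq (2 * (N : ℤ) - 4 * (m + 1))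
  rw [lam, kappa, kappa, skein_eq, show 2 * (N : ℤ) - 4 * (m + 1) + 4 = 2 * N - 4 * m by ring]
  have h5 : q ^ (2 * (N : ℤ) - 4 * m) = q ^ 4 * q ^ (2 * (N : ℤ) - 4 * (m + 1)) := by
    rw [← one_add_shift hq0]; congr 1; ring
  rw [h5] at h1 ⊢
  generalize q ^ (2 * (N : ℤ) - 4 * (m + 1)) = a at *
  field_simp; ring

lemma kappa_succ_mul (hq0 : q ≠ 0) (hq : ∀ m : ℕ, 1 ≤ m → q ^ m ≠ 1) (c : ℂ) (m : ℤ) :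
    kappa N q c (m + 1) * (1 - (q ^ 2)⁻¹ * (skein q - zeta N q) * euler q m)
      = kappa N q c 1 := by
  have h1 := one_add_zpow_ne_zero hq0 hq (2 * (N : ℤ) - 4)
  have h2 := one_add_zpow_ne_zero hq0 hq (2 * (N : ℤ) - 4 * m - 4)
  rw [zeta_eq hq0 hq, kappa, kappa,
    show 2 * (N : ℤ) - 4 * (m + 1) = 2 * (N : ℤ) - 4 * m - 4 by ring, mul_one]
  field_simp

lemma kappa_one_mul_ptr_metric (hq0 : q ≠ 0) (hq : ∀ m : ℕ, 1 ≤ m → q ^ m ≠ 1) (c : ℂ) :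
    kappa N q c 1 * ptr q (metric N q) N = c ^ 2 * ((q ^ (2 * N) - 1) / (q ^ 2 - 1)) := by
  have h1 := one_add_zpow_ne_zero hq0 hq (2 * (N : ℤ) - 4)
  have h2 := skein_ne_zero hq0 hq
  have h3 : q ^ 2 - 1 ≠ 0 := sub_ne_zero.2 (hq 2 (by norm_num))
  have h4 : q ^ 4 - 1 ≠ 0 := sub_ne_zero.2 (hq 4 (by norm_num))
  have e := (skein_mul_ptr_metric (N := N) hq0 N le_rfl).2 (by omega)
  rw [← mul_right_inj' h2, kappa, mul_one, mul_left_comm, e]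
  rw [skein_eq, qPlus]
  have h5 : q ^ (4 * (N : ℤ) - 2 - 2 * N) = q ^ 2 * q ^ (2 * (N : ℤ) - 4) := by
    rw [← zpow_natCast, ← zpow_add₀ hq0]; congr 1; push_cast; ring
  have h6 : q ^ (2 - 2 * (N : ℤ)) = (q ^ 2)⁻¹ * (q ^ (2 * (N : ℤ) - 4))⁻¹ := by
    rw [← zpow_natCast, ← zpow_neg, ← zpow_neg, ← zpow_add₀ hq0]; congr 1; push_cast; ring
  have h7 : q ^ (2 * N) = q ^ 4 * q ^ (2 * (N : ℤ) - 4) := by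
    rw [← one_add_shift hq0, ← zpow_natCast]; congr 1; push_cast; ring
  have h8 : q ^ (2 * (N : ℤ) - 3) = q * q ^ (2 * (N : ℤ) - 4) := by
    rw [← zpow_one_add₀ hq0]; congr 1; ring
  have h9 : q ^ (2 * (N : ℤ) - 4) ≠ 0 := zpow_ne_zero _ hq0
  rw [h5, h6, h7, h8]
  generalize q ^ (2 * (N : ℤ) - 4) = a at *
  field_simp
  ring

end

/-! ### The twisted Leibniz rule respects the exterior relations. -/

section

variable {N : ℕ} {q : ℂ} {M : Type*} [AddCommGroup M] [Module ℂ M]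

/-- The image of an array under the Hecke-type operator `R̂ - q² + ζ K`. -/
def hecke (q : ℂ) (X : Fin N → Fin N → M) : Fin N → Fin N → M := fun k l =>
  amul X (rMat N q) k l - q ^ 2 • X k l + (zeta N q * metric N q k l) • ptr q X N

lemma amul_rInv_eq_hecke (X : Fin N → Fin N → M) (k l : Fin N) :
    amul X (rInv N q) k l = hecke q X k l + (q ^ 2)⁻¹ • X k l
      + ((skein q - zeta N q) * metric N q k l) • ptr q X N := by
  rw [amul_rInv, hecke, skein_eq]; module

/-- The effect of multiplication by `γ_l` on the lowered derivatives `Y` of an element `x`. -/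
def lower (q : ℂ) (γ : Fin N → M →ₗ[ℂ] M) (a : ℂ) (l : Fin N) (x : M) (Y : Fin N → M) :
    Fin N → M := fun k =>
  metric N q k l • x - (q ^ 2)⁻¹ • amul (fun i j => γ i (Y j)) (rInv N q) k l
    - ((q ^ 2)⁻¹ * a) • γ k (Y l)

lemma ptr_metric_smul (hq0 : q ≠ 0) (n : Fin N) (v : Fin N → M) :
    ptr q (fun k l => metric N q n k • v l) N = v n := by
  rw [ptr, Finset.sum_eq_single n.rev]
  · simp only [Fin.is_lt, if_true, Fin.rev_rev, metric_rev, smul_smul]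
    rw [mul_comm, weight_mul_rev hq0, one_smul]
  · intro b _ hb
    rw [metric_eq_zero, zero_smul, smul_zero, ite_self]
    rintro rfl; simp at hb
  · simp

lemma ptr_smul_metric (hq0 : q ≠ 0) (n : Fin N) (v : Fin N → M) :
    ptr q (fun k l => metric N q l n • v k) N = v n := by
  rw [ptr, Finset.sum_eq_single n]
  · simp only [Fin.is_lt, if_true, smul_smul, metric_eq]
    rw [weight_mul_rev hq0, one_smul]
  · intro b _ hb
    rw [metric_eq_zero, zero_smul, smul_zero, ite_self]
    intro h; exact hb (Fin.rev_injective h)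
  · simp

lemma sum_rInv_metric (hq0 : q ≠ 0) (v : Fin N → M) (n k l : Fin N) :
    ∑ a, ∑ b, (rInv N q a b n k * metric N q b l) • v a
      = amul (fun e a => metric N q n e • v a) (rMat N q) k l := by
  rw [amul, Finset.sum_comm, Finset.sum_eq_single l.rev]
  · symm
    rw [Finset.sum_eq_single n.rev]
    · refine Finset.sum_congr rfl fun a _ => ?_
      rw [smul_smul, metric_rev, metric_eq, if_pos rfl, ← metric_rMat hq0, mul_comm]
    · intro b _ hb
      refine Finset.sum_eq_zero fun a _ => ?_
      rw [metric_eq_zero, zero_smul, smul_zero]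
      rintro rfl; simp at hb
    · simp
  · intro b _ hb
    refine Finset.sum_eq_zero fun a _ => ?_
    rw [metric_eq_zero hb, mul_zero, zero_smul]
  · simp

lemma sum_metric_rInv (hq0 : q ≠ 0) (v : Fin N → M) (i j k : Fin N) :
    ∑ b, ∑ f, (metric N q i b * rInv N q b f j k) • v f
      = amul (fun n f => metric N q f k • v n) (rMat N q) i j := by
  rw [amul]
  rw [Finset.sum_eq_single i.rev]
  · refine Finset.sum_congr rfl fun n _ => ?_
    rw [Finset.sum_eq_single k.rev]
    · rw [smul_smul, metric_rev, metric_eq, if_pos rfl, ← metric_rInv hq0]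
    · intro b _ hb
      rw [metric_eq_zero hb, zero_smul, smul_zero]
    · simp
  · intro b _ hb
    refine Finset.sum_eq_zero fun a _ => ?_
    rw [metric_eq_zero, zero_mul, zero_smul]
    rintro rfl; simp at hb
  · simp

variable {γ : Fin N → M →ₗ[ℂ] M} {D : Fin N → M →ₗ[ℂ] M}

/-- Expanding gives terms with no γ∂, terms γγ∂ braided by two factors R̂⁻¹, and terms with
coefficient λ. Modulo exterior arrays the remainder is a multiple of an array built from the metric
and γ_n γ_k Y_l, and its coefficients vanish by `lam_succ` and `zeta_eq_lam_mul`. -/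
lemma isAnti_lower_lower (hq0 : q ≠ 0) (hq : ∀ m : ℕ, 1 ≤ m → q ^ m ≠ 1)
    (hγ : ∀ x, IsAnti q fun k l => γ k (γ l x)) (m : ℤ) {x : M} {Y : Fin N → M}
    (hY : ptr q (fun i j => γ i (Y j)) N = euler q m • x) (n : Fin N) :
    IsAnti q fun k l => lower q γ (lam N q (m + 2)) k (γ l x)
      (lower q γ (lam N q (m + 1)) l x Y) n := by
  have h1 := (isAnti_hecke hq0 hq fun k l => metric N q n k • γ l x).smul (-(q ^ 2)⁻¹)
  have h2 := (IsAnti.sum Finset.univ fun d _ =>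
    (hγ (Y d)).braid_lower hq0 n d).smul ((q ^ 2)⁻¹ ^ 2)
  have h3 := ((isAnti_hecke hq0 hq fun k l => γ k (Y l)).map (γ n)).smul
    ((q ^ 2)⁻¹ ^ 2 * lam N q (m + 2))
  have h := (h1.add h2).add h3
  convert h using 3 with k l
  have hP := sum_rInv_metric hq0 (fun a => γ a x) n k l
  have hW := (hγ (Y l)).amul_rInv hq0 n k
  have hA := congrArg (γ n) (amul_rInv_eq_hecke (q := q) (fun k l => γ k (Y l)) k l)
  -- The inner metric term becomes R̂ by crossing, the inner R̂⁻¹ term becomes the braided array,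
  -- and the λ-term is an exterior array fed into R̂⁻¹, evaluated by `hW`.
  have hT : amul (fun a b => γ a (lower q γ (lam N q (m + 1)) l x Y b)) (rInv N q) n k
      = amul (fun k l => metric N q n k • γ l x) (rMat N q) k l
        - (q ^ 2)⁻¹ • (∑ d, ∑ a, ∑ b, ∑ c, (rInv N q a b n k * rInv N q c d b l) • γ a (γ c (Y d)))
        - ((q ^ 2)⁻¹ * lam N q (m + 1)) •
          amul (fun a b => γ a (γ b (Y l))) (rInv N q) n k := by
    rw [← hP]
    simp only [amul, lower, map_sub, map_smul, map_sum, smul_sub, Finset.sum_sub_distrib,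
      Finset.smul_sum, smul_smul]
    refine congrArg₂ (· - ·) (congrArg₂ (· - ·) rfl ?_) ?_
    · symm
      rw [Finset.sum_comm]
      refine Finset.sum_congr rfl fun a _ => ?_
      rw [Finset.sum_comm]
      refine Finset.sum_congr rfl fun b _ => ?_
      rw [Finset.sum_comm]
      refine Finset.sum_congr rfl fun c _ => Finset.sum_congr rfl fun d _ => ?_
      rw [mul_left_comm]
    · refine Finset.sum_congr rfl fun a _ => Finset.sum_congr rfl fun b _ => ?_
      rw [mul_comm]
  simp only [hecke] at hA
  rw [lower, hT, hW, lower, map_sub, map_sub, map_smul, map_smul, map_smul, hA, map_add, map_add,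
    map_smul, map_smul, hY, map_smul, ptr_metric_smul hq0]
  have e1 := lam_succ (N := N) hq0 hq (m + 1)
  have e2 := zeta_eq_lam_mul (N := N) hq0 hq m
  rw [show m + 1 + 1 = m + 2 by ring] at e1
  have hq2 : q ^ 2 * (q ^ 2)⁻¹ = 1 := mul_inv_cancel₀ (pow_ne_zero 2 hq0)
  simp only [map_add, map_sub, map_smul]
  generalize (q ^ 2)⁻¹ = s at *
  generalize q ^ 2 = r at *
  clear h1 h2 h3 h hP hW hA hT hY hγ hq hq0
  match_scalars
  all_goals grind

end

/-! ### Euler's identity, products of two derivatives, and the Clifford relations. -/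

section

variable {N : ℕ} {q : ℂ} {M : Type*} [AddCommGroup M] [Module ℂ M]
variable {γ : Fin N → M →ₗ[ℂ] M} {D : Fin N → M →ₗ[ℂ] M}

lemma ptr_top_eq (Z : Fin N → Fin N → M) : ptr q Z N = ∑ i, weight N q i • Z i i.rev := by
  simp [ptr]

/-- Crossing moves the matrix from the pair (γ_a, ∂_b) onto the adjacent pair γ_j γ_a, where the
exterior relation makes it a scalar. -/
lemma ptr_amul_rInv (hq0 : q ≠ 0) (hγ : ∀ x, IsAnti q fun k l => γ k (γ l x))
    (Y : Fin N → M) (l : Fin N) :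
    ptr q (fun j k => γ j (amul (fun a b => γ a (Y b)) (rInv N q) k l)) N
      = -(q ^ 2)⁻¹ • γ l (ptr q (fun i j => γ i (Y j)) N) := by
  have h : ∀ b, weight N q b.rev • amul (fun j a => γ j (γ a (Y b))) (rMat N q) l b.rev
      = -(q ^ 2)⁻¹ • γ l (weight N q b.rev • γ b.rev (Y b)) := by
    intro b
    rw [(hγ (Y b)).amul_rMat hq0, map_smul, smul_comm, zpow_neg, zpow_ofNat]
  have h2 : ptr q (fun i j => γ i (Y j)) N = ∑ b : Fin N, weight N q b.rev • γ b.rev (Y b) := by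
    rw [ptr_top_eq, ← sum_rev]; simp
  rw [h2, map_sum, Finset.smul_sum, ← Finset.sum_congr rfl fun b _ => h b]
  simp only [ptr_top_eq, amul, map_sum, map_smul, Finset.smul_sum, smul_smul]
  refine ((Finset.sum_congr rfl fun i _ => Finset.sum_comm).trans Finset.sum_comm).trans ?_
  refine Finset.sum_congr rfl fun b _ => Finset.sum_congr rfl fun i _ =>
    Finset.sum_congr rfl fun a _ => ?_
  rw [← rMat_mul_weight hq0, mul_comm]

/-- The λ-term has zero trace because it is a trace of γ_i γ_j. Hence Euler's identity propagates
for every value of the coefficient. -/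
lemma ptr_lower (hq0 : q ≠ 0) (hq : ∀ m : ℕ, 1 ≤ m → q ^ m ≠ 1)
    (hγ : ∀ x, IsAnti q fun k l => γ k (γ l x)) (a : ℂ) (m : ℤ) {x : M} {Y : Fin N → M}
    (hY : ptr q (fun i j => γ i (Y j)) N = euler q m • x) (l : Fin N) :
    ptr q (fun i j => γ i (lower q γ a l x Y j)) N = euler q (m + 1) • γ l x := by
  have h1 : (fun i j => γ i (lower q γ a l x Y j)) = fun i j => (metric N q j l • γ i x
      + (-(q ^ 2)⁻¹) • γ i (amul (fun a b => γ a (Y b)) (rInv N q) j l))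
      + (-((q ^ 2)⁻¹ * a)) • γ i (γ j (Y l)) := by
    funext i j
    rw [lower, map_sub, map_sub, map_smul, map_smul, map_smul]; module
  rw [h1, ptr_add, ptr_add, ptr_smul, ptr_smul, (hγ (Y l)).ptr_top, ptr_amul_rInv hq0 hγ, hY,
    ptr_smul_metric hq0, euler_succ hq0 hq, map_smul]
  module

/-- Induction step in the degree, with the same decomposition as in `isAnti_lower_lower`; the
braided piece is now γ applied to the array ∂∂x, which is exterior by `h4`. -/
lemma isAnti_lowered_lowered (hq0 : q ≠ 0) (hq : ∀ m : ℕ, 1 ≤ m → q ^ m ≠ 1) (m : ℤ) {x : M}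
    (h1 : ∀ k j, D j (γ k x) = lower q γ (lam N q (m + 1)) k x (fun i => D i x) j)
    (h2 : ∀ f b i, D i (γ b (D f x)) = lower q γ (lam N q m) b (D f x) (fun j => D j (D f x)) i)
    (h3 : ∀ f, ptr q (fun i j => γ i (D j (D f x))) N = euler q (m - 1) • D f x)
    (h4 : IsAnti q fun i j => D i (D j x)) (k : Fin N) :
    IsAnti q fun i j => D i (D j (γ k x)) := by
  have a1 := (isAnti_hecke hq0 hq fun i j => metric N q j k • D i x).smul (-(q ^ 2)⁻¹)
  have a2 := (IsAnti.sum Finset.univ fun a _ =>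
    ((h4.map (γ a)).braid_rInv hq0 hq a k)).smul ((q ^ 2)⁻¹ ^ 2)
  have a3 := (isAnti_hecke hq0 hq fun i j => γ i (D j (D k x))).smul
    ((q ^ 2)⁻¹ ^ 2 * lam N q (m + 1))
  have h := (a1.add a2).add a3
  convert h using 3 with i j
  have hP := sum_metric_rInv hq0 (fun f => D f x) i j k
  have hW := (h4.map (γ i)).amul_rInv hq0 j k
  have hA := amul_rInv_eq_hecke (q := q) (fun i j => γ i (D j (D k x))) i j
  have hT : D i (amul (fun b f => γ b (D f x)) (rInv N q) j k)
      = amul (fun i j => metric N q j k • D i x) (rMat N q) i j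
        - (q ^ 2)⁻¹ • (∑ a, ∑ b, ∑ c, rInv N q a c i b • ∑ n, rInv N q b n j k • γ a (D c (D n x)))
        - ((q ^ 2)⁻¹ * lam N q m) •
          amul (fun a b => γ i (D a (D b x))) (rInv N q) j k := by
    rw [← hP]
    simp only [amul, h2, lower, map_sum, map_smul, smul_sub, Finset.sum_sub_distrib,
      Finset.smul_sum, smul_smul]
    refine congrArg₂ (· - ·) (congrArg₂ (· - ·) ?_ ?_) ?_
    · simp only [mul_comm]
    · symm
      rw [Finset.sum_comm]
      refine Finset.sum_congr rfl fun b _ => ?_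
      refine ((Finset.sum_congr rfl fun a _ => Finset.sum_comm).trans Finset.sum_comm).trans ?_
      refine Finset.sum_congr rfl fun f _ => Finset.sum_congr rfl fun a _ =>
        Finset.sum_congr rfl fun c _ => ?_
      congr 1; ring
    · refine Finset.sum_congr rfl fun a _ => Finset.sum_congr rfl fun b _ => ?_
      rw [mul_comm]
  simp only [hecke] at hA
  rw [h1, lower, map_sub, map_sub, map_smul, map_smul, map_smul, hT, hW, h2, lower, hA,
    ptr_smul_metric hq0, h3]
  have e1 := lam_succ (N := N) hq0 hq m
  have e2 := zeta_eq_lam_mul (N := N) hq0 hq (m - 1)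
  rw [show m - 1 + 2 = m + 1 by ring] at e2
  have hq2 : q ^ 2 * (q ^ 2)⁻¹ = 1 := mul_inv_cancel₀ (pow_ne_zero 2 hq0)
  generalize (q ^ 2)⁻¹ = s at *
  generalize q ^ 2 = r at *
  clear a1 a2 a3 h hP hW hA hT h1 h2 h3 h4 hq hq0
  match_scalars
  all_goals grind

/-- The Clifford relations in the array form. -/
lemma isAnti_clifford (hq0 : q ≠ 0) (hq : ∀ m : ℕ, 1 ≤ m → q ^ m ≠ 1) (c : ℂ) (m : ℤ) {x : M}
    (hγ : ∀ x, IsAnti q fun k l => γ k (γ l x))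
    (h1 : ∀ k j, D j (γ k x) = lower q γ (lam N q (m + 1)) k x (fun i => D i x) j)
    (h3 : ptr q (fun i j => γ i (D j x)) N = euler q m • x)
    (h4 : IsAnti q fun i j => D i (D j x)) (a : ℂ) :
    IsAnti q fun i j => (γ i (γ j x) + kappa N q c (m + 1) • D i (γ j x))
      + kappa N q c m • (γ i (D j x) + a • D i (D j x))
      - (kappa N q c 1 * metric N q i j) • x := by
  -- Exterior relations for ∂∂x are homogeneous, so the coefficient `a` of the second contraction is
  -- immaterial; only γγ, the mixed terms and the metric have to balance.
  have a1 := ((hγ x).add ((isAnti_hecke hq0 hq fun i j => γ i (D j x)).smul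
    (-(q ^ 2)⁻¹ * kappa N q c (m + 1)))).add (h4.smul (kappa N q c m * a))
  convert a1 using 3 with i j
  have hA := amul_rInv_eq_hecke (q := q) (fun i j => γ i (D j x)) i j
  simp only [hecke] at hA
  rw [h1, lower, hA, h3]
  have e1 := kappa_eq (N := N) hq0 hq c m
  have e2 := kappa_succ_mul (N := N) hq0 hq c m
  generalize (q ^ 2)⁻¹ = s at *
  clear a1 hA h1 h3 h4 hq hq0 hγ
  match_scalars
  all_goals grind

end

/-! ### The presentation of the Clifford algebra in terms of exterior arrays. -/

section

variable {N : ℕ} {q : ℂ} {M : Type*} [AddCommGroup M] [Module ℂ M]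

/-- R̂ is symmetric, so the metric is an eigenvector on one side because the full trace is one on
the other; the latter is the case l = N of `ptr_amul_rMat`, applied to an elementary matrix. -/
lemma amul_metric_rMat (hq0 : q ≠ 0) (k l : Fin N) :
    amul (metric N q) (rMat N q) k l = q ^ (2 - 2 * (N : ℤ)) * metric N q k l := by
  rcases Nat.eq_zero_or_pos N with rfl | hN
  · exact k.elim0
  have h := (ptr_amul_rMat hq0 (fun i j => if i = k ∧ j = l then (1 : ℂ) else 0) N le_rfl).2
    (by omega)
  have h1 : ∀ Z : Fin N → Fin N → ℂ, ∑ i, ∑ j, (if i = k ∧ j = l then (1 : ℂ) else 0) * Z i j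
      = Z k l := by
    intro Z
    rw [Finset.sum_eq_single k, Finset.sum_eq_single l]
    · simp
    · intro j _ hj; simp [hj]
    · simp
    · intro i _ hi; simp [hi]
    · simp
  rw [Nat.sub_self, ptr_zero, mul_zero, sub_zero, ptr_top, ptr_top] at h
  simp only [amul, smul_eq_mul] at h ⊢
  have h2 : ∀ a b : Fin N, ∑ i, ∑ j, rMat N q i j a b * (if i = k ∧ j = l then (1 : ℂ) else 0)
      = rMat N q k l a b := by
    intro a b
    rw [← h1 fun i j => rMat N q i j a b]
    simp only [mul_comm]
  simp only [h2] at h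
  rw [← h1 (metric N q)]
  simp only [mul_comm _ (metric N q _ _), rMat_symm hq0 _ _ k l] at h ⊢
  exact h

lemma sum_pPlus (Z : Fin N → Fin N → M) (i j : Fin N) :
    ∑ k, ∑ l, pPlus N q k l i j • Z k l = (1 / (q ^ 2 + q ^ (-2 : ℤ))) •
      (q ^ (-2 : ℤ) • Z i j + amul Z (rMat N q) i j
        - (qPlus q * qMinus q / (q ^ (2 * N) - 1) * metric N q i j) • ptr q Z N) := by
  have h1 : ∑ k, ∑ l, (delta k i * delta l j : ℂ) • Z k l = Z i j := by
    rw [Finset.sum_eq_single i, Finset.sum_eq_single j]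
    · simp [delta]
    · intro j _ hj; simp [delta, hj]
    · simp
    · intro i _ hi; simp [delta, hi]
    · simp
  have h2 := amul_kMat (q := q) Z i j
  rw [mul_smul, ← h2]
  conv_rhs => rw [← h1]
  simp only [amul, Finset.smul_sum, smul_smul, ← Finset.sum_add_distrib, ← Finset.sum_sub_distrib,
    ← sub_smul, ← add_smul]
  refine Finset.sum_congr rfl fun k _ => Finset.sum_congr rfl fun l _ => ?_
  rw [pPlus, mul_sub, mul_add]

lemma IsAnti.sum_pPlus (hq0 : q ≠ 0) {Z : Fin N → Fin N → M} (h : IsAnti q Z) (i j : Fin N) :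
    ∑ k, ∑ l, pPlus N q k l i j • Z k l = 0 := by
  rw [FRT.sum_pPlus, h.amul_rMat hq0, h.ptr_top]
  module

lemma qPlus_mul_qMinus (hq0 : q ≠ 0) : qPlus q * qMinus q = skein q := by
  rw [qPlus, qMinus, skein_eq]; field_simp; ring

/-- The coefficient of K in P₊ is the one for which P₊ annihilates the metric. A metric term can
therefore be added to an array without affecting the P₊-relations. -/
lemma sum_pPlus_metric (hq0 : q ≠ 0) (hq : ∀ m : ℕ, 1 ≤ m → q ^ m ≠ 1) (i j : Fin N) :
    ∑ k, ∑ l, pPlus N q k l i j • metric N q k l = 0 := by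
  have hN : 1 ≤ N := i.pos
  rw [FRT.sum_pPlus, amul_metric_rMat hq0, qPlus_mul_qMinus hq0]
  have e := (skein_mul_ptr_metric (N := N) hq0 N le_rfl).2 (by omega)
  have h1 : q ^ (2 * N) - 1 ≠ 0 := sub_ne_zero.2 (hq _ (by omega))
  have e2 : skein q / (q ^ (2 * N) - 1) * metric N q i j * ptr q (metric N q) N
      = (q ^ (-2 : ℤ) + q ^ (2 - 2 * (N : ℤ))) * metric N q i j := by
    rw [show skein q / (q ^ (2 * N) - 1) * metric N q i j * ptr q (metric N q) N
      = (skein q * ptr q (metric N q) N) / (q ^ (2 * N) - 1) * metric N q i j by ring, e]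
    congr 1
    rw [div_eq_iff h1, skein]
    have h5 : q ^ (4 * (N : ℤ) - 2 - 2 * N) = q ^ (-2 : ℤ) * q ^ (2 * N) := by
      rw [← zpow_natCast, ← zpow_add₀ hq0]; congr 1; push_cast; ring
    have h6 : q ^ (2 - 2 * (N : ℤ)) * q ^ (2 * N) = q ^ 2 := by
      rw [← zpow_natCast, ← zpow_natCast, ← zpow_add₀ hq0]; congr 1; push_cast; ring
    rw [h5]
    linear_combination -h6
  rw [smul_eq_mul, smul_eq_mul, smul_eq_mul, e2]
  ring

lemma isAnti_of_sum_pPlus (hq0 : q ≠ 0) (hq : ∀ m : ℕ, 1 ≤ m → q ^ m ≠ 1)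
    {Z : Fin N → Fin N → M} (h : ∀ i j, ∑ k, ∑ l, pPlus N q k l i j • Z k l = 0)
    (h' : ptr q Z N = 0) : IsAnti q Z := by
  refine isAnti_of_amul hq0 hq fun i j => ?_
  have h1 := h i j
  have h4 : q ^ 2 + q ^ (-2 : ℤ) ≠ 0 := by
    have : q ^ 2 + q ^ (-2 : ℤ) = q ^ (-2 : ℤ) * (1 + q ^ (4 : ℤ)) := by
      rw [zpow_neg, zpow_ofNat, zpow_ofNat]; field_simp; ring
    rw [this]
    exact mul_ne_zero (zpow_ne_zero _ hq0) (one_add_zpow_ne_zero hq0 hq 4)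
  rw [sum_pPlus, h', smul_zero, sub_zero, smul_eq_zero] at h1
  have h2 := h1.resolve_left (one_div_ne_zero h4)
  rw [neg_smul, eq_neg_iff_add_eq_zero, add_comm, h2]

/-- An algebra homomorphism out of the Clifford algebra. -/
def cliffordLift (hq0 : q ≠ 0) (hq : ∀ m : ℕ, 1 ≤ m → q ^ m ≠ 1) (c : ℂ) {A : Type*} [Ring A]
    [Algebra ℂ A] (g : Fin N → A)
    (h : IsAnti q fun i j => g i * g j - (kappa N q c 1 * metric N q i j) • (1 : A)) :
    Clifford N q c →ₐ[ℂ] A :=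
  RingQuot.liftAlgHom ℂ ⟨FreeAlgebra.lift ℂ g, by
    rintro _ _ (⟨i, j⟩ | _)
    · have h1 := h.sum_pPlus hq0 i j
      have h2 := sum_pPlus_metric hq0 hq i j
      simp only [smul_sub, Finset.sum_sub_distrib, smul_smul] at h1
      rw [sub_eq_zero] at h1
      simp only [map_sum, map_smul, map_mul, FreeAlgebra.lift_ι_apply, map_zero]
      rw [h1]
      simp only [← Finset.sum_smul]
      simp only [smul_eq_mul] at h2
      simp only [mul_left_comm _ (kappa N q c 1), ← Finset.mul_sum, h2, mul_zero, zero_smul]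
    · have h1 := h.ptr_top
      simp only [FRT.ptr_top, smul_sub, Finset.sum_sub_distrib, smul_smul] at h1
      rw [sub_eq_zero] at h1
      simp only [map_sum, map_smul, map_mul, FreeAlgebra.lift_ι_apply, AlgHom.commutes]
      rw [h1, ← map_mul, ← kappa_one_mul_ptr_metric hq0 hq, FRT.ptr_top,
        Algebra.algebraMap_eq_smul_one]
      simp only [← Finset.sum_smul, mul_left_comm _ (kappa N q c 1), ← Finset.mul_sum, smul_eq_mul]⟩

lemma cliffordLift_gen (hq0 : q ≠ 0) (hq : ∀ m : ℕ, 1 ≤ m → q ^ m ≠ 1) (c : ℂ) {A : Type*} [Ring A]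
    [Algebra ℂ A] (g : Fin N → A)
    (h : IsAnti q fun i j => g i * g j - (kappa N q c 1 * metric N q i j) • (1 : A)) (i : Fin N) :
    cliffordLift hq0 hq c g h (gen N q c i) = g i := by
  rw [cliffordLift, gen, RingQuot.liftAlgHom_mkAlgHom_apply, FreeAlgebra.lift_ι_apply]

/-- Subtracting κ₁ C makes the full trace zero, by `kappa_one_mul_ptr_metric`, and P₊ does not see
the difference. -/
lemma isAnti_gen (hq0 : q ≠ 0) (hq : ∀ m : ℕ, 1 ≤ m → q ^ m ≠ 1) (c : ℂ) :
    IsAnti q fun i j => gen N q c i * gen N q c j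
      - (kappa N q c 1 * metric N q i j) • (1 : Clifford N q c) := by
  refine isAnti_of_sum_pPlus hq0 hq (fun i j => ?_) ?_
  · have h1 := RingQuot.mkAlgHom_rel ℂ (CliffordRel.plus (N := N) (q := q) (c := c) i j)
    have h2 := sum_pPlus_metric hq0 hq i j
    simp only [map_sum, map_smul, map_mul, map_zero] at h1
    simp only [smul_sub, Finset.sum_sub_distrib, smul_smul]
    simp only [gen]
    rw [h1]
    simp only [← Finset.sum_smul]
    simp only [smul_eq_mul] at h2
    simp only [mul_left_comm _ (kappa N q c 1), ← Finset.mul_sum, h2, mul_zero, zero_smul, sub_zero]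
  · have h1 := RingQuot.mkAlgHom_rel ℂ (CliffordRel.metric (N := N) (q := q) (c := c))
    simp only [map_sum, map_smul, map_mul, AlgHom.commutes] at h1
    simp only [ptr_top, smul_sub, Finset.sum_sub_distrib, smul_smul]
    simp only [gen]
    rw [h1, ← map_mul, ← kappa_one_mul_ptr_metric hq0 hq, FRT.ptr_top,
      Algebra.algebraMap_eq_smul_one]
    simp only [← Finset.sum_smul, mul_left_comm _ (kappa N q c 1), ← Finset.mul_sum, smul_eq_mul,
      sub_self]

lemma kappa_zero_left (m : ℤ) : kappa N q 0 m = 0 := by simp [kappa]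

/-- A copy of the exterior algebra, whose ring structure is opaque to instance search. -/
def Ext (N : ℕ) (q : ℂ) : Type := Exterior N q

instance : Ring (Ext N q) := inferInstanceAs (Ring (Exterior N q))

instance : Algebra ℂ (Ext N q) := inferInstanceAs (Algebra ℂ (Exterior N q))

/-- The identification of the exterior algebra with its copy. -/
def toExt (N : ℕ) (q : ℂ) : Exterior N q ≃ₐ[ℂ] Ext N q :=
  (AlgEquiv.refl : Exterior N q ≃ₐ[ℂ] Exterior N q)

/-- Left multiplication by a generator of the exterior algebra. -/
def wedge (N : ℕ) (q : ℂ) (k : Fin N) : Ext N q →ₗ[ℂ] Ext N q :=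
  LinearMap.mulLeft ℂ (toExt N q (gen N q 0 k))

lemma wedge_apply (k : Fin N) (x : Ext N q) : wedge N q k x = toExt N q (gen N q 0 k) * x := rfl

lemma isAnti_toExt_gen (hq0 : q ≠ 0) (hq : ∀ m : ℕ, 1 ≤ m → q ^ m ≠ 1) :
    IsAnti q fun k l : Fin N => toExt N q (gen N q 0 k) * toExt N q (gen N q 0 l) := by
  have h := (isAnti_gen (N := N) hq0 hq 0).map (toExt N q).toLinearMap
  simp only [kappa_zero_left, zero_mul, zero_smul, sub_zero, AlgEquiv.toLinearMap_apply,
    map_mul] at h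
  exact h

lemma isAnti_wedge (hq0 : q ≠ 0) (hq : ∀ m : ℕ, 1 ≤ m → q ^ m ≠ 1) (x : Ext N q) :
    IsAnti q fun k l => wedge N q k (wedge N q l x) := by
  have h := (isAnti_toExt_gen (N := N) hq0 hq).map (LinearMap.mulRight ℂ x)
  simp only [LinearMap.mulRight_apply, mul_assoc] at h
  exact h

end

/-! ### Jets: simultaneous construction of the degree and the derivatives. -/

section

variable {N : ℕ} {q : ℂ} {M : Type*} [AddCommGroup M] [Module ℂ M]
variable {γ : Fin N → M →ₗ[ℂ] M}

lemma amul_add (Z W : Fin N → Fin N → M) (A : Mat4 N) (k l : Fin N) :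
    amul (fun i j => Z i j + W i j) A k l = amul Z A k l + amul W A k l := by
  simp only [amul, smul_add, Finset.sum_add_distrib]

lemma amul_smul (a : ℂ) (Z : Fin N → Fin N → M) (A : Mat4 N) (k l : Fin N) :
    amul (fun i j => a • Z i j) A k l = a • amul Z A k l := by
  simp only [amul, Finset.smul_sum, smul_comm a]

/-- The action of `γ_l` on pairs consisting of an element and its lowered derivatives. -/
def stepMap (q : ℂ) (γ : Fin N → M →ₗ[ℂ] M) (a : ℂ) (l : Fin N) :
    M × (Fin N → M) →ₗ[ℂ] M × (Fin N → M) where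
  toFun p := (γ l p.1, lower q γ a l p.1 p.2)
  map_add' p p' := by
    ext k
    · simp
    · simp only [lower, Prod.fst_add, Prod.snd_add, Pi.add_apply, map_add, amul_add]
      module
  map_smul' b p := by
    ext k
    · simp
    · simp only [lower, Prod.smul_fst, Prod.smul_snd, Pi.smul_apply, map_smul, amul_smul,
        RingHom.id_apply]
      module

/-- Sequences of pairs, the `m`-th of which stands for an element of degree `m` together with its
lowered derivatives. -/
abbrev Jet (N : ℕ) (M : Type*) [AddCommGroup M] : Type _ := ℕ →₀ M × (Fin N → M)

/-- The action of `γ_l` on jets. -/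
def jetStep (q : ℂ) (γ : Fin N → M →ₗ[ℂ] M) (l : Fin N) : Jet N M →ₗ[ℂ] Jet N M :=
  Finsupp.lsum ℂ fun m => (Finsupp.lsingle (m + 1)).comp
    (stepMap q γ (lam N q ((m : ℤ) + 1)) l)

lemma jetStep_single (l : Fin N) (m : ℕ) (p : M × (Fin N → M)) :
    jetStep q γ l (Finsupp.single m p) = Finsupp.single (m + 1)
      (stepMap q γ (lam N q ((m : ℤ) + 1)) l p) := by
  simp [jetStep]

lemma jetStep_zero (l : Fin N) (u : Jet N M) : jetStep q γ l u 0 = 0 := by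
  induction u using Finsupp.induction_linear with
  | zero => simp
  | add u v hu hv => simp [hu, hv]
  | single m p => rw [jetStep_single, Finsupp.single_eq_of_ne (by omega)]

lemma jetStep_succ (l : Fin N) (u : Jet N M) (m : ℕ) : jetStep q γ l u (m + 1)
    = stepMap q γ (lam N q ((m : ℤ) + 1)) l (u m) := by
  induction u using Finsupp.induction_linear with
  | zero => simp
  | add u v hu hv => simp [hu, hv]
  | single n p =>
    rw [jetStep_single]
    by_cases h : n = m
    · subst h; simp
    · rw [Finsupp.single_eq_of_ne (by omega), Finsupp.single_eq_of_ne (by omega), map_zero]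

/-- The jets satisfying Euler's identity in each degree. -/
def eulerJets (q : ℂ) (γ : Fin N → M →ₗ[ℂ] M) : Submodule ℂ (Jet N M) where
  carrier := {u | ∀ m : ℕ, ptr q (fun i j => γ i ((u m).2 j)) N = euler q m • (u m).1}
  zero_mem' m := by simp [ptr]
  add_mem' {u v} hu hv m := by
    have h1 := hu m
    have h2 := hv m
    simp only [Finsupp.add_apply, Prod.fst_add, Prod.snd_add, Pi.add_apply, map_add, ptr_add,
      h1, h2, smul_add]
  smul_mem' a u hu m := by
    have h1 := hu m
    simp only [Finsupp.smul_apply, Prod.smul_fst, Prod.smul_snd, Pi.smul_apply, map_smul,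
      ptr_smul, h1, smul_comm a]

/-- The exterior relations for jet steps hold only where Euler's identity does, so the steps must be
restricted to a stable subspace. -/
lemma jetStep_mem (hq0 : q ≠ 0) (hq : ∀ m : ℕ, 1 ≤ m → q ^ m ≠ 1)
    (hγ : ∀ x, IsAnti q fun k l => γ k (γ l x)) (l : Fin N) (u : Jet N M)
    (hu : u ∈ eulerJets q γ) : jetStep q γ l u ∈ eulerJets q γ := by
  rintro (_ | m)
  · simp [jetStep_zero, ptr]
  · rw [jetStep_succ]
    have := ptr_lower hq0 hq hγ (lam N q ((m : ℤ) + 1)) m (hu m) l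
    rw [Nat.cast_succ]
    exact this

lemma isAnti_of_injective {M' : Type*} [AddCommGroup M'] [Module ℂ M'] (f : M →ₗ[ℂ] M')
    (hf : Function.Injective f) {Z : Fin N → Fin N → M}
    (h : IsAnti q fun i j => f (Z i j)) : IsAnti q Z where
  diag k hk := hf (by rw [h.diag k hk, map_zero])
  comm k l hkl hl := hf (by rw [h.comm k l hkl hl, map_neg, map_smul])
  refl l hl := hf (by rw [map_ptr, h.refl l hl, map_smul, map_ptr])

lemma isAnti_pi {ι : Type*} {E : ι → Type*} [∀ i, AddCommGroup (E i)] [∀ i, Module ℂ (E i)]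
    {Z : Fin N → Fin N → ∀ i, E i} (h : ∀ a, IsAnti q fun i j => Z i j a) : IsAnti q Z where
  diag k hk := funext fun a => (h a).diag k hk
  comm k l hkl hl := funext fun a => (h a).comm k l hkl hl
  refl l hl := funext fun a => by
    have := (h a).refl l hl
    have e : ∀ m, ptr q Z m a = ptr q (fun i j => Z i j a) m := fun m =>
      map_ptr (LinearMap.proj a : (∀ i, E i) →ₗ[ℂ] E a) Z m
    rw [e, this, Pi.smul_apply, e]

lemma isAnti_prod {M' : Type*} [AddCommGroup M'] [Module ℂ M'] {Z : Fin N → Fin N → M × M'}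
    (h1 : IsAnti q fun i j => (Z i j).1) (h2 : IsAnti q fun i j => (Z i j).2) : IsAnti q Z where
  diag k hk := Prod.ext (h1.diag k hk) (h2.diag k hk)
  comm k l hkl hl := Prod.ext (h1.comm k l hkl hl) (h2.comm k l hkl hl)
  refl l hl := by
    have e1 : ∀ m, (ptr q Z m).1 = ptr q (fun i j => (Z i j).1) m := fun m =>
      map_ptr (LinearMap.fst ℂ M M') Z m
    have e2 : ∀ m, (ptr q Z m).2 = ptr q (fun i j => (Z i j).2) m := fun m =>
      map_ptr (LinearMap.snd ℂ M M') Z m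
    refine Prod.ext ?_ ?_
    · rw [e1, h1.refl l hl, Prod.smul_fst, e1]
    · rw [e2, h2.refl l hl, Prod.smul_snd, e2]

section stable

variable {W : Type*} [AddCommGroup W] [Module ℂ W] {S : Submodule ℂ W} {g : Fin N → W →ₗ[ℂ] W}

lemma isAnti_restrict (hS : ∀ k, ∀ u ∈ S, g k u ∈ S)
    (hg : ∀ u ∈ S, IsAnti q fun k l => g k (g l u)) :
    IsAnti q fun k l => (g k).restrict (hS k) * (g l).restrict (hS l)
      - (kappa N q 0 1 * metric N q k l) • (1 : Module.End ℂ S) := by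
  simp only [kappa_zero_left, zero_mul, zero_smul, sub_zero]
  refine isAnti_of_injective (LinearMap.ltoFun ℂ S S ℂ)
    DFunLike.coe_injective (isAnti_pi fun u => ?_)
  exact isAnti_of_injective S.subtype (Submodule.subtype_injective _) (hg u u.2)

/-- The action of the exterior algebra on a vector, when the generators act on a stable subspace
containing it. -/
def orbitMap (hq0 : q ≠ 0) (hq : ∀ m : ℕ, 1 ≤ m → q ^ m ≠ 1) (hS : ∀ k, ∀ u ∈ S, g k u ∈ S)
    (hg : ∀ u ∈ S, IsAnti q fun k l => g k (g l u)) (w : S) : Ext N q →ₗ[ℂ] W :=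
  S.subtype ∘ₗ (LinearMap.applyₗ w) ∘ₗ
    (cliffordLift hq0 hq 0 (fun k => (g k).restrict (hS k)) (isAnti_restrict hS hg)).toLinearMap ∘ₗ
    (toExt N q).symm.toLinearMap

variable (hq0 : q ≠ 0) (hq : ∀ m : ℕ, 1 ≤ m → q ^ m ≠ 1) (hS : ∀ k, ∀ u ∈ S, g k u ∈ S)
  (hg : ∀ u ∈ S, IsAnti q fun k l => g k (g l u)) (w : S)

lemma orbitMap_mem (x : Ext N q) : orbitMap hq0 hq hS hg w x ∈ S :=
  Subtype.property _

lemma orbitMap_one : orbitMap hq0 hq hS hg w (1 : Ext N q) = w := by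
  simp [orbitMap]

lemma orbitMap_gen_mul (k : Fin N) (x : Ext N q) :
    orbitMap hq0 hq hS hg w (toExt N q (gen N q 0 k) * x) = g k (orbitMap hq0 hq hS hg w x) := by
  simp [orbitMap, cliffordLift_gen]

end stable

/-- Two steps raise the position by two, so positions 0 and 1 vanish; from position 2 on the claim
is the exterior relation in the first component and `isAnti_lower_lower` in the second. -/
lemma isAnti_jetStep (hq0 : q ≠ 0) (hq : ∀ m : ℕ, 1 ≤ m → q ^ m ≠ 1)
    (hγ : ∀ x, IsAnti q fun k l => γ k (γ l x)) (u : Jet N M)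
    (hu : u ∈ eulerJets q γ) : IsAnti q fun k l => jetStep q γ k (jetStep q γ l u) := by
  refine isAnti_of_injective (Finsupp.lcoeFun : Jet N M →ₗ[ℂ] ℕ → M × (Fin N → M))
    DFunLike.coe_injective (isAnti_pi ?_)
  simp only [Finsupp.lcoeFun_apply]
  rintro (_ | _ | m)
  · simpa only [jetStep_zero] using isAnti_zero
  · simpa only [jetStep_zero, jetStep_succ, map_zero] using isAnti_zero
  · simp only [jetStep_succ]
    refine isAnti_prod (hγ _) (isAnti_pi fun n => ?_)
    have := isAnti_lower_lower hq0 hq hγ m (hu m) n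
    rwa [show (m : ℤ) + 2 = ((m + 1 : ℕ) : ℤ) + 1 by push_cast; ring] at this

/-- The jet of an element of the exterior algebra. -/
def jet (hq0 : q ≠ 0) (hq : ∀ m : ℕ, 1 ≤ m → q ^ m ≠ 1) :
    Ext N q →ₗ[ℂ] Jet N (Ext N q) :=
  orbitMap hq0 hq (jetStep_mem hq0 hq (isAnti_wedge hq0 hq))
    (isAnti_jetStep hq0 hq (isAnti_wedge hq0 hq))
    ⟨Finsupp.single 0 (1, 0), by rintro (_ | m) <;> simp [euler_zero, ptr]⟩

lemma jet_mem (hq0 : q ≠ 0) (hq : ∀ m : ℕ, 1 ≤ m → q ^ m ≠ 1) (x : Ext N q) :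
    jet hq0 hq x ∈ eulerJets q (wedge N q) :=
  orbitMap_mem ..

lemma jet_one (hq0 : q ≠ 0) (hq : ∀ m : ℕ, 1 ≤ m → q ^ m ≠ 1) :
    jet hq0 hq (1 : Ext N q) = Finsupp.single 0 (1, 0) :=
  orbitMap_one ..

lemma jet_wedge (hq0 : q ≠ 0) (hq : ∀ m : ℕ, 1 ≤ m → q ^ m ≠ 1) (k : Fin N) (x : Ext N q) :
    jet hq0 hq (wedge N q k x) = jetStep q (wedge N q) k (jet hq0 hq x) :=
  orbitMap_gen_mul ..

end

/-! ### Derivatives, degrees, and the representation on the exterior algebra. -/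

section

variable {N : ℕ} {q : ℂ} (hq0 : q ≠ 0) (hq : ∀ m : ℕ, 1 ≤ m → q ^ m ≠ 1)

/-- The `n`-th lowered derivative on the exterior algebra. -/
def deriv (n : Fin N) : Ext N q →ₗ[ℂ] Ext N q :=
  (Finsupp.lsum ℂ fun _ => LinearMap.proj n ∘ₗ LinearMap.snd ℂ _ _) ∘ₗ jet hq0 hq

/-- The contraction with `γ_n` on the exterior algebra. -/
def iota (c : ℂ) (n : Fin N) : Ext N q →ₗ[ℂ] Ext N q :=
  (Finsupp.lsum ℂ fun m : ℕ => kappa N q c m • (LinearMap.proj n ∘ₗ LinearMap.snd ℂ _ _)) ∘ₗ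
    jet hq0 hq

/-- The elements of degree `m` of the exterior algebra. -/
def gr (m : ℕ) : Submodule ℂ (Ext N q) :=
  LinearMap.eqLocus (jet hq0 hq)
    (Finsupp.lsingle m ∘ₗ LinearMap.prod LinearMap.id (LinearMap.pi (deriv hq0 hq)))

variable {hq0 hq}

lemma mem_gr {m : ℕ} {x : Ext N q} :
    x ∈ gr hq0 hq m ↔ jet hq0 hq x = Finsupp.single m (x, fun n => deriv hq0 hq n x) :=
  Iff.rfl

lemma mem_gr_of_jet {m : ℕ} {x : Ext N q} {Y : Fin N → Ext N q}
    (h : jet hq0 hq x = Finsupp.single m (x, Y)) :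
    x ∈ gr hq0 hq m ∧ ∀ n, deriv hq0 hq n x = Y n := by
  have h1 : ∀ n, deriv hq0 hq n x = Y n := by
    intro n; simp [deriv, h]
  refine ⟨mem_gr.2 ?_, h1⟩
  rw [h]; congr 2; funext n; rw [h1]

lemma iota_of_mem (c : ℂ) (n : Fin N) {m : ℕ} {x : Ext N q} (h : x ∈ gr hq0 hq m) :
    iota hq0 hq c n x = kappa N q c m • deriv hq0 hq n x := by
  rw [mem_gr] at h
  simp [iota, h]

lemma one_mem_gr : (1 : Ext N q) ∈ gr hq0 hq 0 ∧ ∀ n, deriv hq0 hq n (1 : Ext N q) = 0 :=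
  mem_gr_of_jet (jet_one hq0 hq)

lemma wedge_mem_gr {m : ℕ} {x : Ext N q} (h : x ∈ gr hq0 hq m) (k : Fin N) :
    wedge N q k x ∈ gr hq0 hq (m + 1) ∧ ∀ n, deriv hq0 hq n (wedge N q k x)
      = lower q (wedge N q) (lam N q ((m : ℤ) + 1)) k x (fun i => deriv hq0 hq i x) n := by
  refine mem_gr_of_jet ?_
  rw [jet_wedge, mem_gr.1 h, jetStep_single]; rfl

lemma ptr_wedge_deriv {m : ℕ} {x : Ext N q} (h : x ∈ gr hq0 hq m) :
    ptr q (fun i j => wedge N q i (deriv hq0 hq j x)) N = euler q m • x := by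
  have := jet_mem hq0 hq x m
  rw [mem_gr.1 h, Finsupp.single_eq_same] at this
  exact this

/-- The product of the generators along a word. -/
def word (N : ℕ) (q : ℂ) (w : List (Fin N)) : Ext N q :=
  (w.map fun k => toExt N q (gen N q 0 k)).prod

lemma word_nil : word N q [] = 1 := rfl

lemma word_cons (k : Fin N) (w : List (Fin N)) : word N q (k :: w) = wedge N q k (word N q w) := by
  simp [word, wedge_apply]

lemma word_mem_gr (w : List (Fin N)) : word N q w ∈ gr hq0 hq w.length := by
  induction w with
  | nil => exact one_mem_gr.1
  | cons k w ih => rw [word_cons]; exact (wedge_mem_gr ih k).1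

lemma deriv_word_mem (w : List (Fin N)) (n : Fin N) :
    deriv hq0 hq n (word N q w) ∈ gr hq0 hq (w.length - 1) := by
  induction w generalizing n with
  -- In degree 0 the truncated subtraction is harmless, since the derivative is zero.
  | nil => rw [word_nil, one_mem_gr.2]; exact zero_mem _
  | cons k w ih =>
    rw [word_cons, (wedge_mem_gr (word_mem_gr w) k).2, List.length_cons, Nat.add_sub_cancel]
    have h : ∀ a b, wedge N q a (deriv hq0 hq b (word N q w)) ∈ gr hq0 hq w.length := by
      intro a b
      rcases w with _ | ⟨k, w⟩
      · rw [word_nil, one_mem_gr.2, map_zero]; exact zero_mem _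
      · exact (wedge_mem_gr (ih b) a).1
    refine sub_mem (sub_mem (Submodule.smul_mem _ _ (word_mem_gr w)) (Submodule.smul_mem _ _ ?_))
      (Submodule.smul_mem _ _ (h _ _))
    exact sum_mem fun i _ => sum_mem fun j _ => Submodule.smul_mem _ _ (h _ _)

lemma isAnti_deriv_deriv (w : List (Fin N)) :
    IsAnti q fun i j => deriv hq0 hq i (deriv hq0 hq j (word N q w)) := by
  induction w with
  | nil => simp only [word_nil, one_mem_gr.2, map_zero]; exact isAnti_zero
  | cons k w ih =>
    rw [word_cons]
    have h1 := fun k => (wedge_mem_gr (hq0 := hq0) (hq := hq) (word_mem_gr w) k).2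
    -- One-letter words are separate: for them ∂_j x has truncated degree 0, whereas the induction
    -- step would use degree -1. Their second derivatives vanish outright.
    rcases w with _ | ⟨p, w⟩
    · have h2 : ∀ i j, deriv hq0 hq i (deriv hq0 hq j (wedge N q k (word N q []))) = 0 := by
        intro i j
        rw [h1, word_nil]
        simp [lower, amul, one_mem_gr.2]
      simp only [h2]; exact isAnti_zero
    · have h3 := fun f => deriv_word_mem (hq0 := hq0) (hq := hq) (p :: w) f
      rw [List.length_cons, Nat.add_sub_cancel] at h3
      have e : (((p :: w).length : ℕ) : ℤ) = (w.length : ℤ) + 1 := by simp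
      refine isAnti_lowered_lowered hq0 hq ((p :: w).length) h1 (fun f b i => ?_) (fun f => ?_) ih k
      · rw [(wedge_mem_gr (h3 f) b).2, e]
      · rw [ptr_wedge_deriv (h3 f), e]; simp

/-- The action of `γ_k ∈ Cl_q(N)` on the exterior algebra. -/
def cliffordGen (hq0 : q ≠ 0) (hq : ∀ m : ℕ, 1 ≤ m → q ^ m ≠ 1) (c : ℂ) (k : Fin N) :
    Module.End ℂ (Ext N q) :=
  wedge N q k + iota hq0 hq c k

lemma cliffordGen_of_mem (c : ℂ) (k : Fin N) {m : ℕ} {x : Ext N q} (h : x ∈ gr hq0 hq m) :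
    cliffordGen hq0 hq c k x = wedge N q k x + kappa N q c m • deriv hq0 hq k x := by
  rw [cliffordGen, LinearMap.add_apply, iota_of_mem c k h]

lemma isAnti_cliffordGen_word (c : ℂ) (w : List (Fin N)) :
    IsAnti q fun i j => cliffordGen hq0 hq c i (cliffordGen hq0 hq c j (word N q w))
      - (kappa N q c 1 * metric N q i j) • word N q w := by
  have h := isAnti_clifford hq0 hq c w.length (isAnti_wedge hq0 hq)
    (fun k j => (wedge_mem_gr (word_mem_gr w) k).2 j) (ptr_wedge_deriv (word_mem_gr w))
    (isAnti_deriv_deriv (hq0 := hq0) (hq := hq) w) (kappa N q c ((w.length - 1 : ℕ) : ℤ))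
  convert h using 3 with i j
  rw [cliffordGen_of_mem c j (word_mem_gr w), map_add, map_smul,
    cliffordGen_of_mem c i (wedge_mem_gr (word_mem_gr w) j).1,
    cliffordGen_of_mem c i (deriv_word_mem w j), Nat.cast_succ]

lemma span_gen_prod (c : ℂ) :
    Submodule.span ℂ (Set.range fun w : List (Fin N) => (w.map (gen N q c)).prod) = ⊤ := by
  have h1 : Algebra.adjoin ℂ (Set.range (gen N q c)) = ⊤ := by
    have h := congrArg (Subalgebra.map (RingQuot.mkAlgHom ℂ (CliffordRel N q c)))
      (FreeAlgebra.adjoin_range_ι ℂ (Fin N))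
    rw [AlgHom.map_adjoin, ← Set.range_comp, Algebra.map_top,
      (AlgHom.range_eq_top _).2 (RingQuot.mkAlgHom_surjective ℂ (CliffordRel N q c))] at h
    exact h
  have h2 : ((Submonoid.closure (Set.range (gen N q c)) : Submonoid (Clifford N q c)) :
      Set (Clifford N q c)) = Set.range fun w : List (Fin N) => (w.map (gen N q c)).prod := by
    rw [← FreeMonoid.mrange_lift, MonoidHom.coe_mrange]
    exact congrArg _ (funext <| FreeMonoid.lift_apply _)
  rw [← h2, ← Algebra.adjoin_eq_span, h1, Algebra.top_toSubmodule]

lemma toExt_prod (w : List (Fin N)) : toExt N q (w.map (gen N q 0)).prod = word N q w := by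
  rw [map_list_prod, List.map_map]; rfl

lemma span_word : Submodule.span ℂ (Set.range (word N q)) = ⊤ := by
  have h := congrArg (Submodule.map (toExt N q).toLinearMap) (span_gen_prod (N := N) (q := q) 0)
  rw [Submodule.map_span, ← Set.range_comp, Submodule.map_top,
    LinearMap.range_eq_top.2 (toExt N q).surjective] at h
  rw [← h]
  refine congrArg (fun f => Submodule.span ℂ (Set.range f)) (funext fun w => (toExt_prod w).symm)

lemma isAnti_of_span {M M' : Type*} [AddCommGroup M] [Module ℂ M] [AddCommGroup M'] [Module ℂ M']
    {s : Set M} (hs : Submodule.span ℂ s = ⊤) {Z : Fin N → Fin N → M →ₗ[ℂ] M'}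
    (h : ∀ x ∈ s, IsAnti q fun i j => Z i j x) : IsAnti q Z := by
  have e : ∀ x m, ptr q Z m x = ptr q (fun i j => Z i j x) m := fun x m =>
    map_ptr (LinearMap.applyₗ x) Z m
  refine ⟨fun k hk => LinearMap.ext_on hs fun x hx => (h x hx).diag k hk,
    fun k l hkl hl => LinearMap.ext_on hs fun x hx => (h x hx).comm k l hkl hl,
    fun l hl => LinearMap.ext_on hs fun x hx => ?_⟩
  rw [e, (h x hx).refl l hl, LinearMap.smul_apply, e]

lemma isAnti_cliffordGen (c : ℂ) :
    IsAnti q fun i j => cliffordGen hq0 hq c i * cliffordGen hq0 hq c j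
      - (kappa N q c 1 * metric N q i j) • (1 : Module.End ℂ (Ext N q)) := by
  refine isAnti_of_span span_word ?_
  rintro _ ⟨w, rfl⟩
  exact isAnti_cliffordGen_word c w

/-- The representation of the Clifford algebra on the exterior algebra. -/
def cliffordAct (hq0 : q ≠ 0) (hq : ∀ m : ℕ, 1 ≤ m → q ^ m ≠ 1) (c : ℂ) :
    Clifford N q c →ₐ[ℂ] Module.End ℂ (Ext N q) :=
  cliffordLift hq0 hq c (cliffordGen hq0 hq c) (isAnti_cliffordGen c)

end

/-! ### Tensors and recursions for the operators b⁻. -/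

section

variable {N : ℕ} {q : ℂ}

/-- The component of a tensor with first factor `γ_j`. -/
def slice (m : ℕ) (j : Fin N) : Tens N (m + 1) →ₗ[ℂ] Tens N m where
  toFun t w := t (Fin.cons j w)
  map_add' _ _ := rfl
  map_smul' _ _ := rfl

lemma slice_apply (m : ℕ) (j : Fin N) (t : Tens N (m + 1)) (w : Fin m → Fin N) :
    slice m j t w = t (Fin.cons j w) := rfl

/-- The operator `id ⊗ f`. -/
def opSucc (N m : ℕ) : Module.End ℂ (Tens N m) →ₐ[ℂ] Module.End ℂ (Tens N (m + 1)) :=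
  AlgHom.ofLinearMap
    { toFun := fun f =>
        { toFun := fun t w => f (slice m (w 0) t) (Fin.tail w)
          map_add' := fun s t => by funext w; simp
          map_smul' := fun a t => by funext w; simp }
      map_add' := fun f g => rfl
      map_smul' := fun a f => rfl }
    (by
      ext t w
      simp [slice_apply])
    (fun f g => by
      ext t w
      simp only [LinearMap.coe_mk, AddHom.coe_mk, Module.End.mul_apply]
      congr 2)

lemma slice_opSucc (m : ℕ) (f : Module.End ℂ (Tens N m)) (t : Tens N (m + 1)) (j : Fin N) :
    slice m j (opSucc N m f t) = f (slice m j t) := by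
  funext w
  simp [slice_apply, opSucc]

lemma opAt_succ (A : Mat4 N) (m p : ℕ) : opAt A (m + 1) (p + 1) = opSucc N m (opAt A m p) := by
  refine LinearMap.ext fun t => ?_
  funext w
  obtain ⟨j, w, rfl⟩ : ∃ j v, w = Fin.cons j v := ⟨w 0, Fin.tail w, by simp⟩
  change _ = slice m j (opSucc N m (opAt A m p) t) w
  rw [slice_opSucc]
  simp only [opAt, slice_apply, LinearMap.coe_mk, AddHom.coe_mk]
  by_cases h : p + 1 < m
  · have h' : p + 1 + 1 < m + 1 := by omega
    rw [dif_pos h, dif_pos h']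
    refine Finset.sum_congr rfl fun k _ => Finset.sum_congr rfl fun l _ => ?_
    have e1 : (⟨p + 1, by omega⟩ : Fin (m + 1)) = Fin.succ ⟨p, by omega⟩ := rfl
    have e2 : (⟨p + 1 + 1, by omega⟩ : Fin (m + 1)) = Fin.succ ⟨p + 1, by omega⟩ := rfl
    rw [e1, e2, Fin.cons_succ, Fin.cons_succ, Fin.cons_update, Fin.cons_update]
  · rw [dif_neg h, dif_neg (by omega)]

lemma chain_succ (A : Mat4 N) (m s r : ℕ) :
    chain A (m + 1) (s + 1) r = opSucc N m (chain A m s r) := by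
  rw [chain, chain, map_list_prod, List.map_map]
  congr 2
  funext x
  rw [Function.comp_apply, ← opAt_succ, Nat.add_right_comm]

lemma chain_zero_succ (A : Mat4 N) (m r : ℕ) :
    chain A (m + 1) 0 (r + 1) = opAt A (m + 1) 0 * opSucc N m (chain A m 0 r) := by
  rw [← chain_succ, chain, chain, List.range_succ_eq_map, List.map_cons, List.prod_cons,
    List.map_map]
  congr 3
  funext x
  simp [add_comm]

lemma chain_zero (A : Mat4 N) (m s : ℕ) : chain A m s 0 = 1 := by simp [chain]

/-- The first summand of `b^-_{1,k}`. -/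
def bHead (N : ℕ) (q : ℂ) (k : ℕ) : Module.End ℂ (Tens N (k + 1)) :=
  ∑ i ∈ Finset.range (k + 1), (-q ^ (-2 : ℤ)) ^ i • chain (rMat N q) (k + 1) 0 i

/-- The sum over the operators `d'^-_{k+1,i}` in `b^-_{1,k}`. -/
def bTail (N : ℕ) (q : ℂ) (k : ℕ) : Module.End ℂ (Tens N (k + 1)) :=
  ∑ i ∈ Finset.Icc 1 k, q ^ (4 * (i : ℤ) - 4 * (k : ℤ) - 2) • dMinus N q k i

lemma bHead_zero : bHead N q 0 = 1 := by simp [bHead, chain_zero]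

lemma bTail_zero : bTail N q 0 = 0 := by simp [bTail]

/-- Each nontrivial chain starts with R̂₁₂, and the rest is the same chain shifted by one tensor
factor. -/
lemma bHead_succ (k : ℕ) : bHead N q (k + 1)
    = 1 + (-q ^ (-2 : ℤ)) • (opAt (rMat N q) (k + 2) 0 * opSucc N (k + 1) (bHead N q k)) := by
  rw [bHead, Finset.sum_range_succ', pow_zero, one_smul, chain_zero, bHead, map_sum,
    Finset.mul_sum, Finset.smul_sum]
  refine (add_comm _ _).trans (congrArg _ ?_)
  refine Finset.sum_congr rfl fun i _ => ?_
  rw [chain_zero_succ, map_smul, mul_smul_comm, smul_smul, pow_succ']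

/-- K₁₂ can be split off from every summand. The summands with i ≤ k give the shifted tail, and i =
k + 1 has no further K and gives the shifted head. -/
lemma bTail_succ (hq0 : q ≠ 0) (k : ℕ) : bTail N q (k + 1) = opAt (kMat N q) (k + 2) 0 *
    opSucc N (k + 1) (q ^ (-4 : ℤ) • bTail N q k + q ^ (-2 : ℤ) • bHead N q k) := by
  rw [bTail, Finset.sum_Icc_succ_top (by omega), map_add, mul_add]
  congr 1
  · rw [bTail, map_smul, map_sum, Finset.smul_sum, Finset.mul_sum]
    refine Finset.sum_congr rfl fun i hi => ?_
    obtain ⟨h1, h2⟩ := Finset.mem_Icc.1 hi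
    have e : dMinus N q (k + 1) i
        = opAt (kMat N q) (k + 2) 0 * opSucc N (k + 1) (dMinus N q k i) := by
      have e1 : k + 1 - i + 1 = (k - i + 1) + 1 := by omega
      rw [dMinus, dMinus, map_mul, ← mul_assoc, e1, chain_zero_succ, map_sum]
      congr 1
      refine Finset.sum_congr rfl fun j _ => ?_
      rw [map_smul, chain_succ]
    rw [e, map_smul, mul_smul_comm, mul_smul_comm, smul_smul, ← zpow_add₀ hq0]
    congr 2
    push_cast; ring
  · rw [dMinus, bHead, map_smul, map_sum, mul_smul_comm]
    congr 1
    · congr 1; ring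
    · rw [Nat.sub_self, zero_add, chain_zero_succ, chain_zero, map_one, mul_one]
      congr 1
      refine Finset.sum_congr rfl fun j _ => ?_
      rw [map_smul, chain_succ]

lemma bMinus_eq (hq0 : q ≠ 0) (k : ℕ) :
    bMinus N q k = bHead N q k - lam N q ((k : ℤ) + 1) • bTail N q k := by
  rw [bMinus, qPlus_mul_qMinus hq0, lam, bHead, bTail,
    show 2 * (N : ℤ) - 4 * (k + 1) + 4 = 2 * N - 4 * k by ring]

/-- The class of a tensor in the exterior algebra. -/
def cls (N : ℕ) (q : ℂ) (m : ℕ) : Tens N m →ₗ[ℂ] Ext N q :=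
  (toExt N q).toLinearMap ∘ₗ toExterior N q m

lemma cls_apply (m : ℕ) (t : Tens N m) :
    cls N q m t = ∑ w, t w • word N q (List.ofFn w) := by
  simp only [cls, toExterior, LinearMap.comp_apply, LinearMap.coe_mk, AddHom.coe_mk, map_sum,
    AlgEquiv.toLinearMap_apply, map_smul, word, List.map_ofFn, map_list_prod]
  rfl

lemma cls_succ (m : ℕ) (t : Tens N (m + 1)) :
    cls N q (m + 1) t = ∑ j, wedge N q j (cls N q m (slice m j t)) := by
  simp only [cls_apply, map_sum, map_smul]
  rw [← (Fin.consEquiv fun _ : Fin (m + 1) => Fin N).sum_comp, Fintype.sum_prod_type]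
  refine Finset.sum_congr rfl fun j _ => Finset.sum_congr rfl fun w _ => ?_
  have e : (Fin.consEquiv fun _ : Fin (m + 1) => Fin N) (j, w) = Fin.cons j w := rfl
  simp only [e, List.ofFn_succ, Fin.cons_zero, Fin.cons_succ, word_cons, slice_apply]

lemma cls_mem_gr {hq0 : q ≠ 0} {hq : ∀ m : ℕ, 1 ≤ m → q ^ m ≠ 1} (m : ℕ) (t : Tens N m) :
    cls N q m t ∈ gr hq0 hq m := by
  rw [cls_apply]
  refine sum_mem fun w _ => Submodule.smul_mem _ _ ?_
  have := word_mem_gr (hq0 := hq0) (hq := hq) (List.ofFn w)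
  rwa [List.length_ofFn] at this

lemma cls_slice_opAt (A : Mat4 N) (m : ℕ) (u : Tens N (m + 2)) (n : Fin N) :
    cls N q (m + 1) (slice (m + 1) n (opAt A (m + 2) 0 u))
      = ∑ b, ∑ k, ∑ l, A n b k l • wedge N q b (cls N q m (slice m l (slice (m + 1) k u))) := by
  rw [cls_succ]
  refine Finset.sum_congr rfl fun b _ => ?_
  have e : slice m b (slice (m + 1) n (opAt A (m + 2) 0 u))
      = ∑ k, ∑ l, A n b k l • slice m l (slice (m + 1) k u) := by
    funext w
    simp only [slice_apply, opAt, LinearMap.coe_mk, AddHom.coe_mk, Finset.sum_apply,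
      Pi.smul_apply, smul_eq_mul]
    rw [dif_pos (by omega)]
    refine Finset.sum_congr rfl fun k _ => Finset.sum_congr rfl fun l _ => ?_
    have e1 : (⟨0, by omega⟩ : Fin (m + 2)) = 0 := rfl
    have e2 : (⟨0 + 1, by omega⟩ : Fin (m + 2)) = Fin.succ 0 := rfl
    rw [e1, e2, Fin.cons_zero, Fin.cons_succ, Fin.cons_zero, Fin.update_cons_zero,
      ← Fin.cons_update,
      Fin.update_cons_zero]
  rw [e]
  simp only [map_sum, map_smul]

end

/-! ### Comparison of the contraction by b⁻ with the derivatives. -/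

section

variable {N : ℕ} {q : ℂ}

/-- The class of the contraction of `f t` with a generator, with lowered index. -/
def lowered (q : ℂ) (k : ℕ) (f : Module.End ℂ (Tens N (k + 1))) (t : Tens N (k + 1)) (i : Fin N) :
    Ext N q :=
  weight N q i • cls N q k (slice k i.rev (f t))

lemma lowered_bHead_zero (t : Tens N 1) (i : Fin N) :
    lowered q 0 (bHead N q 0) t i = ∑ j, metric N q i j • cls N q 0 (slice 0 j t) := by
  rw [Finset.sum_eq_single i.rev, metric_rev, lowered, bHead_zero, Module.End.one_apply]
  · intro j _ hj
    rw [metric_eq_zero, zero_smul]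
    rintro rfl; simp at hj
  · simp

lemma lowered_bHead_succ (hq0 : q ≠ 0) (k : ℕ) (t : Tens N (k + 2)) (i : Fin N) :
    lowered q (k + 1) (bHead N q (k + 1)) t i
      = ∑ j, (metric N q i j • cls N q (k + 1) (slice (k + 1) j t) - (q ^ 2)⁻¹ •
        amul (fun b f => wedge N q b (lowered q k (bHead N q k) (slice (k + 1) j t) f))
          (rInv N q) i j) := by
  have h1 : weight N q i • cls N q (k + 1) (slice (k + 1) i.rev t)
      = ∑ j, metric N q i j • cls N q (k + 1) (slice (k + 1) j t) := by
    rw [Finset.sum_eq_single i.rev, metric_rev]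
    · intro j _ hj
      rw [metric_eq_zero, zero_smul]
      rintro rfl; simp at hj
    · simp
  rw [Finset.sum_sub_distrib, ← h1, lowered, bHead_succ, LinearMap.add_apply, Module.End.one_apply,
    LinearMap.smul_apply, Module.End.mul_apply, map_add, map_smul, map_add, map_smul,
    cls_slice_opAt, smul_add, zpow_neg, zpow_ofNat, neg_smul, smul_neg, ← sub_eq_add_neg,
    ← Finset.smul_sum, smul_comm (weight N q i)]
  refine congrArg₂ (· - ·) rfl (congrArg _ ?_)
  simp only [amul, Finset.smul_sum, smul_smul]
  rw [Finset.sum_comm]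
  refine Finset.sum_congr rfl fun j _ => Finset.sum_congr rfl fun b _ => ?_
  rw [← sum_rev]
  refine Finset.sum_congr rfl fun l _ => ?_
  rw [metric_rMat hq0, Fin.rev_rev, lowered, slice_opSucc, map_smul, smul_smul]

lemma lowered_bTail_succ (hq0 : q ≠ 0) (k : ℕ) (t : Tens N (k + 2)) (i : Fin N) :
    lowered q (k + 1) (bTail N q (k + 1)) t i = wedge N q i (∑ j,
      ((q ^ 2)⁻¹ ^ 2 • lowered q k (bTail N q k) (slice (k + 1) j t) j
        + (q ^ 2)⁻¹ • lowered q k (bHead N q k) (slice (k + 1) j t) j)) := by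
  rw [lowered, bTail_succ hq0, Module.End.mul_apply, cls_slice_opAt,
    Finset.sum_eq_single i]
  · rw [map_sum, Finset.smul_sum]
    refine Finset.sum_congr rfl fun j _ => ?_
    rw [Finset.sum_eq_single j.rev]
    · have h1 : (q ^ 2)⁻¹ ^ 2 = q ^ (-4 : ℤ) := by
        rw [zpow_neg, inv_pow, ← pow_mul]; rfl
      have h2 : (q ^ 2)⁻¹ = q ^ (-2 : ℤ) := by rw [zpow_neg]; rfl
      rw [slice_opSucc, lowered, lowered, h1, h2, kMat, metric_rev, metric_eq, if_pos rfl,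
        smul_smul, ← mul_assoc, weight_mul_rev hq0, one_mul, LinearMap.add_apply,
        LinearMap.smul_apply, LinearMap.smul_apply]
      simp only [map_add, map_smul, smul_add]
      rw [smul_comm (weight N q j), smul_comm (weight N q j)]
    · intro l _ hl
      rw [kMat, metric_eq_zero (i := j) (j := l), mul_zero, zero_smul]
      rintro rfl; simp at hl
    · simp
  · intro b _ hb
    simp only [kMat, metric_eq]
    simp [Ne.symm hb]
  · simp

/-- Both sides obey the Leibniz recursion in the first tensor factor. In particular the right-hand
side depends only on the class of the tensor. -/
lemma deriv_cls {hq0 : q ≠ 0} {hq : ∀ m : ℕ, 1 ≤ m → q ^ m ≠ 1} (k : ℕ) (t : Tens N (k + 1))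
    (i : Fin N) : deriv hq0 hq i (cls N q (k + 1) t)
      = lowered q k (bHead N q k) t i
        - lam N q ((k : ℤ) + 1) • lowered q k (bTail N q k) t i := by
  have h : ∀ (k : ℕ) (t : Tens N (k + 1)) (i : Fin N), deriv hq0 hq i (cls N q (k + 1) t)
      = ∑ j, lower q (wedge N q) (lam N q ((k : ℤ) + 1)) j (cls N q k (slice k j t))
        (fun f => deriv hq0 hq f (cls N q k (slice k j t))) i := by
    intro k t i
    rw [cls_succ, map_sum]
    exact Finset.sum_congr rfl fun j _ => (wedge_mem_gr (cls_mem_gr k _) j).2 i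
  induction k generalizing i with
  | zero =>
    have h0 : ∀ (u : Tens N 0) f, deriv hq0 hq f (cls N q 0 u) = 0 := by
      intro u f
      rw [cls_apply]
      simp only [map_sum, map_smul, List.ofFn_zero, word_nil, one_mem_gr.2, smul_zero,
        Finset.sum_const_zero]
    rw [h, lowered_bHead_zero, bTail_zero]
    simp [lower, h0, amul, lowered]
  | succ k ih =>
    -- The leading K makes each tail term have the form γ_f θ_j. The exterior relation then replaces
    -- R̂⁻¹ by -q² on it, and `lam_succ` matches the coefficients.
    obtain ⟨θ, hθ⟩ : ∃ θ : Fin N → Ext N q, ∀ j f,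
        lowered q k (bTail N q k) (slice (k + 1) j t) f = wedge N q f (θ j) := by
      rcases k with _ | k
      · exact ⟨0, fun j f => by simp [bTail_zero, lowered]⟩
      · exact ⟨_, fun j f => lowered_bTail_succ hq0 k _ f⟩
    have hq2 : q ^ 2 * (q ^ 2)⁻¹ = 1 := mul_inv_cancel₀ (pow_ne_zero 2 hq0)
    have e1 := lam_succ (N := N) hq0 hq ((k : ℤ) + 1)
    rw [h, lowered_bHead_succ hq0, lowered_bTail_succ hq0, map_sum, Finset.smul_sum,
      ← Finset.sum_sub_distrib]
    refine Finset.sum_congr rfl fun j _ => ?_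
    simp only [ih, hθ, lower]
    have hW := (isAnti_wedge hq0 hq (θ j)).amul_rInv hq0 i j
    have hA : amul (fun a b => wedge N q a (lowered q k (bHead N q k) (slice (k + 1) j t) b
        - lam N q ((k : ℤ) + 1) • wedge N q b (θ j))) (rInv N q) i j
        = amul (fun a b => wedge N q a (lowered q k (bHead N q k) (slice (k + 1) j t) b))
          (rInv N q) i j - lam N q ((k : ℤ) + 1) • -(q ^ 2) • wedge N q i (wedge N q j (θ j)) := by
      rw [← hW, sub_eq_add_neg, ← neg_smul, ← amul_smul, ← amul_add]
      congr 1
      funext a b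
      rw [map_sub, map_smul, sub_eq_add_neg, neg_smul]
    rw [hA]
    simp only [map_add, map_sub, map_smul, Nat.cast_add, Nat.cast_one]
    generalize (q ^ 2)⁻¹ = s at *
    clear hW hA h ih hθ hq hq0
    match_scalars
    all_goals grind

lemma lowered_bMinus (hq0 : q ≠ 0) (k : ℕ) (t : Tens N (k + 1)) (i : Fin N) :
    lowered q k (bMinus N q k) t i = lowered q k (bHead N q k) t i
        - lam N q ((k : ℤ) + 1) • lowered q k (bTail N q k) t i := by
  simp only [lowered, bMinus_eq hq0, LinearMap.sub_apply, LinearMap.smul_apply, map_sub, map_smul]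
  module

lemma cls_contract {hq0 : q ≠ 0} {hq : ∀ m : ℕ, 1 ≤ m → q ^ m ≠ 1} (c : ℂ) (m : ℕ) (t : Tens N m)
    (i : Fin N) :
    ((1 + q ^ (2 * (N : ℤ) - 4)) / (1 + q ^ (2 * (N : ℤ) - 4 * (m : ℤ)))) •
      cls N q (m - 1) (contract N q c i m t)
      = kappa N q c m • deriv hq0 hq i (cls N q m t) := by
  rcases m with _ | k
  · rw [cls_apply (t := t)]
    simp only [map_sum, map_smul, List.ofFn_zero, word_nil, one_mem_gr.2, smul_zero,
        Finset.sum_const_zero, contract, map_zero]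
  · have e : contract N q c i (k + 1) t = (c ^ 2 * q ^ (2 * (N : ℤ) - 3) * qPlus q
        / (q ^ (2 * (N : ℤ) - 4) + 1)) • weight N q i • slice k i.rev (bMinus N q k t) := by
      funext w
      simp only [contract, Pi.smul_apply, slice_apply, smul_eq_mul]
      rw [Finset.sum_eq_single i.rev]
      · rw [gForm, metric_rev]; ring
      · intro j _ hj
        rw [gForm, metric_eq_zero]
        · simp
        · rintro rfl; simp at hj
      · simp
    have h1 := one_add_zpow_ne_zero hq0 hq (2 * (N : ℤ) - 4)
    rw [deriv_cls, ← lowered_bMinus hq0, e]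
    change _ • cls N q k _ = _
    rw [map_smul, map_smul, smul_smul,
      lowered, kappa, add_comm (q ^ (2 * (N : ℤ) - 4))]
    congr 1
    field_simp

end

/-! ### Straightening of words, the length filtration and symbols. -/

section

variable {N : ℕ} {q : ℂ} {M : Type*} [AddCommGroup M] [Module ℂ M]

lemma ptr_mem_span (Z : Fin N → Fin N → M) (k : Fin N) (m : ℕ) (hm : m ≤ k) :
    ptr q Z m ∈ Submodule.span ℂ {x | ∃ a b, a < k ∧ x = Z a b} := by
  refine sum_mem fun i _ => ?_
  split_ifs with h
  · refine Submodule.smul_mem _ _ (Submodule.subset_span ⟨i, i.rev, ?_, rfl⟩)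
    exact Fin.lt_def.2 (h.trans_le hm)
  · exact zero_mem _

/-- On the antidiagonal, k' ≤ k means N - (k+1) ≤ k. The reflection identity thus expresses the
partial trace up to k, inclusive, by one that stops before k, and Z k k' can be solved for. -/
lemma IsAnti.mem_span (hq0 : q ≠ 0) {Z : Fin N → Fin N → M} (h : IsAnti q Z) {k l : Fin N}
    (hkl : l ≤ k) : Z k l ∈ Submodule.span ℂ {x | ∃ a b, a < k ∧ x = Z a b} := by
  by_cases hk : l = k.rev
  · subst hk
    have h1 := (h.refl (N - (k + 1)) (by omega))
    have h0 : N ≤ 2 * (k : ℕ) + 1 := by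
      have := Fin.le_def.1 hkl
      rw [Fin.val_rev] at this; omega
    rw [Nat.sub_sub_self k.is_lt, ptr_succ] at h1
    have h2 : Z k k.rev = (weight N q k)⁻¹ • (weight N q k • Z k k.rev) := by
      rw [smul_smul, inv_mul_cancel₀ (weight_ne_zero hq0 k), one_smul]
    rw [h2, eq_sub_of_add_eq' h1]
    refine Submodule.smul_mem _ _ (sub_mem (Submodule.smul_mem _ _ ?_) ?_)
    · exact ptr_mem_span Z k _ (by omega)
    · exact ptr_mem_span Z k _ le_rfl
  · rcases hkl.eq_or_lt with rfl | hlt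
    · rw [h.diag l hk]; exact zero_mem _
    · rw [h.comm l k hlt (by rintro rfl; simp at hk), ← neg_smul]
      exact Submodule.smul_mem _ _ (Submodule.subset_span ⟨l, k, hlt, rfl⟩)

/-- The value of a word as a number in base `N`. -/
def code : List (Fin N) → ℕ
  | [] => 0
  | k :: w => k * N ^ w.length + code w

lemma code_lt (w : List (Fin N)) : code w < N ^ w.length := by
  induction w with
  | nil => simp [code]
  | cons k w ih =>
    rw [code, List.length_cons, pow_succ, mul_comm (N ^ _)]
    have : ((k : ℕ) + 1) * N ^ w.length ≤ N * N ^ w.length := Nat.mul_le_mul_right _ k.is_lt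
    rw [add_mul, one_mul] at this
    omega

lemma code_lt_code {k a : Fin N} (hak : a < k) {v w : List (Fin N)} (h : v.length = w.length) :
    code (a :: v) < code (k :: w) := by
  have h1 := code_lt v
  have : ((a : ℕ) + 1) * N ^ v.length ≤ k * N ^ v.length := Nat.mul_le_mul_right _ hak
  rw [add_mul, one_mul] at this
  rw [code, code, ← h]
  omega

lemma code_append_lt (p : List (Fin N)) {v w : List (Fin N)} (h : v.length = w.length)
    (h' : code v < code w) : code (p ++ v) < code (p ++ w) := by
  induction p with
  | nil => exact h'
  | cons k p ih =>
    simp only [List.cons_append, code, List.length_append, h]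
    omega

lemma word_append (p w : List (Fin N)) : word N q (p ++ w) = word N q p * word N q w := by
  simp [word]

lemma word_eq_zero (hq0 : q ≠ 0) (hq : ∀ m : ℕ, 1 ≤ m → q ^ m ≠ 1) (w : List (Fin N))
    (hw : w.length = N + 1) : word N q w = 0 := by
  induction hn : code w using Nat.strong_induction_on generalizing w with
  | _ n ih =>
    subst hn
    -- A strictly increasing word has at most N letters. The adjacent pair violating the order is
    -- replaced by pairs with smaller first letter, which lowers the base-N value of the word.
    have h1 : ¬ w.IsChain (· < ·) := by
      intro h
      have h2 : w.Nodup := h.pairwise.imp fun h => h.ne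
      have := h2.length_le_card
      rw [Fintype.card_fin] at this; omega
    rw [List.isChain_iff_forall_rel_of_append_cons_cons] at h1
    push Not at h1
    obtain ⟨k, l, p, r, rfl, hkl⟩ := h1
    have h2 := (isAnti_wedge hq0 hq (word N q r)).mem_span hq0 hkl
    have h3 : ∀ y ∈ Submodule.span ℂ
        {x | ∃ a b, a < k ∧ x = wedge N q a (wedge N q b (word N q r))}, word N q p * y = 0 := by
      intro y hy
      induction hy using Submodule.span_induction with
      | mem y hy =>
        obtain ⟨a, b, hak, rfl⟩ := hy
        rw [← word_cons, ← word_cons, ← word_append]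
        refine ih _ (code_append_lt p (by simp) (code_lt_code hak (by simp))) _ ?_ rfl
        simpa using hw
      | zero => rw [mul_zero]
      | add x y _ _ hx hy => rw [mul_add, hx, hy, add_zero]
      | smul a x _ hx => rw [mul_smul_comm, hx, smul_zero]
    rw [word_append, word_cons, word_cons]
    exact h3 _ h2

/-- The product of the elements `g k` along a word. -/
def mon {A : Type*} [Ring A] (g : Fin N → A) (w : List (Fin N)) : A := (w.map g).prod

lemma mon_cons {A : Type*} [Ring A] {g : Fin N → A} (k : Fin N) (w : List (Fin N)) :
    mon g (k :: w) = g k * mon g w := by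
  simp [mon]

section filtration

variable {A : Type*} [Ring A] [Algebra ℂ A] (g : Fin N → A)

/-- The span of the products of less than `n` of the elements `g k`. -/
def filt (n : ℕ) : Submodule ℂ A := Submodule.span ℂ {x | ∃ w, w.length < n ∧ x = mon g w}

variable {g}

lemma mon_mem_filt {n : ℕ} {w : List (Fin N)} (h : w.length < n) : mon g w ∈ filt g n :=
  Submodule.subset_span ⟨w, h, rfl⟩

lemma filt_zero : filt g 0 = ⊥ := by simp [filt]

lemma filt_mono {m n : ℕ} (h : m ≤ n) : filt g m ≤ filt g n :=
  Submodule.span_mono fun _ ⟨w, hw, hx⟩ => ⟨w, hw.trans_le h, hx⟩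

lemma filt_le {n : ℕ} {S : Submodule ℂ A} (h : ∀ w : List (Fin N), w.length < n → mon g w ∈ S) :
    filt g n ≤ S :=
  Submodule.span_le.2 fun _ ⟨w, hw, hx⟩ => hx ▸ h w hw

lemma filt_le_comap (k : Fin N) (n : ℕ) :
    filt g n ≤ (filt g (n + 1)).comap (LinearMap.mulLeft ℂ (g k)) :=
  filt_le fun w hw => by
    rw [Submodule.mem_comap, LinearMap.mulLeft_apply, ← mon_cons]
    exact mon_mem_filt (by simpa using hw)

lemma mul_mem_filt (k : Fin N) {n : ℕ} {x : A} (h : x ∈ filt g n) : g k * x ∈ filt g (n + 1) :=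
  filt_le_comap k n h

lemma exists_sub_mem_filt {n : ℕ} {x : A} (h : x ∈ filt g (n + 1)) :
    ∃ t : Tens N n, x - ∑ w, t w • mon g (List.ofFn w) ∈ filt g n := by
  induction h using Submodule.span_induction with
  | mem x hx =>
    obtain ⟨w, hw, rfl⟩ := hx
    rcases (Nat.lt_succ_iff.1 hw).lt_or_eq with h | rfl
    · exact ⟨0, by simpa using mon_mem_filt h⟩
    · refine ⟨Pi.single w.get 1, ?_⟩
      rw [Finset.sum_eq_single w.get]
      · simp
      · intro v _ hv; rw [Pi.single_eq_of_ne hv, zero_smul]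
      · simp
  | zero => exact ⟨0, by simp⟩
  | add x y _ _ hx hy =>
    obtain ⟨s, hs⟩ := hx
    obtain ⟨t, ht⟩ := hy
    refine ⟨s + t, ?_⟩
    have := add_mem hs ht
    simp only [Pi.add_apply, add_smul, Finset.sum_add_distrib]
    convert this using 1; abel
  | smul a x _ hx =>
    obtain ⟨t, ht⟩ := hx
    refine ⟨a • t, ?_⟩
    have := Submodule.smul_mem _ a ht
    simpa only [Pi.smul_apply, smul_eq_mul, mul_smul, ← Finset.smul_sum, smul_sub] using this

/-- The sequences of symbols of elements of the filtered algebra. -/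
abbrev Symbol (g : Fin N → A) : Type _ := (m : ℕ) → A ⧸ filt g m

/-- Multiplication of symbols by a generator. -/
def symbolStep (g : Fin N → A) (k : Fin N) : Symbol g →ₗ[ℂ] Symbol g :=
  LinearMap.pi fun m => match m with
    | 0 => 0
    | m + 1 => (filt g m).mapQ (filt g (m + 1)) (LinearMap.mulLeft ℂ (g k))
        (filt_le_comap k m) ∘ₗ LinearMap.proj m

lemma symbolStep_zero (k : Fin N) (u : Symbol g) : symbolStep g k u 0 = 0 := rfl

lemma symbolStep_succ (k : Fin N) (u : Symbol g) (m : ℕ) : symbolStep g k u (m + 1)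
    = (filt g m).mapQ (filt g (m + 1)) (LinearMap.mulLeft ℂ (g k)) (filt_le_comap k m) (u m) := rfl

/-- The sequences of symbols of elements of the right degree. -/
def symbols (g : Fin N → A) : Submodule ℂ (Symbol g) :=
  Submodule.pi Set.univ fun m => (filt g (m + 1)).map (filt g m).mkQ

lemma symbolStep_mem (k : Fin N) (u : Symbol g) (hu : u ∈ symbols g) :
    symbolStep g k u ∈ symbols g := by
  rintro (_ | m) -
  · exact zero_mem _
  · obtain ⟨x, hx, e⟩ := hu m (Set.mem_univ _)
    refine ⟨g k * x, mul_mem_filt k hx, ?_⟩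
    rw [symbolStep_succ, ← e]; rfl

/-- The metric term of the Clifford relation multiplies x without raising its length, so it is zero
two filtration steps higher. -/
lemma isAnti_symbolStep {a : ℂ} (h : IsAnti q fun i j => g i * g j - (a * metric N q i j) • (1 : A))
    (u : Symbol g) (hu : u ∈ symbols g) :
    IsAnti q fun k l => symbolStep g k (symbolStep g l u) := by
  refine isAnti_pi ?_
  rintro (_ | _ | m)
  · exact isAnti_zero
  · simpa only [symbolStep_succ, symbolStep_zero, map_zero] using isAnti_zero
  · obtain ⟨x, hx, e⟩ := hu m (Set.mem_univ _)
    have h1 := h.map ((filt g (m + 2)).mkQ ∘ₗ LinearMap.mulRight ℂ x)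
    convert h1 using 3 with k l
    rw [symbolStep_succ, symbolStep_succ, ← e]
    simp only [LinearMap.comp_apply, Submodule.mkQ_apply, Submodule.mapQ_apply,
      LinearMap.mulLeft_apply, LinearMap.mulRight_apply, sub_mul, smul_mul_assoc,
      one_mul, mul_assoc]
    rw [Submodule.Quotient.eq, sub_sub_cancel]
    exact Submodule.smul_mem _ _ (filt_mono (by omega) hx)

/-- The symbols of elements of the exterior algebra. -/
lemma exists_symbolMap (hq0 : q ≠ 0) (hq : ∀ m : ℕ, 1 ≤ m → q ^ m ≠ 1) {a : ℂ}
    (h : IsAnti q fun i j => g i * g j - (a * metric N q i j) • (1 : A)) :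
    ∃ φ : Ext N q →ₗ[ℂ] Symbol g, ∀ w : List (Fin N),
      φ (word N q w) w.length = (filt g w.length).mkQ (mon g w) := by
  let v : symbols g := ⟨Pi.single 0 ((filt g 0).mkQ 1), by
    rintro (_ | m) -
    · rw [Pi.single_eq_same]
      exact ⟨1, mon_mem_filt (w := []) (by simp), rfl⟩
    · rw [Pi.single_eq_of_ne (by omega)]; exact zero_mem _⟩
  refine ⟨orbitMap hq0 hq symbolStep_mem (isAnti_symbolStep h) v, fun w => ?_⟩
  induction w with
  | nil =>
    rw [word_nil, orbitMap_one]
    exact Pi.single_eq_same (M := fun m => A ⧸ filt g m) 0 _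
  | cons k w ih =>
    rw [word_cons, wedge_apply, orbitMap_gen_mul, List.length_cons, symbolStep_succ, ih, mon_cons]
    rfl

/-- A word of length N + 1 is zero in the exterior algebra, so its symbol is zero and it is a
combination of shorter words. Multiplication by generators thus never leaves `filt g (N + 1)`. -/
lemma filt_eq_top (hq0 : q ≠ 0) (hq : ∀ m : ℕ, 1 ≤ m → q ^ m ≠ 1) {a : ℂ}
    (h : IsAnti q fun i j => g i * g j - (a * metric N q i j) • (1 : A))
    (hs : Submodule.span ℂ (Set.range (mon g)) = ⊤) : filt g (N + 1) = ⊤ := by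
  obtain ⟨φ, hφ⟩ := exists_symbolMap hq0 hq h
  rw [eq_top_iff, ← hs, Submodule.span_le]
  rintro _ ⟨w, rfl⟩
  rw [SetLike.mem_coe]
  induction w with
  | nil => exact mon_mem_filt (by simp)
  | cons k w ih =>
    have h1 : filt g (N + 2) ≤ filt g (N + 1) := by
      refine filt_le fun w hw => ?_
      rcases (Nat.lt_succ_iff.1 hw).lt_or_eq with h | h
      · exact mon_mem_filt h
      · have := hφ w
        rw [word_eq_zero hq0 hq w h, map_zero, h] at this
        exact (Submodule.Quotient.mk_eq_zero _).1 this.symm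
    rw [mon_cons]
    exact h1 (mul_mem_filt k ih)

end filtration

end

/-! ### Faithfulness. -/

section

variable {N : ℕ} {q : ℂ} {hq0 : q ≠ 0} {hq : ∀ m : ℕ, 1 ≤ m → q ^ m ≠ 1}

/-- The elements of the exterior algebra that are sums of elements of degree less than `n`. -/
abbrev extFilt (N : ℕ) (q : ℂ) (n : ℕ) : Submodule ℂ (Ext N q) :=
  filt (fun k : Fin N => toExt N q (gen N q 0 k)) n

lemma word_mem_extFilt {n : ℕ} {w : List (Fin N)} (h : w.length < n) :
    word N q w ∈ extFilt N q n :=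
  mon_mem_filt h

lemma deriv_word_mem_extFilt (w : List (Fin N)) (i : Fin N) :
    deriv hq0 hq i (word N q w) ∈ extFilt N q w.length := by
  induction w generalizing i with
  | nil => rw [word_nil, one_mem_gr.2]; exact zero_mem _
  | cons k w ih =>
    rw [word_cons, (wedge_mem_gr (word_mem_gr w) k).2, List.length_cons]
    refine sub_mem (sub_mem (Submodule.smul_mem _ _ (word_mem_extFilt (Nat.lt_succ_self _)))
      (Submodule.smul_mem _ _ ?_)) (Submodule.smul_mem _ _ (mul_mem_filt i (ih k)))
    exact sum_mem fun a _ => sum_mem fun b _ => Submodule.smul_mem _ _ (mul_mem_filt a (ih b))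

lemma cls_single (w : List (Fin N)) :
    cls N q w.length (Pi.single w.get 1) = word N q w := by
  rw [cls_apply, Finset.sum_eq_single w.get]
  · simp
  · intro v _ hv; rw [Pi.single_eq_of_ne hv, zero_smul]
  · simp

/-- The jet separates degrees: words shorter than n have no component at position n. -/
lemma eq_zero_of_mem_extFilt {n : ℕ} {x : Ext N q} (h : x ∈ gr hq0 hq n)
    (h' : x ∈ extFilt N q n) : x = 0 := by
  have h1 : extFilt N q n ≤ LinearMap.ker (Finsupp.lapply (R := ℂ) n ∘ₗ jet hq0 hq) := by
    refine filt_le fun w hw => ?_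
    have := mem_gr.1 (word_mem_gr (hq0 := hq0) (hq := hq) w)
    change jet hq0 hq (word N q w) n = 0
    rw [this, Finsupp.single_eq_of_ne (by omega)]
  have h2 : jet hq0 hq x n = 0 := h1 h'
  rw [mem_gr.1 h, Finsupp.single_eq_same] at h2
  exact congrArg Prod.fst h2

theorem injective_of_action (hq0 : q ≠ 0) (hq : ∀ m : ℕ, 1 ≤ m → q ^ m ≠ 1) {A : Type*} [Ring A]
    [Algebra ℂ A] {g : Fin N → A} {c a : ℂ}
    (h : IsAnti q fun i j => g i * g j - (a * metric N q i j) • (1 : A))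
    (hs : Submodule.span ℂ (Set.range (mon g)) = ⊤) (ρ : A →ₐ[ℂ] Module.End ℂ (Ext N q))
    (hρ : ∀ m ≤ N, ∀ (t : Tens N m) (i : Fin N), ρ (g i) (cls N q m t)
      = wedge N q i (cls N q m t) + kappa N q c m • deriv hq0 hq i (cls N q m t)) :
    Function.Injective ρ := by
  have hw : ∀ (w : List (Fin N)) (i : Fin N), w.length ≤ N → ρ (g i) (word N q w)
      = word N q (i :: w) + kappa N q c w.length • deriv hq0 hq i (word N q w) := by
    intro w i h
    have := hρ _ h (Pi.single w.get 1) i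
    rwa [cls_single, ← word_cons] at this
  have hstep : ∀ (i : Fin N) (n : ℕ), n ≤ N → ∀ x ∈ extFilt N q n,
      ρ (g i) x ∈ extFilt N q (n + 1) := by
    intro i n hn
    suffices extFilt N q n ≤ (extFilt N q (n + 1)).comap (ρ (g i)) from fun x hx => this hx
    refine filt_le fun w h => ?_
    change ρ (g i) (word N q w) ∈ extFilt N q (n + 1)
    rw [hw w i (by omega)]
    refine add_mem (word_mem_extFilt (by simpa using h)) (Submodule.smul_mem _ _ ?_)
    exact filt_mono (by omega) (deriv_word_mem_extFilt w i)
  -- Evaluated at 1, a word acts as its exterior counterpart modulo lower degree. Only degrees below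
  -- N are acted on here, so the prescribed formula applies.
  have htop : ∀ w : List (Fin N), w.length ≤ N →
      ρ (mon g w) 1 - word N q w ∈ extFilt N q w.length := by
    intro w
    induction w with
    | nil => intro _; simp [mon, word_nil]
    | cons k w ih =>
      intro h
      rw [List.length_cons] at h ⊢
      have e : ρ (mon g (k :: w)) 1 - word N q (k :: w)
          = ρ (g k) (ρ (mon g w) 1 - word N q w)
            + kappa N q c w.length • deriv hq0 hq k (word N q w) := by
        rw [mon_cons, map_mul, Module.End.mul_apply, map_sub, hw w k (by omega)]; abel
      rw [e]
      refine add_mem (hstep k _ (by omega) _ (ih (by omega))) (Submodule.smul_mem _ _ ?_)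
      exact filt_mono (by omega) (deriv_word_mem_extFilt w k)
  obtain ⟨φ, hφ⟩ := exists_symbolMap hq0 hq h
  rw [injective_iff_map_eq_zero]
  intro x hx
  -- Descent in the filtration: x acts as zero, so its leading tensor t has zero class in the
  -- exterior algebra (`h6`). The symbol map then gives that the leading part of x is itself of
  -- lower length (`h7`).
  have key : ∀ n ≤ N + 1, x ∈ filt g n → x = 0 := by
    intro n
    induction n with
    | zero => intro _ h; rwa [filt_zero] at h
    | succ n ih =>
      intro hn hxn
      obtain ⟨t, ht⟩ := exists_sub_mem_filt hxn
      refine ih (by omega) ?_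
      have h1 : filt g n ≤ (extFilt N q n).comap
          (LinearMap.applyₗ (1 : Ext N q) ∘ₗ ρ.toLinearMap) := by
        refine filt_le fun w h => ?_
        have := add_mem (filt_mono h.le (htop w (by omega))) (word_mem_extFilt (q := q) h)
        rw [sub_add_cancel] at this
        exact this
      have h2 : ∑ w, t w • ρ (mon g (List.ofFn w)) 1 ∈ extFilt N q n := by
        have := h1 ht
        simp only [Submodule.mem_comap, LinearMap.comp_apply, AlgHom.toLinearMap_apply, map_sub,
          map_sum, map_smul, hx, map_zero, zero_sub, neg_mem_iff,
          LinearMap.applyₗ_apply_apply] at this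
        exact this
      have h3 : cls N q n t ∈ extFilt N q n := by
        have h4 : ∑ w, t w • (ρ (mon g (List.ofFn w)) 1 - word N q (List.ofFn w))
            ∈ extFilt N q n := by
          refine sum_mem fun w _ => Submodule.smul_mem _ _ ?_
          have := htop (List.ofFn w) (by rw [List.length_ofFn]; omega)
          rwa [List.length_ofFn] at this
        have h5 := sub_mem h2 h4
        rw [cls_apply]
        simpa only [← Finset.sum_sub_distrib, smul_sub, sub_sub_cancel] using h5
      have h6 : cls N q n t = 0 :=
        eq_zero_of_mem_extFilt (cls_mem_gr (hq0 := hq0) (hq := hq) n t) h3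
      have h7 : (filt g n).mkQ (∑ w, t w • mon g (List.ofFn w)) = 0 := by
        have := congrFun (congrArg φ h6) n
        rw [cls_apply, map_sum, Finset.sum_apply, map_zero, Pi.zero_apply] at this
        rw [map_sum, ← this]
        refine Finset.sum_congr rfl fun w _ => ?_
        have e := hφ (List.ofFn w)
        rw [List.length_ofFn] at e
        rw [map_smul, map_smul, Pi.smul_apply, e]
      have := add_mem ht ((Submodule.Quotient.mk_eq_zero _).1 h7)
      rwa [sub_add_cancel] at this
  refine key _ le_rfl ?_
  rw [filt_eq_top hq0 hq h hs]
  exact Submodule.mem_top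

lemma cliffordAct_cls (c : ℂ) (m : ℕ) (t : Tens N m) (i : Fin N) :
    cliffordAct hq0 hq c (gen N q c i) (cls N q m t)
      = wedge N q i (cls N q m t) + kappa N q c m • deriv hq0 hq i (cls N q m t) := by
  rw [cliffordAct, cliffordLift_gen, cliffordGen_of_mem c i (cls_mem_gr m t)]

/-- The endomorphisms of the exterior algebra and of its copy. -/
def endExt (N : ℕ) (q : ℂ) : Module.End ℂ (Exterior N q) ≃ₐ[ℂ] Module.End ℂ (Ext N q) :=
  (toExt N q).toLinearEquiv.conjAlgEquiv ℂ

lemma isCliffordAction_iff (c : ℂ) (act : Clifford N q c →ₐ[ℂ] Module.End ℂ (Exterior N q)) :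
    IsCliffordAction N q c act ↔ ∀ m ≤ N, ∀ (t : Tens N m) (i : Fin N),
      endExt N q (act (gen N q c i)) (cls N q m t)
        = wedge N q i (cls N q m t) + kappa N q c m • deriv hq0 hq i (cls N q m t) := by
  refine forall_congr' fun m => forall_congr' fun _ => forall_congr' fun t =>
    forall_congr' fun i => ?_
  rw [← cls_contract, ← (toExt N q).injective.eq_iff, map_add, map_smul, map_mul, wedge_apply]
  simp only [endExt, cls, LinearMap.comp_apply, AlgEquiv.toLinearMap_apply]
  simp

end

end FRT

end

theorem mainTheorem12 (N : ℕ) (hN : 3 ≤ N) (q : ℂ) (hq0 : q ≠ 0)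
    (hq : ∀ m : ℕ, 1 ≤ m → q ^ m ≠ 1)
    (c : ℂ) (hc : ∃ r : ℝ, r ≠ 0 ∧ c ^ 2 = (r : ℂ)) :
    (∃ act : FRT.Clifford N q c →ₐ[ℂ] Module.End ℂ (FRT.Exterior N q),
      FRT.IsCliffordAction N q c act) ∧
    ∀ act : FRT.Clifford N q c →ₐ[ℂ] Module.End ℂ (FRT.Exterior N q),
      FRT.IsCliffordAction N q c act → Function.Injective act := by
  refine ⟨⟨(FRT.endExt N q).symm.toAlgHom.comp (FRT.cliffordAct hq0 hq c), ?_⟩, fun act hact => ?_⟩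
  · rw [FRT.isCliffordAction_iff (hq0 := hq0) (hq := hq)]
    intro m _ t i
    have := FRT.cliffordAct_cls (hq0 := hq0) (hq := hq) c m t i
    simpa using this
  · rw [FRT.isCliffordAction_iff (hq0 := hq0) (hq := hq)] at hact
    have h : Function.Injective (FRT.endExt N q ∘ act) :=
      FRT.injective_of_action hq0 hq (FRT.isAnti_gen hq0 hq c) (FRT.span_gen_prod c)
        ((FRT.endExt N q).toAlgHom.comp act) hact
    exact h.of_comp
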